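/- Let $\xi_1,\xi_2,\zeta$ be complex-valued random variables, let $0<\alpha<2$, let $(a_n)_{n\ge1}$ be a sequence of the form $a_n=\ell(n)n^{1/\alpha}$ with $\ell:(0,\infty)\to(0,\infty)$ slowly varying (that is, $\lim_{t\to\infty}\ell(tx)/\ell(t)=1$ for all $x>0$), and let $\theta_d$ be a finite Borel measure on the unit sphere $\mathbb S$ of $\mathbb C^2$ (Euclidean norm $\|\cdot\|$). Assume: 1. for every Borel set $D\subseteq\mathbb S$ with $\theta_d(\partial D)=0$ (boundary relative to $\mathbb S$) and every $r>0$, $$\lim_{n\to\infty} n\,\mathbb P\left(\frac{(\xi_1,\xi_2)}{\|(\xi_1,\xi_2)\|}\in D,\ \|(\xi_1,\xi_2)\|\ge r a_n\right)=\theta_d(D)\,m_\alpha([r,\infty)),$$ where $m_\alpha$ is the measure on $(0,\infty)$ with density $\alpha r^{-(1+\alpha)}$; 2. there is $K>0$ with $\mathbb P(|\zeta|\ge t)\le K t^{-\alpha}$ for all $t>0$; 3. there is no $(a,b)\in\mathbb C^2\setminus\{(0,0)\}$ with $\operatorname{supp}(\theta_d)\subseteq\{(z,w)\in\mathbb S: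 az+bw=0\}$; 4. $a_n/n^{1/\alpha}\to c$ as $n\to\infty$ for some constant $c>0$. For each $n\ge1$ let $X_n=(X_{ij})_{i,j=1}^n$ be an $n\times n$ elliptic random matrix with atom variables $(\xi_1,\xi_2),\zeta$; that is, the random elements $X_{ii}$ $(1\le i\le n)$ and $(X_{ij},X_{ji})$ $(1\le i<j\le n)$ are all independent, each pair $(X_{ij},X_{ji})$ with $i<j$ has the distribution of $(\xi_1,\xi_2)$, and each $X_{ii}$ has the distribution of $\zeta$. Put $A_n=\frac1{a_n}X_n$, and let $s_n(M)$ denote the least singular value of an $n\times n$ matrix $M$. Then for every $z\in\mathbb C$ there exist $C,r>0$ such that $$\lim_{n\to\infty}\mathbb P\left(s_n(A_n-zI_n)\le C n^{-r}\right)=0.$$ -/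

import Mathlib

open MeasureTheory ProbabilityTheory Filter Topology
open scoped ENNReal

/-- The unit sphere of `ℂ²` for the Euclidean norm, with its relative topology and Borel
σ-algebra. -/
abbrev UnitSphereC2 : Type :=
  Metric.sphere (0 : EuclideanSpace ℂ (Fin 2)) 1

/-- The measure `m_α` on `(0, ∞)` with density `α r ^ (-(1 + α))`, seen as a measure on `ℝ`. -/
noncomputable def powerMeasure (α : ℝ) : Measure ℝ :=
  (volume.restrict (Set.Ioi 0)).withDensity
    (fun r => ENNReal.ofReal (α * r ^ (-(1 + α))))

/-- Slow variation at infinity, for a positive function on `(0, ∞)`. The values of `ℓ` outside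
`(0, ∞)` play no role. -/
def IsSlowlyVarying (ℓ : ℝ → ℝ) : Prop :=
  (∀ t, 0 < t → 0 < ℓ t) ∧
    ∀ x, 0 < x → Tendsto (fun t => ℓ (t * x) / ℓ t) atTop (𝓝 1)

/-- Condition C1 on the atom variables `(ξ₁, ξ₂), ζ`, with index `α`, normalizing sequence `a` and
dependence measure `θ` (a finite measure on the unit sphere of `ℂ²`). -/
structure ConditionC1 {Ω₀ : Type*} [MeasurableSpace Ω₀] (ν : Measure Ω₀)
    (ξ₁ ξ₂ ζ : Ω₀ → ℂ) (α : ℝ) (a : ℕ → ℝ) (θ : Measure UnitSphereC2) : Prop where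
  pos : 0 < α
  lt_two : α < 2
  finite : IsFiniteMeasure θ
  slowly_varying : ∃ ℓ : ℝ → ℝ, IsSlowlyVarying ℓ ∧
    ∀ n : ℕ, 1 ≤ n → a n = ℓ n * (n : ℝ) ^ (1 / α)
  tail : ∀ D : Set UnitSphereC2, MeasurableSet D → θ (frontier D) = 0 → ∀ r : ℝ, 0 < r →
    Tendsto (fun n : ℕ => (n : ℝ≥0∞) *
        ν {ω | ‖(!₂[ξ₁ ω, ξ₂ ω] : EuclideanSpace ℂ (Fin 2))‖⁻¹ •
                  (!₂[ξ₁ ω, ξ₂ ω] : EuclideanSpace ℂ (Fin 2)) ∈ Subtype.val '' D ∧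
                r * a n ≤ ‖(!₂[ξ₁ ω, ξ₂ ω] : EuclideanSpace ℂ (Fin 2))‖})
      atTop (𝓝 (θ D * powerMeasure α (Set.Ici r)))
  diag_tail : ∃ C : ℝ, 0 < C ∧ ∀ t : ℝ, 0 < t → ν.real {ω | t ≤ ‖ζ ω‖} ≤ C * t ^ (-α)

/-- Condition C2: Condition C1, the support of `θ` lies on no complex line through the origin, and
`a n / n ^ (1 / α)` has a positive limit. -/
structure ConditionC2 {Ω₀ : Type*} [MeasurableSpace Ω₀] (ν : Measure Ω₀)
    (ξ₁ ξ₂ ζ : Ω₀ → ℂ) (α : ℝ) (a : ℕ → ℝ) (θ : Measure UnitSphereC2) : Prop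
    extends ConditionC1 ν ξ₁ ξ₂ ζ α a θ where
  nondegenerate : ¬ ∃ c d : ℂ, (c, d) ≠ (0, 0) ∧
    θ.support ⊆ {p : UnitSphereC2 | c * p.val 0 + d * p.val 1 = 0}
  scaling : ∃ c : ℝ, 0 < c ∧
    Tendsto (fun n : ℕ => a n / (n : ℝ) ^ (1 / α)) atTop (𝓝 c)

/-- An elliptic random matrix with atom variables `(ξ₁, ξ₂), ζ`. The independent family is indexed
by the pairs `i ≤ j`; for `i = j` its member `(X i i, X i i)` carries the same information as
the diagonal entry `X i i`. -/
structure IsEllipticRandomMatrix {Ω₀ Ω : Type*} [MeasurableSpace Ω₀] [MeasurableSpace Ω]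
    (ν : Measure Ω₀) (ξ₁ ξ₂ ζ : Ω₀ → ℂ) (P : Measure Ω) {n : ℕ}
    (X : Ω → Matrix (Fin n) (Fin n) ℂ) : Prop where
  measurable : ∀ i j, Measurable (fun ω => X ω i j)
  indep : iIndepFun (fun (p : {p : Fin n × Fin n // p.1 ≤ p.2}) (ω : Ω) =>
    (X ω p.val.1 p.val.2, X ω p.val.2 p.val.1)) P
  off_diag : ∀ i j, i < j →
    IdentDistrib (fun ω => (X ω i j, X ω j i)) (fun ω => (ξ₁ ω, ξ₂ ω)) P ν
  diag : ∀ i, IdentDistrib (fun ω => X ω i i) ζ P ν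

/-- The least singular value `s_n(A)` of an `n × n` complex matrix. Mathlib numbers the singular
values from `0`, in decreasing order. For `n = 0` the value is `0`. -/
noncomputable def leastSingularValue {n : ℕ} (A : Matrix (Fin n) (Fin n) ℂ) : ℝ :=
  (Matrix.toEuclideanLin A).singularValues (n - 1)

/-! A least singular value below `n ^ (-R)` gives a vector `y` of sup norm one that `M = X - a n *
z` maps to something of size at most a tiny `σ`. Two properties of the atoms suffice to exclude
this. With probability `1 - O(n⁻²)` all entries are at most a fixed power of `n`. Also, no
normalized linear form `c ξ₁ + d ξ₂` concentrates on a ball of radius `ε` with probability above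
some `q < 1`; all forms are needed because the two entries of a symmetric pair are dependent. This
second property follows by compactness, once `c ξ₁ + d ξ₂` is known never to be almost surely
constant (`ConditionC2.not_ae_const`, `exists_spread`). No moments are used.

Let `k` be about `n ^ (9/10)` and call a vector almost sparse if at most `2k` coordinates exceed
`η`, a small power of `n⁻¹`. Almost sparse vectors have a net of size `n ^ O(k)`, while a fixed
vector is mapped near a fixed target with probability at most `q ^ (n - 1)`. So almost surely in the
limit no such vector is nearly null (`IsPairIndep.measure_exists_compressible_le`). The same bound
shows that the rows of the inverse of a minor, and its image of a fixed vector, are not almost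
sparse.

If `y` is not almost sparse, each of more than `2k` large coordinates `a` forces the Schur
complement `M a a - u B v` to be small compared with `‖B‖`, where `B` inverts the minor without `a`
(`norm_schur_le_of_approx_null`). Row `u` and column `v` are dependent, but independent of `B`.
Decoupling turns the bilinear form into linear forms with at least `k` large coefficients, and
Littlewood–Offord bounds their concentration by `O(k ^ (-1/2))`, hence the Schur event by `O(k ^
(-1/4))` (`IsPairIndep.measure_schur_small_le`). Since more than `2k` indices fail together,
averaging over `a` costs only `n / (2k)`, and `(n / k) * k ^ (-1/4)` tends to zero. -/

/-! ### Littlewood–Offord counting for subset sums. -/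

theorem Nat.centralBinom_sq_mul_le (n : ℕ) : n.centralBinom ^ 2 * (2 * n + 1) ≤ 16 ^ n := by
  induction n with
  | zero => simp
  | succ n ih =>
    have h := Nat.succ_mul_centralBinom_succ n
    have h1 : (n + 1) ^ 2 * ((n + 1).centralBinom ^ 2 * (2 * (n + 1) + 1))
        ≤ (n + 1) ^ 2 * 16 ^ (n + 1) := by
      calc (n + 1) ^ 2 * ((n + 1).centralBinom ^ 2 * (2 * (n + 1) + 1))
          = ((n + 1) * (n + 1).centralBinom) ^ 2 * (2 * (n + 1) + 1) := by ring
        _ = (n.centralBinom ^ 2 * (2 * n + 1)) * (4 * (2 * n + 1) * (2 * n + 3)) := by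
            rw [h]; ring
        _ ≤ 16 ^ n * (4 * (2 * n + 1) * (2 * n + 3)) := Nat.mul_le_mul_right _ ih
        _ ≤ 16 ^ n * (16 * (n + 1) ^ 2) := by
            -- The weight `2n + 1` closes the induction because `(2n + 1)(2n + 3) ≤ (2n + 2)²`.
            apply Nat.mul_le_mul_left; nlinarith
        _ = (n + 1) ^ 2 * 16 ^ (n + 1) := by ring
    exact Nat.le_of_mul_le_mul_left h1 (by positivity)

theorem Nat.choose_half_mul_sqrt_le (h : ℕ) :
    (h.choose (h / 2) : ℝ) * Real.sqrt (h + 1) ≤ 2 ^ h := by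
  have key : (h.choose (h / 2)) ^ 2 * (h + 1) ≤ 4 ^ h := by
    rcases Nat.even_or_odd' h with ⟨n, rfl | rfl⟩
    · have := Nat.centralBinom_sq_mul_le n
      rw [Nat.mul_div_cancel_left _ (by norm_num), pow_mul]
      simpa [Nat.centralBinom] using this
    · have h2 : 2 * (2 * n + 1).choose n = (n + 1).centralBinom := by
        have h3 := Nat.choose_symm_half n
        rw [Nat.centralBinom, Nat.mul_succ, Nat.choose_succ_succ, h3]; ring
      have h4 := Nat.centralBinom_sq_mul_le (n + 1)
      have h5 : (2 * n + 1) / 2 = n := by omega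
      rw [h5]
      rw [← h2] at h4
      have h6 : (16 : ℕ) ^ (n + 1) = 4 * 4 ^ (2 * n + 1) := by
        rw [pow_succ, pow_succ, pow_mul]; norm_num; ring
      rw [h6] at h4
      nlinarith
  have key' : ((h.choose (h / 2) : ℝ) * Real.sqrt (h + 1)) ^ 2 ≤ (2 ^ h) ^ 2 := by
    rw [mul_pow, Real.sq_sqrt (by positivity), ← pow_mul, mul_comm h 2, pow_mul]
    norm_num
    exact_mod_cast key
  exact (abs_le.mp (abs_le_of_sq_le_sq key' (by positivity))).2

/-- Erdős' Littlewood–Offord bound for subset sums in which only the coefficients in `G` are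
bounded below. -/
theorem card_subset_sums_mul_sqrt_le {ι : Type*} [Fintype ι] [DecidableEq ι] (r : ι → ℝ)
    (G : Finset ι) (γ x : ℝ) (hG : ∀ i ∈ G, γ < |r i|) :
    (((Finset.univ : Finset (Finset ι)).filter
      fun A => |∑ i ∈ A, r i - x| ≤ γ / 2).card : ℝ) * Real.sqrt (G.card + 1)
      ≤ 2 ^ Fintype.card ι := by
  classical
  set F := (Finset.univ : Finset (Finset ι)).filter fun A => |∑ i ∈ A, r i - x| ≤ γ / 2 with hF
  -- Taking the symmetric difference of `A ∩ G` with `N` replaces each `r i` by `|r i|`, up to a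
  -- constant. With `A \ G` frozen, strict inclusion then raises the sum by more than `γ`, the
  -- length of the window, so each fibre is an antichain and Sperner applies.
  set N := G.filter fun i => r i < 0 with hN
  have hfib : ∀ D ∈ F.image (fun A => A \ G),
      (F.filter fun A => A \ G = D).card ≤ G.card.choose (G.card / 2) := by
    intro D _
    let φ : Finset ι → Finset {i // i ∈ G} := fun A => (symmDiff (A ∩ G) N).subtype (· ∈ G)
    have hmem : ∀ A (i : {i // i ∈ G}), i ∈ φ A ↔ ((i : ι) ∈ A ↔ ¬ r i < 0) := by
      intro A i
      simp only [φ, Finset.mem_subtype, Finset.mem_symmDiff, Finset.mem_inter, hN,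
        Finset.mem_filter, i.2, and_true, true_and]
      tauto
    have hinj : Set.InjOn φ (F.filter fun A => A \ G = D) := by
      intro A hA B hB hAB
      simp only [Finset.coe_filter, Set.mem_ofPred_eq] at hA hB
      ext i
      by_cases hi : i ∈ G
      · have h1 := hmem A ⟨i, hi⟩
        have h2 := hmem B ⟨i, hi⟩
        rw [hAB] at h1
        simp only at h1 h2
        tauto
      · have h1 : i ∈ A ↔ i ∈ A \ G := by simp [hi]
        have h2 : i ∈ B ↔ i ∈ B \ G := by simp [hi]
        rw [h1, h2, hA.2, hB.2]
    rw [← Finset.card_image_of_injOn hinj]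
    have hsum : ∀ A, A \ G = D → ∑ i ∈ A, r i =
        ∑ i ∈ D, r i + ∑ i ∈ N, r i + ∑ i ∈ φ A, |r i| := by
      intro A hA
      have e1 : ∑ i ∈ A, r i = ∑ i ∈ D, r i + ∑ i ∈ A ∩ G, r i := by
        rw [← hA, ← Finset.sum_inter_add_sum_sdiff A G, add_comm]
      have e2 : ∑ i ∈ A ∩ G, r i = ∑ i : {i // i ∈ G}, if (i : ι) ∈ A then r i else 0 := by
        rw [← Finset.sum_subtype G (f := fun i => if i ∈ A then r i else 0) (by simp),
          ← Finset.sum_filter]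
        apply Finset.sum_congr _ (fun _ _ => rfl)
        ext i; simp [and_comm]
      have e3 : ∑ i ∈ N, r i = ∑ i : {i // i ∈ G}, if r i < 0 then r i else 0 := by
        rw [← Finset.sum_subtype G (f := fun i => if r i < 0 then r i else 0) (by simp),
          ← Finset.sum_filter]
      have e4 : ∑ i ∈ φ A, |r i| = ∑ i : {i // i ∈ G}, if i ∈ φ A then |r i| else 0 := by
        rw [← Finset.sum_filter, Finset.filter_mem_eq_inter, Finset.univ_inter]
      rw [e1, add_assoc, e2, e3, e4, ← Finset.sum_add_distrib]
      congr 1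
      apply Finset.sum_congr rfl
      intro i _
      have := hmem A i
      by_cases h1 : (i : ι) ∈ A <;> by_cases h2 : r i < 0
      · have h3 : i ∉ φ A := by tauto
        simp [h1, h2, h3]
      · have h3 : i ∈ φ A := by tauto
        simp [h1, h2, h3, abs_of_nonneg (not_lt.mp h2)]
      · have h3 : i ∈ φ A := by tauto
        simp [h1, h2, h3, abs_of_neg h2]
      · have h3 : i ∉ φ A := by tauto
        simp [h1, h2, h3]
    have hanti : IsAntichain (· ⊆ ·) (((F.filter fun A => A \ G = D).image φ : Finset _) :
        Set (Finset {i // i ∈ G})) := by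
      intro S hS T hT hne hsub
      simp only [Finset.coe_image, Finset.coe_filter, Set.mem_image, Set.mem_ofPred_eq] at hS hT
      obtain ⟨A, ⟨hAF, hA⟩, rfl⟩ := hS
      obtain ⟨B, ⟨hBF, hB⟩, rfl⟩ := hT
      have hAF' := (Finset.mem_filter.mp hAF).2
      have hBF' := (Finset.mem_filter.mp hBF).2
      rw [hsum A hA] at hAF'
      rw [hsum B hB] at hBF'
      obtain ⟨i, hiB, hiA⟩ := Finset.exists_of_ssubset (hsub.ssubset_of_ne hne)
      have h1 : ∑ i ∈ φ A, |r i| + |r i| ≤ ∑ i ∈ φ B, |r i| := by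
        rw [← Finset.sum_sdiff hsub, add_comm]
        gcongr
        exact Finset.single_le_sum (f := fun i : {i // i ∈ G} => |r i|) (fun _ _ => abs_nonneg _)
          (Finset.mem_sdiff.mpr ⟨hiB, hiA⟩)
      have h2 := hG i i.2
      rw [abs_le] at hAF' hBF'
      linarith [hAF'.1, hBF'.2]
    simpa using hanti.sperner
  have hcard := Finset.card_le_mul_card_image (s := F) (f := fun A => A \ G) _ hfib
  have himg : (F.image (fun A => A \ G)).card ≤ 2 ^ (Fintype.card ι - G.card) := by
    rw [← Finset.card_compl, ← Finset.card_powerset]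
    apply Finset.card_le_card
    intro D hD
    obtain ⟨A, _, rfl⟩ := Finset.mem_image.mp hD
    simp only [Finset.mem_powerset]
    intro i hi
    simp only [Finset.mem_sdiff] at hi
    simp [hi.2]
  have h1 := Nat.choose_half_mul_sqrt_le G.card
  have h2 : (F.card : ℝ) ≤ (G.card.choose (G.card / 2) : ℝ) * 2 ^ (Fintype.card ι - G.card) := by
    exact_mod_cast hcard.trans (Nat.mul_le_mul_left _ himg)
  calc (F.card : ℝ) * Real.sqrt (G.card + 1)
      ≤ ((G.card.choose (G.card / 2) : ℝ) * 2 ^ (Fintype.card ι - G.card))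
          * Real.sqrt (G.card + 1) := by gcongr
    _ = ((G.card.choose (G.card / 2) : ℝ) * Real.sqrt (G.card + 1))
          * 2 ^ (Fintype.card ι - G.card) := by ring
    _ ≤ 2 ^ G.card * 2 ^ (Fintype.card ι - G.card) := by gcongr
    _ = 2 ^ Fintype.card ι := by
        rw [← pow_add, Nat.add_sub_cancel' (Finset.card_le_univ G)]

/-- Complex form: the coefficients in `G` have modulus larger than `γ`. -/
theorem card_complex_subset_sums_mul_sqrt_le {ι : Type*} [Fintype ι] [DecidableEq ι] (d : ι → ℂ)
    (G : Finset ι) (γ : ℝ) (x : ℂ) (hG : ∀ i ∈ G, γ < ‖d i‖) :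
    (((Finset.univ : Finset (Finset ι)).filter
      fun A => ‖∑ i ∈ A, d i - x‖ ≤ γ / 4).card : ℝ) * Real.sqrt (G.card / 2)
      ≤ 2 ^ Fintype.card ι := by
  classical
  have aux : ∀ (r : ι → ℝ) (y : ℝ) (G' : Finset ι), G.card ≤ 2 * G'.card →
      (∀ i ∈ G', γ / 2 < |r i|) →
      (∀ A : Finset ι, ‖∑ i ∈ A, d i - x‖ ≤ γ / 4 → |∑ i ∈ A, r i - y| ≤ γ / 4) →
      (((Finset.univ : Finset (Finset ι)).filter
      fun A => ‖∑ i ∈ A, d i - x‖ ≤ γ / 4).card : ℝ) * Real.sqrt (G.card / 2)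
      ≤ 2 ^ Fintype.card ι := by
    intro r y G' hc hG' hA
    refine le_trans ?_ (card_subset_sums_mul_sqrt_le r G' (γ / 2) y hG')
    have hc' : (G.card : ℝ) ≤ 2 * G'.card := by exact_mod_cast hc
    gcongr ?_ * ?_
    · norm_cast
      apply Finset.card_le_card
      intro A
      simp only [Finset.mem_filter, Finset.mem_univ, true_and]
      intro h
      have := hA A h
      linarith
    · apply Real.sqrt_le_sqrt; linarith
  -- A coefficient of modulus above `γ` has real or imaginary part above `γ / 2`, so one of the two
  -- real problems keeps at least half of `G`.
  set G1 := G.filter fun i => γ / 2 < |(d i).re|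
  set G2 := G.filter fun i => γ / 2 < |(d i).im|
  have hun : G ⊆ G1 ∪ G2 := by
    intro i hi
    have h1 := hG i hi
    have h2 := Complex.norm_le_abs_re_add_abs_im (d i)
    simp only [G1, G2, Finset.mem_union, Finset.mem_filter, hi, true_and]
    by_contra! h
    linarith
  have hc := (Finset.card_le_card hun).trans (Finset.card_union_le _ _)
  rcases le_total G1.card G2.card with h | h
  · refine aux (fun i => (d i).im) x.im G2 (by omega) (fun i hi => (Finset.mem_filter.mp hi).2) ?_
    intro A hA
    refine le_trans ?_ hA
    have := Complex.abs_im_le_norm (∑ i ∈ A, d i - x)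
    simpa using this
  · refine aux (fun i => (d i).re) x.re G1 (by omega) (fun i hi => (Finset.mem_filter.mp hi).2) ?_
    intro A hA
    refine le_trans ?_ hA
    have := Complex.abs_re_le_norm (∑ i ∈ A, d i - x)
    simpa using this

/-! ### From counting to small-ball probabilities. -/

/-- If every point of `g` lies in at most `c` of finitely many measurable sets, the measures of
their traces on `g` add up to at most `c`. -/
theorem sum_measureReal_inter_le {Ω κ : Type*} [MeasurableSpace Ω] [Fintype κ] [DecidableEq κ]
    (P : Measure Ω) [IsProbabilityMeasure P] (s : κ → Set Ω) [∀ a ω, Decidable (ω ∈ s a)] (g : Set Ω)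
    (hs : ∀ a, MeasurableSet (s a)) (hg : MeasurableSet g) (c : ℝ) (hc0 : 0 ≤ c)
    (hc : ∀ ω ∈ g, ((Finset.univ.filter fun a => ω ∈ s a).card : ℝ) ≤ c) :
    ∑ a, P.real (s a ∩ g) ≤ c := by
  have h1 : ∀ a, P.real (s a ∩ g) = ∫ ω, (s a ∩ g).indicator (fun _ => (1 : ℝ)) ω ∂P := by
    intro a
    rw [integral_indicator ((hs a).inter hg)]
    simp
  simp_rw [h1]
  rw [← integral_finsetSum _ fun a _ => (integrable_const (1 : ℝ)).indicator ((hs a).inter hg)]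
  calc ∫ ω, ∑ a, (s a ∩ g).indicator (fun _ => (1 : ℝ)) ω ∂P ≤ ∫ _ω, c ∂P := by
        apply integral_mono
        · exact integrable_finsetSum _ fun a _ =>
            (integrable_const (1 : ℝ)).indicator ((hs a).inter hg)
        · exact integrable_const c
        · intro ω
          by_cases hω : ω ∈ g
          · refine le_trans (le_of_eq ?_) (hc ω hω)
            rw [Finset.card_filter, Nat.cast_sum]
            refine Finset.sum_congr rfl fun a _ => ?_
            by_cases ha : ω ∈ s a <;> simp [ha, hω]
          · simp [hω, hc0]
    _ = c := by simp

theorem prod_real_norm_sub_le {E : Type*} [MeasurableSpace E] (μ : Measure E)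
    [IsProbabilityMeasure μ] (w : E → ℂ) (hw : Measurable w) (δ q : ℝ)
    (h : ∀ u, μ.real {y | ‖w y - u‖ ≤ δ} ≤ q) :
    1 - q ≤ (μ.prod μ).real {p | δ < ‖w p.1 - w p.2‖} := by
  have hm : MeasurableSet {p : E × E | ‖w p.1 - w p.2‖ ≤ δ} :=
    measurableSet_le (by fun_prop) (by fun_prop)
  have hq : 0 ≤ q := measureReal_nonneg.trans (h 0)
  have h1 : (μ.prod μ) {p : E × E | ‖w p.1 - w p.2‖ ≤ δ} ≤ ENNReal.ofReal q := by
    rw [Measure.prod_apply_symm hm]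
    calc ∫⁻ y, μ ((fun x => (x, y)) ⁻¹' {p : E × E | ‖w p.1 - w p.2‖ ≤ δ}) ∂μ
        ≤ ∫⁻ _y, ENNReal.ofReal q ∂μ := by
          apply lintegral_mono
          intro y
          exact (ENNReal.le_ofReal_iff_toReal_le (measure_ne_top _ _) hq).mpr (h (w y))
      _ = ENNReal.ofReal q := by simp
  have h2 : {p : E × E | δ < ‖w p.1 - w p.2‖} = {p : E × E | ‖w p.1 - w p.2‖ ≤ δ}ᶜ := by
    ext p; simp
  rw [h2, probReal_compl_eq_one_sub hm]
  have h3 := (ENNReal.le_ofReal_iff_toReal_le (measure_ne_top _ _) hq).mp h1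
  change (μ.prod μ).real _ ≤ q at h3
  linarith

/-- The number of occurrences among independent events of probability at least `p`. -/
theorem pi_real_card_lt_le {ι F : Type*} [Fintype ι] [DecidableEq ι] [MeasurableSpace F]
    (m : ι → Measure F) [∀ i, IsProbabilityMeasure (m i)] (s : ι → Set F)
    [∀ i y, Decidable (y ∈ s i)] (hs : ∀ i, MeasurableSet (s i))
    (T : Finset ι) (p : ℝ) (hp : 0 < p) (hT : T.Nonempty) (h : ∀ i ∈ T, p ≤ (m i).real (s i)) :
    (Measure.pi m).real {y | ((T.filter fun i => y i ∈ s i).card : ℝ) < p * T.card / 2}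
      ≤ 1 / (p ^ 2 * T.card) := by
  have hTc : (0 : ℝ) < T.card := by exact_mod_cast hT.card_pos
  let X : ι → (ι → F) → ℝ := fun i y => (s i).indicator (fun _ => 1) (y i)
  have hXm' : ∀ i, Measurable ((s i).indicator (fun _ => (1 : ℝ))) := fun i =>
    measurable_const.indicator (hs i)
  have hXm : ∀ i, Measurable (X i) := fun i => (hXm' i).comp (measurable_pi_apply i)
  have hX01 : ∀ i y, X i y ∈ Set.Icc (0 : ℝ) 1 := by
    intro i y
    simp only [X, Set.indicator_apply]
    split_ifs <;> simp
  have hXL : ∀ i, MemLp (X i) 2 (Measure.pi m) := fun i =>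
    MemLp.of_bound (hXm i).aestronglyMeasurable 1 (ae_of_all _ fun y => by
      rw [Real.norm_eq_abs, abs_le]; have := hX01 i y; constructor <;> linarith [this.1, this.2])
  have hind : iIndepFun X (Measure.pi m) :=
    iIndepFun_pi (μ := m) (X := fun i => (s i).indicator (fun _ => (1 : ℝ)))
      fun i => (hXm' i).aemeasurable
  have hEX : ∀ i, ∫ y, X i y ∂(Measure.pi m) = (m i).real (s i) := by
    intro i
    have h2 : ∫ y, X i y ∂(Measure.pi m) = ∫ z, (s i).indicator (fun _ => (1 : ℝ)) z ∂(m i) := by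
      rw [← (measurePreserving_eval m i).map_eq, integral_map]
      · exact (measurable_pi_apply i).aemeasurable
      · exact (hXm' i).aestronglyMeasurable
    rw [h2, integral_indicator (hs i)]
    simp
  -- An indicator has variance at most `1/4`; Chebyshev at half of `p * T.card` then suffices.
  have hvar : variance (∑ i ∈ T, X i) (Measure.pi m) ≤ T.card / 4 := by
    rw [IndepFun.variance_sum (fun i _ => hXL i) (fun i _ j _ hij => hind.indepFun hij)]
    calc ∑ i ∈ T, variance (X i) (Measure.pi m) ≤ ∑ i ∈ T, (1 / 4 : ℝ) := by
          apply Finset.sum_le_sum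
          intro i _
          refine (variance_le_sq_of_bounded (ae_of_all _ (hX01 i)) (hXm i).aemeasurable).trans ?_
          norm_num
      _ = T.card / 4 := by rw [Finset.sum_const, nsmul_eq_mul]; ring
  have hmean : p * T.card ≤ ∫ y, (∑ i ∈ T, X i) y ∂(Measure.pi m) := by
    simp only [Finset.sum_apply]
    rw [integral_finsetSum _ fun i _ => (hXL i).integrable (by norm_num)]
    simp_rw [hEX]
    calc p * T.card = ∑ i ∈ T, p := by rw [Finset.sum_const, nsmul_eq_mul]; ring
      _ ≤ _ := Finset.sum_le_sum h
  have hL : MemLp (∑ i ∈ T, X i) 2 (Measure.pi m) := memLp_finsetSum' _ fun i _ => hXL i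
  have hc : 0 < p * T.card / 2 := by positivity
  have hch := meas_ge_le_variance_div_sq hL hc
  have hsub : {y | ((T.filter fun i => y i ∈ s i).card : ℝ) < p * T.card / 2} ⊆
      {y | p * T.card / 2 ≤ |(∑ i ∈ T, X i) y - ∫ y, (∑ i ∈ T, X i) y ∂(Measure.pi m)|} := by
    intro y hy
    simp only [Set.mem_ofPred_eq] at hy ⊢
    have h1 : (∑ i ∈ T, X i) y = ((T.filter fun i => y i ∈ s i).card : ℝ) := by
      simp [X, Set.indicator_apply, Finset.sum_boole]
    rw [h1, abs_sub_comm]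
    refine le_trans ?_ (le_abs_self _)
    linarith
  have h5 : (Measure.pi m).real {y | ((T.filter fun i => y i ∈ s i).card : ℝ) < p * T.card / 2}
      ≤ variance (∑ i ∈ T, X i) (Measure.pi m) / (p * T.card / 2) ^ 2 := by
    refine ENNReal.toReal_le_of_le_ofReal (div_nonneg (variance_nonneg _ _) (by positivity)) ?_
    exact (measure_mono hsub).trans hch
  refine h5.trans ?_
  rw [div_le_div_iff₀ (by positivity) (by positivity)]
  calc variance (∑ i ∈ T, X i) (Measure.pi m) * (p ^ 2 * T.card)
      ≤ T.card / 4 * (p ^ 2 * T.card) := by gcongr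
    _ = 1 * (p * T.card / 2) ^ 2 := by ring

/-- Small-ball bound for a sum of independent complex variables, those indexed by `T` being
non-concentrated at scale `δ`. -/
theorem pi_smallBall_le {ι E : Type*} [Fintype ι] [DecidableEq ι] [MeasurableSpace E]
    (μ : ι → Measure E) [∀ i, IsProbabilityMeasure (μ i)] (w : ι → E → ℂ)
    (hw : ∀ i, Measurable (w i)) (T : Finset ι) (δ q : ℝ) (hT : T.Nonempty) (hq : q < 1)
    (h : ∀ i ∈ T, ∀ u, (μ i).real {y | ‖w i y - u‖ ≤ δ} ≤ q) (x : ℂ) :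
    (Measure.pi μ).real {y | ‖∑ i, w i (y i) - x‖ ≤ δ / 4}
      ≤ 3 / ((1 - q) ^ 2 * Real.sqrt T.card) := by
  classical
  have hTc : (1 : ℝ) ≤ T.card := by exact_mod_cast hT.card_pos
  have hq0 : 0 ≤ q := by
    obtain ⟨i, hi⟩ := hT
    exact measureReal_nonneg.trans (h i hi 0)
  have hp : 0 < 1 - q := by linarith
  let m : ι → Measure (E × E) := fun i => (μ i).prod (μ i)
  -- Symmetrization: draw every coordinate twice and let `A` choose which copy is kept. Each `A`
  -- yields the law `Measure.pi μ`, so the probability may be averaged over `A`. For frozen pairs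
  -- this average is a subset-sum count for the differences, many of which exceed `δ` in modulus on
  -- the event `g`.
  let mix : Finset ι → (ι → E × E) → (ι → E) := fun A p i => if i ∈ A then (p i).1 else (p i).2
  have hmix : ∀ A, MeasurePreserving (mix A) (Measure.pi m) (Measure.pi μ) := by
    intro A
    refine measurePreserving_pi m μ (f := fun i p => if i ∈ A then p.1 else p.2) ?_
    intro i
    by_cases hi : i ∈ A
    · simpa [hi] using! (measurePreserving_fst (μ := μ i) (ν := μ i))
    · simpa [hi] using! (measurePreserving_snd (μ := μ i) (ν := μ i))
  let S : Set (ι → E) := {y | ‖∑ i, w i (y i) - x‖ ≤ δ / 4}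
  have hS : MeasurableSet S := measurableSet_le (by fun_prop) (by fun_prop)
  let s : ι → Set (E × E) := fun i => {p | δ < ‖w i p.1 - w i p.2‖}
  have hs : ∀ i, MeasurableSet (s i) := fun i =>
    measurableSet_lt (by fun_prop) (by fun_prop)
  let g : Set (ι → E × E) :=
    {p | (1 - q) * T.card / 2 ≤ ((T.filter fun i => p i ∈ s i).card : ℝ)}
  have hg : MeasurableSet g := by
    refine measurableSet_le measurable_const ?_
    simp only [Finset.card_filter, Nat.cast_sum]
    refine Finset.measurable_sum _ fun i _ => ?_
    refine Measurable.comp (measurable_of_countable _) ?_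
    exact Measurable.ite ((hs i).preimage (measurable_pi_apply i)) measurable_const
      measurable_const
  have hgc : (Measure.pi m).real gᶜ ≤ 1 / ((1 - q) ^ 2 * T.card) := by
    have := pi_real_card_lt_le m s hs T (1 - q) hp hT fun i hi =>
      prod_real_norm_sub_le (μ i) (w i) (hw i) δ q (h i hi)
    convert! this using 2
    ext p; simp [g]
  have hcount : ∀ p ∈ g, (((Finset.univ : Finset (Finset ι)).filter
      fun A => p ∈ mix A ⁻¹' S).card : ℝ)
      ≤ 2 ^ Fintype.card ι * (2 / Real.sqrt ((1 - q) * T.card)) := by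
    intro p hpg
    have h1 := card_complex_subset_sums_mul_sqrt_le (fun i => w i (p i).1 - w i (p i).2)
      (T.filter fun i => p i ∈ s i) δ (x - ∑ i, w i (p i).2)
      (fun i hi => (Finset.mem_filter.mp hi).2)
    have h2 : ∀ A : Finset ι, p ∈ mix A ⁻¹' S ↔
        ‖∑ i ∈ A, (w i (p i).1 - w i (p i).2) - (x - ∑ i, w i (p i).2)‖ ≤ δ / 4 := by
      intro A
      have h3 : ∑ i, w i (mix A p i) =
          ∑ i ∈ A, (w i (p i).1 - w i (p i).2) + ∑ i, w i (p i).2 := by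
        rw [← Finset.sum_filter_add_sum_filter_not Finset.univ (· ∈ A) (fun i => w i (mix A p i)),
          ← Finset.sum_filter_add_sum_filter_not Finset.univ (· ∈ A) (fun i => w i (p i).2),
          ← add_assoc]
        simp only [Finset.filter_mem_eq_inter, Finset.univ_inter]
        rw [← Finset.sum_add_distrib]
        congr 1
        · apply Finset.sum_congr rfl
          intro i hi
          simp [mix, hi]
        · apply Finset.sum_congr rfl
          intro i hi
          simp [mix, (Finset.mem_filter.mp hi).2]
      simp only [S, Set.mem_preimage, Set.mem_ofPred_eq, h3]
      rw [show ∑ i ∈ A, (w i (p i).1 - w i (p i).2) + ∑ i, w i (p i).2 - x =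
        ∑ i ∈ A, (w i (p i).1 - w i (p i).2) - (x - ∑ i, w i (p i).2) by ring]
    simp_rw [h2]
    have hsq : Real.sqrt ((1 - q) * T.card) / 2
        ≤ Real.sqrt (((T.filter fun i => p i ∈ s i).card : ℝ) / 2) := by
      apply Real.le_sqrt_of_sq_le
      rw [div_pow, Real.sq_sqrt (by positivity)]
      have : (1 - q) * T.card / 2 ≤ ((T.filter fun i => p i ∈ s i).card : ℝ) := hpg
      linarith
    have hpos : 0 < Real.sqrt ((1 - q) * T.card) := Real.sqrt_pos.mpr (by positivity)
    rw [← mul_div_assoc, le_div_iff₀ hpos]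
    have h4 := (mul_le_mul_of_nonneg_left hsq (Nat.cast_nonneg _)).trans h1
    linarith
  have hsum := sum_measureReal_inter_le (Measure.pi m) (fun A => mix A ⁻¹' S) g
    (fun A => hS.preimage (hmix A).measurable) hg _ (by positivity) hcount
  have hA : ∀ A, (Measure.pi μ).real S - 1 / ((1 - q) ^ 2 * T.card)
      ≤ (Measure.pi m).real (mix A ⁻¹' S ∩ g) := by
    intro A
    have h1 : (Measure.pi m).real (mix A ⁻¹' S) = (Measure.pi μ).real S := by
      rw [measureReal_def, measureReal_def, (hmix A).measure_preimage hS.nullMeasurableSet]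
    have h2 : (Measure.pi m).real (mix A ⁻¹' S)
        ≤ (Measure.pi m).real (mix A ⁻¹' S ∩ g) + (Measure.pi m).real gᶜ := by
      refine (measureReal_mono ?_).trans (measureReal_union_le _ _)
      intro p hp
      by_cases hpg : p ∈ g
      · exact Or.inl ⟨hp, hpg⟩
      · exact Or.inr hpg
    linarith
  have hfin := (Finset.sum_le_sum fun A (_ : A ∈ Finset.univ) => hA A).trans hsum
  rw [Finset.sum_const, Finset.card_univ, Fintype.card_finset, nsmul_eq_mul] at hfin
  push_cast at hfin
  have hfin' := le_of_mul_le_mul_left hfin (by positivity)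
  have hsT : 1 ≤ Real.sqrt T.card := Real.one_le_sqrt.mpr hTc
  have e1 : 1 / ((1 - q) ^ 2 * (T.card : ℝ)) ≤ 1 / ((1 - q) ^ 2 * Real.sqrt T.card) := by
    apply one_div_le_one_div_of_le (by positivity)
    gcongr
    exact Real.sqrt_le_iff.mpr ⟨by positivity, by nlinarith⟩
  have e2 : 2 / Real.sqrt ((1 - q) * T.card) ≤ 2 / ((1 - q) ^ 2 * Real.sqrt T.card) := by
    apply div_le_div_of_nonneg_left (by norm_num) (by positivity)
    rw [Real.sqrt_mul hp.le]
    gcongr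
    apply Real.le_sqrt_of_sq_le
    have : (1 - q) ^ 3 ≤ 1 := pow_le_one₀ hp.le (by linarith)
    nlinarith
  have e3 : 3 / ((1 - q) ^ 2 * Real.sqrt T.card) =
      1 / ((1 - q) ^ 2 * Real.sqrt T.card) + 2 / ((1 - q) ^ 2 * Real.sqrt T.card) := by ring
  change (Measure.pi μ).real S ≤ _
  linarith

/-! ### Pair-independent matrices and conditioning on one row and column. -/

/-- A random matrix whose symmetric pairs of entries are independent and, off the diagonal, have
uniformly non-concentrated linear forms. -/
structure IsPairIndep {V Ω : Type*} [LinearOrder V] [MeasurableSpace Ω] (P : Measure Ω)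
    (M : Ω → V → V → ℂ) (ε q : ℝ) : Prop where
  measurable : ∀ i j, Measurable fun ω => M ω i j
  indep : iIndepFun (fun (p : {p : V × V // p.1 ≤ p.2}) ω =>
    (M ω p.1.1 p.1.2, M ω p.1.2 p.1.1)) P
  spread : ∀ i j, i ≠ j → ∀ a b u : ℂ, (1 ≤ ‖a‖ ∨ 1 ≤ ‖b‖) →
    P.real {ω | ‖a * M ω i j + b * M ω j i - u‖ ≤ ε} ≤ q

namespace IsPairIndep

variable {V Ω : Type*} [LinearOrder V] [MeasurableSpace Ω] {P : Measure Ω}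
  {M : Ω → V → V → ℂ} {ε q : ℝ}

theorem submatrix (h : IsPairIndep P M ε q) {W : Type*} [LinearOrder W] (e : W ↪o V) :
    IsPairIndep P (fun ω i j => M ω (e i) (e j)) ε q where
  measurable _ _ := h.measurable _ _
  indep := by
    let g : {p : W × W // p.1 ≤ p.2} → {p : V × V // p.1 ≤ p.2} := fun p =>
      ⟨(e p.1.1, e p.1.2), e.monotone p.2⟩
    have hg : g.Injective := by
      intro p p' hpp
      simp only [g, Subtype.mk.injEq, Prod.mk.injEq, EmbeddingLike.apply_eq_iff_eq] at hpp
      exact Subtype.ext (Prod.ext hpp.1 hpp.2)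
    exact h.indep.precomp hg
  spread i j hij := h.spread _ _ (by simpa using hij)

theorem transpose (h : IsPairIndep P M ε q) : IsPairIndep P (fun ω i j => M ω j i) ε q where
  measurable _ _ := h.measurable _ _
  indep := h.indep.comp (fun _ => Prod.swap) (fun _ => measurable_swap)
  spread i j hij a b u hab := h.spread j i hij.symm a b u hab

/-- `spread` concerns off-diagonal pairs only, so deterministic diagonal shifts are free. This
serves both for subtracting `a n * z` and for the small perturbation that makes minors invertible.
-/
theorem add_diagonal (h : IsPairIndep P M ε q) (c : V → ℂ) :
    IsPairIndep P (fun ω i j => M ω i j + if i = j then c i else 0) ε q where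
  measurable i j := (h.measurable i j).add_const _
  indep := by
    convert h.indep.comp (fun p z => (z.1 + if p.1.1 = p.1.2 then c p.1.1 else 0,
      z.2 + if p.1.1 = p.1.2 then c p.1.2 else 0)) (fun p => by fun_prop) using 3 with p ω
    by_cases hp : p.1.1 = p.1.2 <;> simp [hp, eq_comm]
  spread i j hij a b u hab := by simpa [hij, hij.symm] using h.spread i j hij a b u hab

theorem isProbabilityMeasure (h : IsPairIndep P M ε q) : IsProbabilityMeasure P :=
  h.indep.isProbabilityMeasure

/-- The pair formed by the entries `(k, i)` and `(i, k)`. -/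
def rowCol (M : Ω → V → V → ℂ) (k : V) (i : {i // i ≠ k}) (ω : Ω) : ℂ × ℂ :=
  (M ω k i, M ω i k)

/-- The minor obtained by deleting index `k`, together with the diagonal entry at `k`. -/
def rest (M : Ω → V → V → ℂ) (k : V) (ω : Ω) : ({i // i ≠ k} → {i // i ≠ k} → ℂ) × ℂ :=
  (fun i j => M ω i j, M ω k k)

theorem measurable_rowCol (h : IsPairIndep P M ε q) (k : V) (i : {i // i ≠ k}) :
    Measurable (rowCol M k i) :=
  (h.measurable _ _).prodMk (h.measurable _ _)

theorem measurable_rest (h : IsPairIndep P M ε q) (k : V) : Measurable (rest M k) :=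
  (measurable_pi_lambda _ fun _ => measurable_pi_lambda _ fun _ => h.measurable _ _).prodMk
    (h.measurable _ _)

theorem iIndepFun_rowCol (h : IsPairIndep P M ε q) (k : V) : iIndepFun (rowCol M k) P := by
  classical
  -- The family is indexed by ordered pairs, so the pair attached to `{i, k}` is stored as `(i, k)`
  -- or `(k, i)` and has to be swapped in the first case.
  let g : {i // i ≠ k} → {p : V × V // p.1 ≤ p.2} := fun i =>
    if hi : (i : V) ≤ k then ⟨(i, k), hi⟩ else ⟨(k, i), (not_le.mp hi).le⟩
  have hg : g.Injective := by
    intro i j hij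
    have hi := i.2
    have hj := j.2
    simp only [g] at hij
    split_ifs at hij <;> simp only [Subtype.mk.injEq, Prod.mk.injEq] at hij
    · exact Subtype.ext hij.1
    · exact absurd hij.1 hi
    · exact absurd hij.1.symm hj
    · exact Subtype.ext hij.2
  convert (h.indep.precomp hg).comp (fun i z => if (i : V) ≤ k then z.swap else z) ?_ using 1
  · ext1 i
    ext1 ω
    by_cases hi : (i : V) ≤ k <;> simp [rowCol, g, hi]
  · intro i
    by_cases hi : (i : V) ≤ k
    · simp only [hi, if_true]; exact measurable_swap
    · simp only [hi, if_false]; exact measurable_id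

theorem indepFun_rest_rowCol [Fintype V] (h : IsPairIndep P M ε q) (k : V) :
    IndepFun (rest M k) (fun ω i => rowCol M k i ω) P := by
  classical
  -- The off-diagonal pairs meeting `k`. The diagonal pair `(k, k)` stays in the complement, since
  -- `rest` contains that entry.
  let T : Finset {p : V × V // p.1 ≤ p.2} :=
    Finset.univ.filter fun p => (p.1.1 = k ∨ p.1.2 = k) ∧ p.1.1 ≠ p.1.2
  have hmS : ∀ p : {p : V × V // p.1 ≤ p.2}, ¬ ((p.1.1 = k ∨ p.1.2 = k) ∧ p.1.1 ≠ p.1.2) →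
    p ∈ Tᶜ := by
    intro p hp; simpa [T] using hp
  have hmT : ∀ p : {p : V × V // p.1 ≤ p.2}, ((p.1.1 = k ∨ p.1.2 = k) ∧ p.1.1 ≠ p.1.2) →
    p ∈ T := by
    intro p hp; simpa [T] using hp
  have hST := h.indep.indepFun_finset Tᶜ T disjoint_compl_left fun p =>
    (h.measurable _ _).prodMk (h.measurable _ _)
  let φ : ({p // p ∈ Tᶜ} → ℂ × ℂ) → ({i // i ≠ k} → {i // i ≠ k} → ℂ) × ℂ := fun x =>
    (fun i j => if hij : (i : V) ≤ j
      then (x ⟨⟨(i, j), hij⟩, hmS _ (by simp [i.2, j.2])⟩).1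
      else (x ⟨⟨(j, i), (not_le.mp hij).le⟩, hmS _ (by simp [i.2, j.2])⟩).2,
      (x ⟨⟨(k, k), le_rfl⟩, hmS _ (by simp)⟩).1)
  let ψ : ({p // p ∈ T} → ℂ × ℂ) → ({i // i ≠ k} → ℂ × ℂ) := fun x i =>
    if hi : (i : V) ≤ k then (x ⟨⟨(i, k), hi⟩, hmT _ ⟨Or.inr rfl, i.2⟩⟩).swap
    else x ⟨⟨(k, i), (not_le.mp hi).le⟩, hmT _ ⟨Or.inl rfl, i.2.symm⟩⟩
  have hφ : Measurable φ := by
    refine Measurable.prodMk ?_ (by fun_prop)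
    refine measurable_pi_lambda _ fun i => measurable_pi_lambda _ fun j => ?_
    by_cases hij : (i : V) ≤ j
    · simp only [hij, dif_pos]; fun_prop
    · simp only [hij, dif_neg, not_false_iff]; fun_prop
  have hψ : Measurable ψ := by
    refine measurable_pi_lambda _ fun i => ?_
    by_cases hi : (i : V) ≤ k
    · simp only [ψ, hi, dif_pos]; exact measurable_swap.comp (measurable_pi_apply _)
    · simp only [ψ, hi, dif_neg, not_false_iff]; exact measurable_pi_apply _
  convert hST.comp hφ hψ using 1
  · ext1 ω
    simp only [rest, φ, Function.comp_apply]
    congr 1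
    ext i j
    split_ifs <;> rfl
  · ext1 ω
    ext1 i
    simp only [rowCol, ψ, Function.comp_apply]
    split_ifs <;> rfl

/-- Conditioning on all entries outside row and column `k`. -/
theorem measure_split [Fintype V] (h : IsPairIndep P M ε q) (k : V)
    {A : Set ((({i // i ≠ k} → {i // i ≠ k} → ℂ) × ℂ) × ({i // i ≠ k} → ℂ × ℂ))}
    (hA : MeasurableSet A) :
    P {ω | (rest M k ω, fun i => rowCol M k i ω) ∈ A} =
      ∫⁻ ω, Measure.pi (fun i => P.map (rowCol M k i)) {y | (rest M k ω, y) ∈ A} ∂P := by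
  have := h.isProbabilityMeasure
  have hY : Measurable fun ω i => rowCol M k i ω :=
    measurable_pi_lambda _ fun i => h.measurable_rowCol k i
  have hZ := h.measurable_rest k
  have : ∀ i, IsProbabilityMeasure (P.map (rowCol M k i)) := fun i =>
    Measure.isProbabilityMeasure_map (h.measurable_rowCol k i).aemeasurable
  have h1 := (h.indepFun_rest_rowCol k).map_prod_eq_prod_map_map hZ.aemeasurable hY.aemeasurable
  rw [(h.iIndepFun_rowCol k).map_fun_eq_pi_map fun i => (h.measurable_rowCol k i).aemeasurable]
    at h1
  have h2 : P {ω | (rest M k ω, fun i => rowCol M k i ω) ∈ A} =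
      P.map (fun ω => (rest M k ω, fun i => rowCol M k i ω)) A :=
    (Measure.map_apply (hZ.prodMk hY) hA).symm
  rw [h2, h1, Measure.prod_apply hA, lintegral_map (measurable_measure_prodMk_left hA) hZ]
  rfl

theorem spread_rowCol (h : IsPairIndep P M ε q) (k : V) (i : {i // i ≠ k}) (a b u : ℂ)
    (hab : 1 ≤ ‖a‖ ∨ 1 ≤ ‖b‖) :
    (P.map (rowCol M k i)).real {y | ‖a * y.1 + b * y.2 - u‖ ≤ ε} ≤ q := by
  rw [map_measureReal_apply (h.measurable_rowCol k i)
    (measurableSet_le (by fun_prop) (by fun_prop))]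
  exact h.spread k i i.2.symm a b u hab

end IsPairIndep

/-! ### Nets: almost sparse vectors are not nearly null. -/

theorem Complex.exists_finset_grid (R η : ℝ) (hη : 0 < η) :
    ∃ G : Finset ℂ, G.card ≤ (2 * ⌈R / η⌉₊ + 1) ^ 2 ∧ ∀ z : ℂ, ‖z‖ ≤ R → ∃ g ∈ G, ‖z - g‖ ≤ η := by
  classical
  set m := ⌈R / η⌉₊ with hm
  let I : Finset ℤ := Finset.Icc (-(m : ℤ)) m
  have hI : I.card = 2 * m + 1 := by
    simp only [I, Int.card_Icc]; omega
  refine ⟨(I ×ˢ I).image fun p => ⟨η * p.1, η * p.2⟩, ?_, ?_⟩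
  · refine Finset.card_image_le.trans ?_
    rw [Finset.card_product, hI, sq]
  · intro z hz
    have key : ∀ s : ℝ, |s| ≤ R → round (s / η) ∈ I ∧ |s - η * round (s / η)| ≤ η / 2 := by
      intro s hs
      constructor
      · have h1 : |s / η| ≤ m := by
          rw [abs_div, abs_of_pos hη]
          exact (div_le_div_of_nonneg_right hs hη.le).trans (Nat.le_ceil _)
        rw [abs_le] at h1
        simp only [I, Finset.mem_Icc]
        have h2 := abs_sub_round (s / η)
        rw [abs_le] at h2
        constructor
        · have : (-(m : ℤ) : ℝ) - 1 < round (s / η) := by push_cast; linarith [h1.1, h2.2]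
          have : -(m : ℤ) - 1 < round (s / η) := by exact_mod_cast this
          omega
        · have : (round (s / η) : ℝ) < (m : ℤ) + 1 := by push_cast; linarith [h1.2, h2.1]
          have : round (s / η) < (m : ℤ) + 1 := by exact_mod_cast this
          omega
      · have h2 := abs_sub_round (s / η)
        have h3 : s - η * round (s / η) = η * (s / η - round (s / η)) := by field_simp
        rw [h3, abs_mul, abs_of_pos hη]
        nlinarith
    obtain ⟨h1, h2⟩ := key z.re ((Complex.abs_re_le_norm z).trans hz)
    obtain ⟨h3, h4⟩ := key z.im ((Complex.abs_im_le_norm z).trans hz)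
    refine ⟨_, Finset.mem_image_of_mem _ (Finset.mk_mem_product h1 h3), ?_⟩
    refine (Complex.norm_le_abs_re_add_abs_im _).trans ?_
    simp only [Complex.sub_re, Complex.sub_im]
    linarith

namespace IsPairIndep

variable {V Ω : Type*} [LinearOrder V] [Fintype V] [MeasurableSpace Ω] {P : Measure Ω}
  {M : Ω → V → V → ℂ} {ε q : ℝ}

/-- Freeze everything outside row and column `k`. For each `i ≠ k`, coordinate `i` of `M x` contains
the fresh term `M i k * x k`, and these terms are independent, so the bounds multiply. Coordinate
`k` is discarded because its entries are paired with the others; hence the exponent `n - 1`. -/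
theorem measure_forall_norm_sub_le (h : IsPairIndep P M ε q) (hq : 0 ≤ q) (x : V → ℂ) (k : V)
    (hx : 1 ≤ ‖x k‖) (c : V → ℂ) :
    P {ω | ∀ i, ‖∑ j, M ω i j * x j - c i‖ ≤ ε} ≤ ENNReal.ofReal q ^ (Fintype.card V - 1) := by
  have := h.isProbabilityMeasure
  have : ∀ i, IsProbabilityMeasure (P.map (rowCol M k i)) := fun i =>
    Measure.isProbabilityMeasure_map (h.measurable_rowCol k i).aemeasurable
  let A : Set ((({i // i ≠ k} → {i // i ≠ k} → ℂ) × ℂ) × ({i // i ≠ k} → ℂ × ℂ)) :=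
    {p | ∀ i : {i // i ≠ k},
      ‖0 * (p.2 i).1 + x k * (p.2 i).2 - (c i - ∑ j, p.1.1 i j * x j)‖ ≤ ε}
  have hA : MeasurableSet A := by
    simp only [A, Set.ofPred_forall]
    refine MeasurableSet.iInter fun i => measurableSet_le (by fun_prop) (by fun_prop)
  have hsub : {ω | ∀ i, ‖∑ j, M ω i j * x j - c i‖ ≤ ε} ⊆
      {ω | (rest M k ω, fun i => rowCol M k i ω) ∈ A} := by
    intro ω hω i
    refine le_trans (le_of_eq ?_) (hω i)
    rw [Fintype.sum_eq_add_sum_subtype_ne _ k]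
    simp only [rest, rowCol]
    congr 1
    ring
  refine (measure_mono hsub).trans ?_
  rw [h.measure_split k hA]
  calc ∫⁻ ω, Measure.pi (fun i => P.map (rowCol M k i)) {y | (rest M k ω, y) ∈ A} ∂P
      ≤ ∫⁻ _ω, ENNReal.ofReal q ^ (Fintype.card V - 1) ∂P := by
        refine lintegral_mono fun ω => ?_
        have hset : {y | (rest M k ω, y) ∈ A} = Set.univ.pi fun i : {i // i ≠ k} =>
            {y : ℂ × ℂ | ‖0 * y.1 + x k * y.2 -
              (c i - ∑ j, (rest M k ω).1 i j * x j)‖ ≤ ε} := by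
          ext y; simp [A, Set.mem_pi]
        rw [hset, Measure.pi_pi]
        refine (Finset.prod_le_pow_card _ _ (ENNReal.ofReal q) fun i _ => ?_).trans ?_
        · exact (ENNReal.le_ofReal_iff_toReal_le (measure_ne_top _ _) hq).mpr
            (h.spread_rowCol k i _ _ _ (Or.inr hx))
        · rw [Finset.card_univ]
          simp [Fintype.card_subtype_compl]
    _ = _ := by simp

/-- Net bound: no vector that is nearly supported on `l` coordinates is mapped close to the line
spanned by `w`. -/
theorem measure_exists_compressible_le (h : IsPairIndep P M ε q) (hq : 0 ≤ q) (hε : ε ≤ 1)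
    (K η : ℝ) (hK : 0 ≤ K) (hη0 : 0 < η) (hη2 : η ≤ 1 / 2)
    (hη : (Fintype.card V * K + 1) * η ≤ ε / 4) (l : ℕ) (hl : l ≤ Fintype.card V)
    (w : V → ℂ) (hw : ∀ i, ‖w i‖ ≤ 1) (hw1 : ∃ i, ‖w i‖ = 1) :
    P {ω | (∀ i j, ‖M ω i j‖ ≤ K) ∧ ∃ (y : V → ℂ) (t : ℂ), (∀ j, ‖y j‖ ≤ 1) ∧ (∃ j, ‖y j‖ = 1) ∧
        (Finset.univ.filter fun j => η ≤ ‖y j‖).card ≤ l ∧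
        ∀ i, ‖∑ j, M ω i j * y j - t * w i‖ ≤ ε / 4} ≤
      ((Fintype.card V ^ l * ((2 * ⌈(Fintype.card V * K + 1) / η⌉₊ + 1) ^ 2) ^ (l + 1) : ℕ) : ℝ≥0∞)
        * ENNReal.ofReal q ^ (Fintype.card V - 1) := by
  classical
  set n := Fintype.card V with hn
  obtain ⟨G, hGc, hG⟩ := Complex.exists_finset_grid (n * K + 1) η hη0
  set g := (2 * ⌈(n * K + 1) / η⌉₊ + 1) ^ 2 with hg
  -- Rounding a vector of sup norm one leaves a coordinate of modulus at least `1/2`. Doubling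
  -- restores the modulus `1` required for a fixed vector, and turns the error `ε/4 + (nK + 1)η ≤
  -- ε/2` into `ε`.
  let X : Finset V → Finset (V → ℂ) := fun S =>
    (Fintype.piFinset fun j => if j ∈ S then G else {0}).filter fun x => ∃ k, 1 ≤ ‖2 * x k‖
  let N : Finset ((V → ℂ) × ℂ) :=
    ((Finset.univ.powersetCard l).biUnion X) ×ˢ G
  have hXc : ∀ S ∈ (Finset.univ : Finset V).powersetCard l, (X S).card ≤ g ^ l := by
    intro S hS
    refine (Finset.card_filter_le _ _).trans ?_
    rw [Fintype.card_piFinset]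
    simp only [apply_ite Finset.card, Finset.card_singleton]
    rw [Finset.prod_ite_mem, Finset.univ_inter, Finset.prod_const,
      (Finset.mem_powersetCard.mp hS).2]
    exact Nat.pow_le_pow_left hGc l
  have hNc : N.card ≤ n ^ l * g ^ (l + 1) := by
    rw [Finset.card_product, pow_succ, ← mul_assoc]
    refine Nat.mul_le_mul ?_ hGc
    refine (Finset.card_biUnion_le_card_mul _ _ _ hXc).trans ?_
    rw [Finset.card_powersetCard, Finset.card_univ]
    exact Nat.mul_le_mul_right _ (Nat.choose_le_pow _ _)
  have hcover : {ω | (∀ i j, ‖M ω i j‖ ≤ K) ∧ ∃ (y : V → ℂ) (t : ℂ), (∀ j, ‖y j‖ ≤ 1) ∧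
        (∃ j, ‖y j‖ = 1) ∧ (Finset.univ.filter fun j => η ≤ ‖y j‖).card ≤ l ∧
        ∀ i, ‖∑ j, M ω i j * y j - t * w i‖ ≤ ε / 4} ⊆
      ⋃ p ∈ N, {ω | ∀ i, ‖∑ j, M ω i j * (2 * p.1 j) - 2 * p.2 * w i‖ ≤ ε} := by
    rintro ω ⟨hMK, y, t, hy, ⟨j0, hj0⟩, hcard, hres⟩
    obtain ⟨S, hS1, -, hS2⟩ := Finset.exists_subsuperset_card_eq
      (Finset.subset_univ (Finset.univ.filter fun j => η ≤ ‖y j‖)) hcard (by simpa using hl)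
    have hnK : 0 ≤ (n : ℝ) * K := by positivity
    have hex : ∀ j, ∃ a ∈ G, ‖y j - a‖ ≤ η := fun j => hG _ ((hy j).trans (by linarith))
    choose a haG ha using hex
    let x : V → ℂ := fun j => if j ∈ S then a j else 0
    have hx : ∀ j, ‖x j - y j‖ ≤ η := by
      intro j
      by_cases hj : j ∈ S
      · simp only [x, hj, if_true]; rw [norm_sub_rev]; exact ha j
      · simp only [x, hj, if_false, zero_sub, norm_neg]
        by_contra hlt
        exact hj (hS1 (by simp; linarith))
    have hMv : ∀ i (v : V → ℂ) (b : ℝ), (∀ j, ‖v j‖ ≤ b) → ‖∑ j, M ω i j * v j‖ ≤ n * K * b := by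
      intro i v b hv
      refine (norm_sum_le _ _).trans ?_
      calc ∑ j, ‖M ω i j * v j‖ ≤ ∑ _j : V, K * b := by
            apply Finset.sum_le_sum
            intro j _
            rw [norm_mul]
            exact mul_le_mul (hMK i j) (hv j) (norm_nonneg _) hK
        _ = n * K * b := by rw [Finset.sum_const, Finset.card_univ, nsmul_eq_mul]; ring
    obtain ⟨i0, hi0⟩ := hw1
    -- A coordinate where `w` has modulus one bounds `t` by the image of `y`, so `t` can be put in
    -- the same grid.
    have ht : ‖t‖ ≤ n * K + 1 := by
      have h1 : ‖t * w i0‖ ≤ ‖∑ j, M ω i0 j * y j‖ + ε / 4 := by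
        have := hres i0
        rw [norm_sub_rev] at this
        calc ‖t * w i0‖ = ‖(t * w i0 - ∑ j, M ω i0 j * y j) + ∑ j, M ω i0 j * y j‖ := by ring_nf
          _ ≤ ‖t * w i0 - ∑ j, M ω i0 j * y j‖ + ‖∑ j, M ω i0 j * y j‖ := norm_add_le _ _
          _ ≤ _ := by linarith
      rw [norm_mul, hi0, mul_one] at h1
      linarith [hMv i0 y 1 hy]
    obtain ⟨t', ht'G, ht'⟩ := hG t ht
    have hxk : ∃ k, 1 ≤ ‖2 * x k‖ := by
      refine ⟨j0, ?_⟩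
      have h1 := hx j0
      have h2 : ‖y j0‖ ≤ ‖x j0‖ + ‖x j0 - y j0‖ := by
        calc ‖y j0‖ = ‖x j0 - (x j0 - y j0)‖ := by ring_nf
          _ ≤ _ := norm_sub_le _ _
      rw [norm_mul]; simp
      linarith
    refine Set.mem_biUnion (x := (x, t')) ?_ ?_
    · simp only [N, Finset.coe_product, Set.mem_prod, Finset.mem_coe, Finset.mem_biUnion]
      refine ⟨⟨S, by simp [Finset.mem_powersetCard, hS2], ?_⟩, ht'G⟩
      simp only [X, Finset.mem_filter, Fintype.mem_piFinset]
      refine ⟨fun j => ?_, hxk⟩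
      by_cases hj : j ∈ S <;> simp [x, hj, haG]
    · intro i
      simp only
      have e1 : ∑ j, M ω i j * (2 * x j) - 2 * t' * w i =
          2 * ((∑ j, M ω i j * y j - t * w i) + (∑ j, M ω i j * (x j - y j)) + (t - t') * w i) := by
        have e2 : ∑ j, M ω i j * (2 * x j) = 2 * ∑ j, M ω i j * x j := by
          rw [Finset.mul_sum]; exact Finset.sum_congr rfl fun _ _ => by ring
        simp only [mul_sub, Finset.sum_sub_distrib]
        rw [e2]; ring
      rw [e1, norm_mul]
      have h1 := hres i
      have h2 := hMv i (fun j => x j - y j) η hx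
      have h3 : ‖(t - t') * w i‖ ≤ η := by
        rw [norm_mul]
        calc ‖t - t'‖ * ‖w i‖ ≤ η * 1 := mul_le_mul ht' (hw i) (norm_nonneg _) hη0.le
          _ = η := mul_one _
      have h4 := norm_add₃_le (a := ∑ j, M ω i j * y j - t * w i)
        (b := ∑ j, M ω i j * (x j - y j)) (c := (t - t') * w i)
      simp only [Complex.norm_ofNat]
      linarith
  refine (measure_mono hcover).trans ((measure_biUnion_finset_le _ _).trans ?_)
  calc ∑ p ∈ N, P {ω | ∀ i, ‖∑ j, M ω i j * (2 * p.1 j) - 2 * p.2 * w i‖ ≤ ε}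
      ≤ ∑ _p ∈ N, ENNReal.ofReal q ^ (n - 1) := by
        apply Finset.sum_le_sum
        intro p hp
        simp only [N, Finset.mem_product, Finset.mem_biUnion, X, Finset.mem_filter] at hp
        obtain ⟨⟨S, -, -, k, hk⟩, -⟩ := hp
        exact h.measure_forall_norm_sub_le hq (fun j => 2 * p.1 j) k hk _
    _ = (N.card : ℝ≥0∞) * ENNReal.ofReal q ^ (n - 1) := by rw [Finset.sum_const, nsmul_eq_mul]
    _ ≤ _ := by gcongr

end IsPairIndep

/-! ### Decoupling and concentration of bilinear forms. -/

/-- Every `f ≥ 0` satisfies `f ≤ s + f² / s`. Taking for `f` the measure of a section of `A`, `f²`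
is the probability that two independent copies both lie in it. This plays the role of
Cauchy–Schwarz, with a free threshold and additive error terms. -/
theorem prod_measure_le_add_inv_mul {E₁ E₂ : Type*} [MeasurableSpace E₁] [MeasurableSpace E₂]
    (μ₁ : Measure E₁) (μ₂ : Measure E₂) [IsProbabilityMeasure μ₁] [IsProbabilityMeasure μ₂]
    {A : Set (E₁ × E₂)} (hA : MeasurableSet A) {s : ℝ} (hs : 0 < s) :
    (μ₁.prod μ₂) A ≤ ENNReal.ofReal s + ENNReal.ofReal s⁻¹ *
      ((μ₁.prod μ₁).prod μ₂) {p | (p.1.1, p.2) ∈ A ∧ (p.1.2, p.2) ∈ A} := by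
  have hA2 : MeasurableSet {p : (E₁ × E₁) × E₂ | (p.1.1, p.2) ∈ A ∧ (p.1.2, p.2) ∈ A} :=
    (hA.preimage (f := fun p : (E₁ × E₁) × E₂ => (p.1.1, p.2)) (by fun_prop)).inter
      (hA.preimage (f := fun p : (E₁ × E₁) × E₂ => (p.1.2, p.2)) (by fun_prop))
  rw [Measure.prod_apply_symm hA, Measure.prod_apply_symm hA2]
  have hmeas : Measurable fun b => μ₁ ((fun a => (a, b)) ⁻¹' A) := measurable_measure_prodMk_right hA
  have hsl : ∀ b, (μ₁.prod μ₁) ((fun p : E₁ × E₁ => (p, b)) ⁻¹'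
      {p : (E₁ × E₁) × E₂ | (p.1.1, p.2) ∈ A ∧ (p.1.2, p.2) ∈ A}) =
      μ₁ ((fun a => (a, b)) ⁻¹' A) * μ₁ ((fun a => (a, b)) ⁻¹' A) := by
    intro b
    rw [← Measure.prod_prod]
    rfl
  simp_rw [hsl]
  rw [← lintegral_const_mul _ (hmeas.fun_mul hmeas)]
  calc ∫⁻ b, μ₁ ((fun a => (a, b)) ⁻¹' A) ∂μ₂
      ≤ ∫⁻ b, (ENNReal.ofReal s + ENNReal.ofReal s⁻¹ *
          (μ₁ ((fun a => (a, b)) ⁻¹' A) * μ₁ ((fun a => (a, b)) ⁻¹' A))) ∂μ₂ := by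
        refine lintegral_mono fun b => ?_
        set f := μ₁ ((fun a => (a, b)) ⁻¹' A)
        have hf : f ≠ ∞ := measure_ne_top _ _
        change f ≤ ENNReal.ofReal s + ENNReal.ofReal s⁻¹ * (f * f)
        rw [← ENNReal.ofReal_toReal hf, ← ENNReal.ofReal_mul ENNReal.toReal_nonneg,
          ← ENNReal.ofReal_mul (by positivity), ← ENNReal.ofReal_add hs.le (by positivity)]
        apply ENNReal.ofReal_le_ofReal
        have h0 : 0 ≤ f.toReal := ENNReal.toReal_nonneg
        have h1 : s * (s⁻¹ * (f.toReal * f.toReal)) = f.toReal * f.toReal := by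
          field_simp
        by_contra! hlt
        have h3 : 0 ≤ s⁻¹ * (f.toReal * f.toReal) := by positivity
        have h4 : s < f.toReal := by linarith
        have h5 : s⁻¹ * (f.toReal * f.toReal) < f.toReal := by linarith
        nlinarith
    _ = _ := by rw [lintegral_add_left measurable_const]; simp

theorem prod_measure_le_add {E₁ E₂ : Type*} [MeasurableSpace E₁] [MeasurableSpace E₂]
    (μ : Measure E₁) (ν : Measure E₂) [IsProbabilityMeasure μ] [IsProbabilityMeasure ν]
    {C : Set (E₁ × E₂)} (hC : MeasurableSet C) (D : Set E₁) (c : ℝ≥0∞)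
    (h : ∀ p, p ∉ D → ν {b | (p, b) ∈ C} ≤ c) : (μ.prod ν) C ≤ μ D + c := by
  rw [Measure.prod_apply hC]
  have hD := measurableSet_toMeasurable μ D
  calc ∫⁻ p, ν (Prod.mk p ⁻¹' C) ∂μ
      ≤ ∫⁻ p, ((toMeasurable μ D).indicator 1 p + c) ∂μ := by
        refine lintegral_mono fun p => ?_
        by_cases hp : p ∈ toMeasurable μ D
        · simp only [hp, Set.indicator_of_mem, Pi.one_apply]
          exact prob_le_one.trans le_self_add
        · simp only [hp, not_false_iff, Set.indicator_of_notMem, zero_add]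
          exact h p fun hpD => hp (subset_toMeasurable _ _ hpD)
    _ = μ D + c := by
        rw [lintegral_add_right _ measurable_const, lintegral_indicator_one hD,
          measure_toMeasurable]
        simp

theorem sum_eq_sum_mem_add_sum_notMem {W : Type*} [Fintype W] [DecidableEq W] (I : Finset W)
    (f : W → ℂ) : ∑ j, f j = ∑ j : {j // j ∈ I}, f j + ∑ j : {j // j ∉ I}, f j := by
  rw [← Fintype.sum_subtype_add_sum_subtype (· ∈ I)]
  congr!

/-- The vector equal on `I` to the difference of the second components of `a` and `a'`, and to `0`
elsewhere. -/
def sndDiff {W : Type*} [DecidableEq W] (I : Finset W) (p : ({i // i ∈ I} → ℂ × ℂ) × ({i // i ∈ I} → ℂ × ℂ)) (i : W) : ℂ :=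
  if h : i ∈ I then (p.1 ⟨i, h⟩).2 - (p.2 ⟨i, h⟩).2 else 0

theorem measurable_sndDiff {W : Type*} [DecidableEq W] (I : Finset W) : Measurable (sndDiff I) := by
  refine measurable_pi_lambda _ fun i => ?_
  by_cases h : i ∈ I
  · simp only [sndDiff, h, dif_pos]; fun_prop
  · simp only [sndDiff, h, dif_neg, not_false_iff]; fun_prop

section QuadraticForm

variable {W : Type*} [Fintype W] [DecidableEq W] {ε q : ℝ}

/-- Dividing by `r` brings one coefficient of each pair in `T` to modulus at least one, the
normalization of the spread hypothesis. -/
theorem pi_linearForm_smallBall_le (μ : W → Measure (ℂ × ℂ)) [∀ i, IsProbabilityMeasure (μ i)]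
    (hq : q < 1) (hμ : ∀ i (a b u : ℂ), (1 ≤ ‖a‖ ∨ 1 ≤ ‖b‖) →
      (μ i).real {y | ‖a * y.1 + b * y.2 - u‖ ≤ ε} ≤ q)
    (a b : W → ℂ) (T : Finset W) {r : ℝ} (hr : 0 < r) {k : ℕ} (hk : 0 < k) (hkT : k ≤ T.card)
    (hT : ∀ i ∈ T, r ≤ ‖a i‖ ∨ r ≤ ‖b i‖) (x : ℂ) :
    (Measure.pi μ) {y | ‖∑ i, (a i * (y i).1 + b i * (y i).2) - x‖ ≤ r * ε / 4}
      ≤ ENNReal.ofReal (3 / ((1 - q) ^ 2 * Real.sqrt k)) := by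
  have hp : 0 < 1 - q := by linarith
  have hkr : (0 : ℝ) < k := by exact_mod_cast hk
  have hTne : T.Nonempty := Finset.card_pos.mp (by omega)
  have hrc : ((r : ℝ) : ℂ) ≠ 0 := by exact_mod_cast hr.ne'
  have h1 := pi_smallBall_le μ (fun i y => a i * y.1 + b i * y.2) (fun i => by fun_prop) T
    (r * ε) q hTne hq ?_ x
  · rw [ENNReal.le_ofReal_iff_toReal_le (measure_ne_top _ _) (by positivity)]
    refine h1.trans ?_
    gcongr
  · intro i hi u
    refine le_trans (measureReal_mono ?_) (hμ i (a i / r) (b i / r) (u / r) ?_)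
    · intro y hy
      simp only [Set.mem_ofPred_eq] at hy ⊢
      have : a i / r * y.1 + b i / r * y.2 - u / r = (a i * y.1 + b i * y.2 - u) / r := by
        field_simp
      rw [this, norm_div, Complex.norm_real, Real.norm_eq_abs, abs_of_pos hr, div_le_iff₀ hr]
      linarith
    · simp only [norm_div, Complex.norm_real, Real.norm_eq_abs, abs_of_pos hr]
      rw [one_le_div hr, one_le_div hr]
      exact hT i hi

/-- Decoupling bound for the concentration of a bilinear form in independent pairs. -/
theorem pi_bilinearForm_smallBall_le (μ : W → Measure (ℂ × ℂ)) [∀ i, IsProbabilityMeasure (μ i)]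
    (hε : 0 < ε) (hq : q < 1) (hμ : ∀ i (a b u : ℂ), (1 ≤ ‖a‖ ∨ 1 ≤ ‖b‖) →
      (μ i).real {y | ‖a * y.1 + b * y.2 - u‖ ≤ ε} ≤ q)
    (B : Matrix W W ℂ) (m : ℂ) {β η s : ℝ} (hβ : 0 < β) (hη : 0 < η) (hs : 0 < s)
    {k : ℕ} (hk : 0 < k) (I : Finset W) (hI : I.card = k) (i₀ : W)
    (hi₀ : ∀ j ∈ I, η * β ≤ ‖B i₀ j‖) :
    (Measure.pi μ) {y | ‖m - ∑ i, ∑ j, (y i).1 * B i j * (y j).2‖ ≤ ε ^ 2 * η ^ 2 / 32 * β} ≤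
      ENNReal.ofReal s + ENNReal.ofReal s⁻¹ *
        (2 * ENNReal.ofReal (3 / ((1 - q) ^ 2 * Real.sqrt k)) +
          ((Measure.pi fun i : {i // i ∈ I} => μ i).prod (Measure.pi fun i : {i // i ∈ I} => μ i))
            {p | sndDiff I p ≠ 0 ∧ (Finset.univ.filter fun j =>
              η * ‖B.mulVec (sndDiff I p)‖ ≤ ‖B.mulVec (sndDiff I p) j‖).card ≤ 2 * k}) := by
  set f := ENNReal.ofReal (3 / ((1 - q) ^ 2 * Real.sqrt k)) with hf
  set μI := Measure.pi fun i : {i // i ∈ I} => μ i with hμI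
  set μJ := Measure.pi fun i : {i // i ∉ I} => μ i with hμJ
  -- Chosen so that `2 * ρ * β = r * ε / 4` for `r = η * (η * β * ε / 4)`, the size guaranteed below
  -- for the large coefficients of the decoupled form.
  set ρ := ε ^ 2 * η ^ 2 / 32 with hρ
  set Bad := {p | sndDiff I p ≠ 0 ∧ (Finset.univ.filter fun j =>
              η * ‖B.mulVec (sndDiff I p)‖ ≤ ‖B.mulVec (sndDiff I p) j‖).card ≤ 2 * k} with hBad
  let S : Set (W → ℂ × ℂ) := {y | ‖m - ∑ i, ∑ j, (y i).1 * B i j * (y j).2‖ ≤ ρ * β}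
  have hS : MeasurableSet S := measurableSet_le (by fun_prop) (by fun_prop)
  let e := MeasurableEquiv.piEquivPiSubtypeProd (fun _ : W => ℂ × ℂ) (· ∈ I)
  have he : MeasurePreserving e.symm (μI.prod μJ) (Measure.pi μ) := by
    convert! (measurePreserving_piEquivPiSubtypeProd μ (· ∈ I)).symm
  have hSA : MeasurableSet (e.symm ⁻¹' S) := hS.preimage e.symm.measurable
  have h1 : (Measure.pi μ) S = (μI.prod μJ) (e.symm ⁻¹' S) :=
    (he.measure_preimage hS.nullMeasurableSet).symm
  change (Measure.pi μ) S ≤ _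
  rw [h1]
  refine (prod_measure_le_add_inv_mul μI μJ hSA hs).trans ?_
  gcongr
  -- Two copies on `I` share the same coordinates off `I`. Subtracting the two bilinear forms
  -- cancels what is quadratic in the shared variables; the remainder is affine in them, and its
  -- coefficients on first components are those of `B.mulVec (sndDiff I p)`.
  set C := {p : (({i // i ∈ I} → ℂ × ℂ) × ({i // i ∈ I} → ℂ × ℂ)) × ({i // i ∉ I} → ℂ × ℂ) |
    (p.1.1, p.2) ∈ e.symm ⁻¹' S ∧ (p.1.2, p.2) ∈ e.symm ⁻¹' S} with hCdef
  have hC : MeasurableSet C :=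
    (hSA.preimage (f := fun p : (({i // i ∈ I} → ℂ × ℂ) × ({i // i ∈ I} → ℂ × ℂ)) ×
        ({i // i ∉ I} → ℂ × ℂ) => (p.1.1, p.2)) (by fun_prop)).inter
      (hSA.preimage (f := fun p : (({i // i ∈ I} → ℂ × ℂ) × ({i // i ∈ I} → ℂ × ℂ)) ×
        ({i // i ∉ I} → ℂ × ℂ) => (p.1.2, p.2)) (by fun_prop))
  -- Row `i₀` of `B` has entries of size at least `η * β` on all of `I`, so coordinate `i₀` of the
  -- coefficient vector is itself a well-spread linear form. This bounds the norm of that vector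
  -- from below.
  set Small := {p : ({i // i ∈ I} → ℂ × ℂ) × ({i // i ∈ I} → ℂ × ℂ) |
    ‖B.mulVec (sndDiff I p) i₀‖ ≤ η * β * ε / 4} with hSmallDef
  have hmulVec : ∀ p i, B.mulVec (sndDiff I p) i =
      ∑ j : {j // j ∈ I}, B i j * ((p.1 j).2 - (p.2 j).2) := by
    intro p i
    rw [Matrix.mulVec, dotProduct, sum_eq_sum_mem_add_sum_notMem I]
    have h2 : ∑ j : {j // j ∉ I}, B i j * sndDiff I p j = 0 :=
      Finset.sum_eq_zero fun j _ => by simp [sndDiff, j.2]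
    rw [h2, add_zero]
    exact Finset.sum_congr rfl fun j _ => by simp [sndDiff, j.2]
  have hSmall : (μI.prod μI) Small ≤ f := by
    have hm : MeasurableSet Small := by
      simp only [Small, hmulVec]
      exact measurableSet_le (by fun_prop) (by fun_prop)
    rw [Measure.prod_apply_symm hm]
    calc ∫⁻ a', μI ((fun a => (a, a')) ⁻¹' Small) ∂μI ≤ ∫⁻ _a', f ∂μI := by
          refine lintegral_mono fun a' => ?_
          refine le_trans (measure_mono ?_) (pi_linearForm_smallBall_le
            (fun i : {i // i ∈ I} => μ i) hq (fun i => hμ i) (fun _ => 0) (fun j => B i₀ j)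
            Finset.univ (mul_pos hη hβ) hk (by simp [hI])
            (fun j _ => Or.inr (hi₀ j j.2)) (∑ j : {j // j ∈ I}, B i₀ j * (a' j).2))
          intro a ha
          simp only [Small, hmulVec, Set.mem_preimage, Set.mem_ofPred_eq] at ha ⊢
          refine le_trans (le_of_eq ?_) ha
          simp [mul_sub]
      _ = f := by simp
  have hslice : ∀ p, p ∉ Small ∪ Bad → μJ {b | (p, b) ∈ C} ≤ f := by
    intro p hp
    simp only [Set.mem_union, not_or] at hp
    obtain ⟨hp1, hp2⟩ := hp
    simp only [Small, Set.mem_ofPred_eq, not_le] at hp1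
    set x := B.mulVec (sndDiff I p) with hx
    have hxn : η * β * ε / 4 < ‖x‖ := hp1.trans_le (norm_le_pi_norm x i₀)
    have hd : sndDiff I p ≠ 0 := by
      intro h0
      rw [hx, h0, Matrix.mulVec_zero, norm_zero] at hxn
      have : 0 < η * β * ε / 4 := by positivity
      linarith
    have hcard : 2 * k < (Finset.univ.filter fun j => η * ‖x‖ ≤ ‖x j‖).card := by
      by_contra hlt
      exact hp2 ⟨hd, not_lt.mp hlt⟩
    -- More than `2k` coefficients are large and at most `k` of them sit in `I`, so at least `k`
    -- multiply fresh variables. Nothing is required of the companion coefficients `c`.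
    let T : Finset {i // i ∉ I} :=
      ((Finset.univ.filter fun j => η * ‖x‖ ≤ ‖x j‖).subtype (· ∉ I))
    have hTc : k ≤ T.card := by
      have h2 := Finset.card_filter_add_card_filter_not (s := Finset.univ.filter fun j => η * ‖x‖ ≤ ‖x j‖) (· ∈ I)
      have h3 : ((Finset.univ.filter fun j => η * ‖x‖ ≤ ‖x j‖).filter (· ∈ I)).card ≤ k := by
        rw [← hI]
        exact Finset.card_le_card fun j hj => (Finset.mem_filter.mp hj).2
      rw [Finset.card_subtype]
      omega
    let dv : W → ℂ := fun i => if h : i ∈ I then (p.1 ⟨i, h⟩).1 - (p.2 ⟨i, h⟩).1 else 0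
    let c : W → ℂ := fun j => ∑ i, dv i * B i j
    have hr : 0 < η * (η * β * ε / 4) := by positivity
    refine le_trans (measure_mono ?_) (pi_linearForm_smallBall_le
      (fun i : {i // i ∉ I} => μ i) hq (fun i => hμ i) (fun j => x j) (fun j => c j) T hr hk hTc
      (fun j hj => Or.inl ?_)
      (-∑ j : {j // j ∈ I}, (c j * (p.1 j).2 + x j * (p.2 j).1)))
    · intro b hb
      obtain ⟨hb1, hb2⟩ := hb
      set y := e.symm (p.1, b) with hy
      set y' := e.symm (p.2, b) with hy'
      have hyI : ∀ j : {j // j ∈ I}, y j = p.1 j := fun j => by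
        simp [y, e, j.2]
      have hyJ : ∀ j : {j // j ∉ I}, y j = b j := fun j => by
        simp [y, e, j.2]
      have hyI' : ∀ j : {j // j ∈ I}, y' j = p.2 j := fun j => by
        simp [y', e, j.2]
      have hyJ' : ∀ j : {j // j ∉ I}, y' j = b j := fun j => by
        simp [y', e, j.2]
      have hdv : ∀ i, dv i = (y i).1 - (y' i).1 := by
        intro i
        by_cases hi : i ∈ I
        · simp only [dv, hi, dif_pos, hyI ⟨i, hi⟩, hyI' ⟨i, hi⟩]
        · simp only [dv, hi, dif_neg, not_false_iff, hyJ ⟨i, hi⟩, hyJ' ⟨i, hi⟩, sub_self]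
      have hdu : ∀ i, sndDiff I p i = (y i).2 - (y' i).2 := by
        intro i
        by_cases hi : i ∈ I
        · simp only [sndDiff, hi, dif_pos, hyI ⟨i, hi⟩, hyI' ⟨i, hi⟩]
        · simp only [sndDiff, hi, dif_neg, not_false_iff, hyJ ⟨i, hi⟩, hyJ' ⟨i, hi⟩, sub_self]
      have hid : ∑ j, (x j * (y' j).1 + c j * (y j).2) =
          ∑ i, ∑ j, (y i).1 * B i j * (y j).2 - ∑ i, ∑ j, (y' i).1 * B i j * (y' j).2 := by
        rw [Finset.sum_add_distrib]
        have h3 : ∑ j, c j * (y j).2 = ∑ i, ∑ j, dv i * B i j * (y j).2 := by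
          rw [Finset.sum_comm]
          exact Finset.sum_congr rfl fun j _ => by rw [← Finset.sum_mul]
        have h4 : ∑ i, x i * (y' i).1 = ∑ i, ∑ j, (y' i).1 * B i j * sndDiff I p j := by
          refine Finset.sum_congr rfl fun i _ => ?_
          rw [hx, Matrix.mulVec, dotProduct, Finset.sum_mul]
          exact Finset.sum_congr rfl fun j _ => by ring
        rw [h3, h4]
        simp only [← Finset.sum_add_distrib, ← Finset.sum_sub_distrib]
        refine Finset.sum_congr rfl fun i _ => Finset.sum_congr rfl fun j _ => ?_
        rw [hdv, hdu]; ring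
      have hsplit : ∑ j : {j // j ∉ I}, (x j * (b j).1 + c j * (b j).2) -
          (-∑ j : {j // j ∈ I}, (c j * (p.1 j).2 + x j * (p.2 j).1)) =
          ∑ j, (x j * (y' j).1 + c j * (y j).2) := by
        rw [sum_eq_sum_mem_add_sum_notMem I, sub_neg_eq_add, add_comm]
        simp only [hyI, hyJ, hyI', hyJ']
        congr 1
        exact Finset.sum_congr rfl fun j _ => add_comm _ _
      simp only [Set.mem_ofPred_eq]
      rw [hsplit, hid]
      have hb1' : ‖m - ∑ i, ∑ j, (y i).1 * B i j * (y j).2‖ ≤ ρ * β := hb1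
      have hb2' : ‖m - ∑ i, ∑ j, (y' i).1 * B i j * (y' j).2‖ ≤ ρ * β := hb2
      calc ‖∑ i, ∑ j, (y i).1 * B i j * (y j).2 - ∑ i, ∑ j, (y' i).1 * B i j * (y' j).2‖
          = ‖(m - ∑ i, ∑ j, (y' i).1 * B i j * (y' j).2) -
              (m - ∑ i, ∑ j, (y i).1 * B i j * (y j).2)‖ := by ring_nf
        _ ≤ ρ * β + ρ * β := (norm_sub_le _ _).trans (add_le_add hb2' hb1')
        _ = η * (η * β * ε / 4) * ε / 4 := by rw [hρ]; ring
    · have h2 : η * ‖x‖ ≤ ‖x j‖ := by simpa [T] using hj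
      exact (mul_le_mul_of_nonneg_left hxn.le hη.le).trans h2
  refine (prod_measure_le_add (μI.prod μI) μJ hC (Small ∪ Bad) f hslice).trans ?_
  calc (μI.prod μI) (Small ∪ Bad) + f ≤ (f + (μI.prod μI) Bad) + f := by
        gcongr
        exact (measure_union_le _ _).trans (by gcongr)
    _ = 2 * f + (μI.prod μI) Bad := by ring

end QuadraticForm

/-! ### Inverses of minors and the Schur complement. -/

/-- The union bound over a net of almost sparse vectors. -/
noncomputable def netBound (n l : ℕ) (K η q : ℝ) : ℝ≥0∞ :=
  ((n ^ l * ((2 * ⌈(n * K + 1) / η⌉₊ + 1) ^ 2) ^ (l + 1) : ℕ) : ℝ≥0∞) * ENNReal.ofReal q ^ (n - 1)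

theorem Matrix.measurable_det_of {W : Type*} [Fintype W] [DecidableEq W] :
    Measurable fun z : W → W → ℂ => (Matrix.of z).det := by
  have h : Continuous fun z : W → W → ℂ => (Matrix.of z).det :=
    Continuous.matrix_det (A := fun z : W → W → ℂ => Matrix.of z) continuous_id
  exact h.measurable

theorem Matrix.measurable_inv_of {W : Type*} [Fintype W] [DecidableEq W] (i j : W) :
    Measurable fun z : W → W → ℂ => (Matrix.of z)⁻¹ i j := by
  have h : Continuous fun z : W → W → ℂ => (Matrix.of z).adjugate i j :=
    (Continuous.matrix_adjugate (A := fun z : W → W → ℂ => Matrix.of z)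
      continuous_id).matrix_elem i j
  simp only [Matrix.inv_def, Ring.inverse_eq_inv, Matrix.smul_apply, smul_eq_mul]
  exact Matrix.measurable_det_of.inv.mul h.measurable

theorem measurableSet_card_filter_le {E W : Type*} [MeasurableSpace E] [Fintype W]
    (p : W → E → Prop) [∀ i e, Decidable (p i e)] (hp : ∀ i, MeasurableSet {e | p i e}) (l : ℕ) :
    MeasurableSet {e | (Finset.univ.filter fun i => p i e).card ≤ l} := by
  refine measurableSet_le ?_ measurable_const
  simp only [Finset.card_filter]
  exact Finset.measurable_sum _ fun i _ => Measurable.ite (hp i) measurable_const measurable_const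

namespace IsPairIndep

/-- The minor of `M` obtained by deleting index `k`. -/
def minor {V Ω : Type*} (M : Ω → V → V → ℂ) (k : V) (ω : Ω) : {i // i ≠ k} → {i // i ≠ k} → ℂ :=
  fun i j => M ω i j

theorem minor_isPairIndep {V Ω : Type*} [LinearOrder V] [MeasurableSpace Ω] {P : Measure Ω}
    {M : Ω → V → V → ℂ} {ε q : ℝ} (h : IsPairIndep P M ε q) (k : V) : IsPairIndep P (minor M k) ε q :=
  h.submatrix (OrderEmbedding.subtype (· ≠ k))

section Inverse

variable {W Ω : Type*} [LinearOrder W] [Fintype W] [MeasurableSpace Ω] {P : Measure Ω}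
  {M : Ω → W → W → ℂ} {ε q : ℝ}

/-- The image of a fixed nonzero vector under the inverse matrix is unlikely to be almost
sparse. -/
theorem measure_inv_mulVec_compressible_le (h : IsPairIndep P M ε q) (hq : 0 ≤ q) (hε0 : 0 ≤ ε)
    (hε : ε ≤ 1) (K η : ℝ) (hK : 0 ≤ K) (hη0 : 0 < η) (hη2 : η ≤ 1 / 2)
    (hη : (Fintype.card W * K + 1) * η ≤ ε / 4) (l : ℕ) (hl : l ≤ Fintype.card W)
    (v : W → ℂ) (hv : v ≠ 0) :
    P {ω | (∀ i j, ‖M ω i j‖ ≤ K) ∧ (Matrix.of (M ω)).det ≠ 0 ∧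
        (Finset.univ.filter fun j =>
          η * ‖(Matrix.of (M ω))⁻¹.mulVec v‖ ≤ ‖(Matrix.of (M ω))⁻¹.mulVec v j‖).card ≤ l} ≤
      netBound (Fintype.card W) l K η q := by
  have hW : Nonempty W := by
    by_contra hne
    rw [not_nonempty_iff] at hne
    exact hv (Subsingleton.elim _ _)
  have hexists : ∀ x : W → ℂ, ∃ j, ‖x j‖ = ‖x‖ := by
    intro x
    obtain ⟨j, -, hj⟩ := Finset.exists_max_image Finset.univ (fun j => ‖x j‖) Finset.univ_nonempty
    exact ⟨j, le_antisymm (norm_le_pi_norm x j)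
      ((pi_norm_le_iff_of_nonneg (norm_nonneg _)).mpr fun i => hj i (Finset.mem_univ i))⟩
  have hv0 : 0 < ‖v‖ := norm_pos_iff.mpr hv
  have hunit : ∀ (x : W → ℂ) i, ‖x i / (‖x‖ : ℂ)‖ = ‖x i‖ / ‖x‖ := by
    intro x i; simp
  refine (measure_mono ?_).trans (h.measure_exists_compressible_le hq hε K η hK hη0 hη2 hη l hl
    (fun i => v i / ‖v‖) (fun i => ?_) ?_)
  · rintro ω ⟨hMK, hdet, hcard⟩
    set x := (Matrix.of (M ω))⁻¹.mulVec v with hx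
    have hMx : (Matrix.of (M ω)).mulVec x = v := by
      rw [hx, Matrix.mulVec_mulVec, Matrix.mul_nonsing_inv _ (isUnit_iff_ne_zero.mpr hdet),
        Matrix.one_mulVec]
    have hxne : x ≠ 0 := by
      intro h0
      rw [h0, Matrix.mulVec_zero] at hMx
      exact hv hMx.symm
    have hx0 : 0 < ‖x‖ := norm_pos_iff.mpr hxne
    -- `M` sends `x / ‖x‖` exactly onto the line through `v / ‖v‖`; the free multiplier in the net
    -- bound absorbs the unknown ratio `‖v‖ / ‖x‖`.
    refine ⟨hMK, fun j => x j / ‖x‖, (‖v‖ : ℂ) / ‖x‖, ?_, ?_, ?_, ?_⟩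
    · intro j
      rw [hunit, div_le_one hx0]; exact norm_le_pi_norm x j
    · obtain ⟨j, hj⟩ := hexists x
      exact ⟨j, by rw [hunit, hj, div_self hx0.ne']⟩
    · simp only [hunit, le_div_iff₀ hx0]
      exact hcard
    · intro i
      have h1 : ∑ j, M ω i j * x j = v i := congrFun hMx i
      have h2 : ∑ j, M ω i j * (x j / ‖x‖) = v i / ‖x‖ := by
        rw [← h1, Finset.sum_div]
        exact Finset.sum_congr rfl fun j _ => by ring
      have h3 : (‖v‖ : ℂ) ≠ 0 := by exact_mod_cast hv0.ne'
      have h4 : (‖x‖ : ℂ) ≠ 0 := by exact_mod_cast hx0.ne'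
      have h5 : v i / (‖x‖ : ℂ) - ‖v‖ / ‖x‖ * (v i / ‖v‖) = 0 := by
        field_simp; ring
      rw [h2, h5, norm_zero]
      positivity
  · rw [hunit, div_le_one hv0]; exact norm_le_pi_norm v i
  · obtain ⟨j, hj⟩ := hexists v
    exact ⟨j, by rw [hunit, hj, div_self hv0.ne']⟩

/-- Row `i` of the inverse is the inverse transpose applied to a basis vector, and pair independence
is stable under transposition. -/
theorem measure_exists_inv_row_compressible_le (h : IsPairIndep P M ε q) (hq : 0 ≤ q)
    (hε0 : 0 ≤ ε) (hε : ε ≤ 1) (K η : ℝ) (hK : 0 ≤ K) (hη0 : 0 < η) (hη2 : η ≤ 1 / 2)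
    (hη : (Fintype.card W * K + 1) * η ≤ ε / 4) (l : ℕ) (hl : l ≤ Fintype.card W) :
    P {ω | (∀ i j, ‖M ω i j‖ ≤ K) ∧ (Matrix.of (M ω)).det ≠ 0 ∧ ∃ i,
        (Finset.univ.filter fun j =>
          η * ‖(Matrix.of (M ω))⁻¹ i‖ ≤ ‖(Matrix.of (M ω))⁻¹ i j‖).card ≤ l} ≤
      Fintype.card W * netBound (Fintype.card W) l K η q := by
  have hsub : {ω | (∀ i j, ‖M ω i j‖ ≤ K) ∧ (Matrix.of (M ω)).det ≠ 0 ∧ ∃ i,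
        (Finset.univ.filter fun j =>
          η * ‖(Matrix.of (M ω))⁻¹ i‖ ≤ ‖(Matrix.of (M ω))⁻¹ i j‖).card ≤ l} ⊆
      ⋃ i ∈ (Finset.univ : Finset W), {ω | (∀ a b, ‖M ω b a‖ ≤ K) ∧
        (Matrix.of (fun a b => M ω b a)).det ≠ 0 ∧
        (Finset.univ.filter fun j =>
          η * ‖(Matrix.of (fun a b => M ω b a))⁻¹.mulVec (Pi.single i 1)‖ ≤
            ‖(Matrix.of (fun a b => M ω b a))⁻¹.mulVec (Pi.single i 1) j‖).card ≤ l} := by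
    rintro ω ⟨h1, h2, i, h3⟩
    have ht : Matrix.of (fun a b => M ω b a) = (Matrix.of (M ω)).transpose := rfl
    refine Set.mem_biUnion (x := i) (by simp) ⟨fun a b => h1 b a, ?_, ?_⟩
    · rw [ht, Matrix.det_transpose]; exact h2
    · have h4 : (Matrix.of (fun a b => M ω b a))⁻¹.mulVec (Pi.single i 1) =
          (Matrix.of (M ω))⁻¹ i := by
        rw [ht, ← Matrix.transpose_nonsing_inv, Matrix.mulVec_single_one]
        rfl
      rw [h4]; exact h3
  refine (measure_mono hsub).trans ((measure_biUnion_finset_le _ _).trans ?_)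
  calc _ ≤ ∑ _i : W, netBound (Fintype.card W) l K η q := by
        refine Finset.sum_le_sum fun i _ => ?_
        exact h.transpose.measure_inv_mulVec_compressible_le hq hε0 hε K η hK hη0 hη2 hη l hl _
          (by simp)
    _ = _ := by rw [Finset.sum_const, Finset.card_univ, nsmul_eq_mul]

end Inverse

variable {V Ω : Type*} [LinearOrder V] [Fintype V] [MeasurableSpace Ω] {P : Measure Ω}
  {M : Ω → V → V → ℂ} {ε q : ℝ}

/-- Small-ball bound for the Schur complement of a diagonal entry. -/
theorem measure_schur_small_le (h : IsPairIndep P M ε q) (hq0 : 0 ≤ q) (hq : q < 1) (hε0 : 0 < ε)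
    (hε : ε ≤ 1) {K η s : ℝ} (hK : 0 ≤ K) (hη0 : 0 < η) (hη2 : η ≤ 1 / 2) (hs : 0 < s)
    (hη : (Fintype.card V * K + 1) * η ≤ ε / 4) {k : ℕ} (hk : 0 < k)
    (hl : 2 * k + 1 ≤ Fintype.card V) (a : V) :
    P {ω | (∀ i j, ‖M ω i j‖ ≤ K) ∧ (Matrix.of (minor M a ω)).det ≠ 0 ∧
        ‖M ω a a - ∑ i : {i // i ≠ a}, ∑ j : {i // i ≠ a},
          M ω a i * (Matrix.of (minor M a ω))⁻¹ i j * M ω j a‖ ≤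
          ε ^ 2 * η ^ 2 / 32 * ‖fun i j => (Matrix.of (minor M a ω))⁻¹ i j‖} ≤
      ENNReal.ofReal s + ENNReal.ofReal s⁻¹ *
        (2 * ENNReal.ofReal (3 / ((1 - q) ^ 2 * Real.sqrt k)) +
          (Fintype.card V ^ k : ℕ) * netBound (Fintype.card V - 1) (2 * k) K η q) +
      Fintype.card V * netBound (Fintype.card V - 1) (2 * k) K η q := by
  classical
  have := h.isProbabilityMeasure
  have hcW : Fintype.card {i // i ≠ a} = Fintype.card V - 1 := by
    simp [Fintype.card_subtype_compl]
  have hηW : ((Fintype.card {i // i ≠ a} : ℕ) * K + 1) * η ≤ ε / 4 := by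
    refine le_trans ?_ hη
    have : Fintype.card {i // i ≠ a} ≤ Fintype.card V := by omega
    gcongr
  have hlW : 2 * k ≤ Fintype.card {i // i ≠ a} := by omega
  have hW : Nonempty {i // i ≠ a} := Fintype.card_pos_iff.mp (by omega)
  let μ : {i // i ≠ a} → Measure (ℂ × ℂ) := fun i => P.map (rowCol M a i)
  have hμp : ∀ i, IsProbabilityMeasure (μ i) := fun i =>
    Measure.isProbabilityMeasure_map (h.measurable_rowCol a i).aemeasurable
  have hmin := h.minor_isPairIndep a
  let Wt := {i // i ≠ a}
  let NB := netBound (Fintype.card V - 1) (2 * k) K η q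
  let f := ENNReal.ofReal (3 / ((1 - q) ^ 2 * Real.sqrt k))
  have hinv : ∀ i j, Measurable fun z : (Wt → Wt → ℂ) × ℂ => (Matrix.of z.1)⁻¹ i j := fun i j =>
    (Matrix.measurable_inv_of i j).comp measurable_fst
  have hinvrow : ∀ i, Measurable fun z : (Wt → Wt → ℂ) × ℂ => ((Matrix.of z.1)⁻¹ i : Wt → ℂ) :=
    fun i => measurable_pi_lambda _ fun j => hinv i j
  have hdet : MeasurableSet {z : (Wt → Wt → ℂ) × ℂ | (Matrix.of z.1).det ≠ 0} :=
    ((Matrix.measurable_det_of.comp measurable_fst) (measurableSet_singleton 0)).compl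
  have hent : MeasurableSet {z : (Wt → Wt → ℂ) × ℂ | ∀ i j, ‖z.1 i j‖ ≤ K} := by
    simp only [Set.ofPred_forall]
    exact MeasurableSet.iInter fun i => MeasurableSet.iInter fun j =>
      measurableSet_le (by fun_prop) measurable_const
  let G : Set ((Wt → Wt → ℂ) × ℂ) := {z | (∀ i j, ‖z.1 i j‖ ≤ K) ∧ (Matrix.of z.1).det ≠ 0}
  have hG : MeasurableSet G := hent.inter hdet
  let R : Set ((Wt → Wt → ℂ) × ℂ) := {z | ∃ i, (Finset.univ.filter fun j =>
          η * ‖(Matrix.of z.1)⁻¹ i‖ ≤ ‖(Matrix.of z.1)⁻¹ i j‖).card ≤ 2 * k}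
  have hR : MeasurableSet R := by
    have : R = ⋃ i, {z : (Wt → Wt → ℂ) × ℂ | (Finset.univ.filter fun j =>
          η * ‖(Matrix.of z.1)⁻¹ i‖ ≤ ‖(Matrix.of z.1)⁻¹ i j‖).card ≤ 2 * k} := by
      ext z; simp [R]
    rw [this]
    refine MeasurableSet.iUnion fun i => measurableSet_card_filter_le _ (fun j => ?_) _
    exact measurableSet_le (measurable_const.mul (hinvrow i).norm) (hinv i j).norm
  let Q : Set (((Wt → Wt → ℂ) × ℂ) × (Wt → ℂ × ℂ)) :=
    {p | ‖p.1.2 - ∑ i, ∑ j, (p.2 i).1 * (Matrix.of p.1.1)⁻¹ i j * (p.2 j).2‖ ≤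
      ε ^ 2 * η ^ 2 / 32 * ‖fun i j => (Matrix.of p.1.1)⁻¹ i j‖}
  have hQ : MeasurableSet Q := by
    refine measurableSet_le ?_ ?_
    · refine (Measurable.sub (by fun_prop) ?_).norm
      refine Finset.measurable_sum _ fun i _ => Finset.measurable_sum _ fun j _ => ?_
      exact (Measurable.mul (by fun_prop) ((hinv i j).comp measurable_fst)).mul (by fun_prop)
    · refine measurable_const.mul (Measurable.norm ?_)
      exact measurable_pi_lambda _ fun i => measurable_pi_lambda _ fun j =>
        (hinv i j).comp measurable_fst
  let A : Set (((Wt → Wt → ℂ) × ℂ) × (Wt → ℂ × ℂ)) := {p | p.1 ∈ G \ R ∧ p ∈ Q}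
  have hA : MeasurableSet A := ((hG.diff hR).preimage measurable_fst).inter hQ
  let Bad : (I : Finset Wt) →
      Set (((Wt → Wt → ℂ) × ℂ) × (({i // i ∈ I} → ℂ × ℂ) × ({i // i ∈ I} → ℂ × ℂ))) := fun I =>
    {p | p.1 ∈ G ∧ sndDiff I p.2 ≠ 0 ∧ (Finset.univ.filter fun j =>
              η * ‖(Matrix.of p.1.1)⁻¹.mulVec (sndDiff I p.2)‖ ≤
                ‖(Matrix.of p.1.1)⁻¹.mulVec (sndDiff I p.2) j‖).card ≤ 2 * k}
  have hBad : ∀ I, MeasurableSet (Bad I) := by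
    intro I
    have hd : Measurable fun p : ((Wt → Wt → ℂ) × ℂ) × (({i // i ∈ I} → ℂ × ℂ) ×
        ({i // i ∈ I} → ℂ × ℂ)) => sndDiff I p.2 := (measurable_sndDiff I).comp measurable_snd
    have hmv : ∀ j, Measurable fun p : ((Wt → Wt → ℂ) × ℂ) × (({i // i ∈ I} → ℂ × ℂ) ×
        ({i // i ∈ I} → ℂ × ℂ)) => (Matrix.of p.1.1)⁻¹.mulVec (sndDiff I p.2) j := fun j =>
      Finset.measurable_sum _ fun i _ => ((hinv j i).comp measurable_fst).mul
        ((measurable_pi_apply i).comp hd)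
    refine (hG.preimage measurable_fst).inter (MeasurableSet.inter ?_ ?_)
    · exact (hd (measurableSet_singleton 0)).compl
    · refine measurableSet_card_filter_le _ (fun j => ?_) _
      exact measurableSet_le (measurable_const.mul (measurable_pi_lambda _ hmv).norm) (hmv j).norm
  let μ2 : (I : Finset Wt) → Measure (({i // i ∈ I} → ℂ × ℂ) × ({i // i ∈ I} → ℂ × ℂ)) :=
    fun I => (Measure.pi fun i : {i // i ∈ I} => μ i).prod (Measure.pi fun i : {i // i ∈ I} => μ i)
  have hcover : {ω | (∀ i j, ‖M ω i j‖ ≤ K) ∧ (Matrix.of (minor M a ω)).det ≠ 0 ∧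
        ‖M ω a a - ∑ i : {i // i ≠ a}, ∑ j : {i // i ≠ a},
          M ω a i * (Matrix.of (minor M a ω))⁻¹ i j * M ω j a‖ ≤
          ε ^ 2 * η ^ 2 / 32 * ‖fun i j => (Matrix.of (minor M a ω))⁻¹ i j‖} ⊆
      {ω | (rest M a ω, fun i => rowCol M a i ω) ∈ A} ∪
      {ω | (∀ i j, ‖minor M a ω i j‖ ≤ K) ∧ (Matrix.of (minor M a ω)).det ≠ 0 ∧ ∃ i,
        (Finset.univ.filter fun j => η * ‖(Matrix.of (minor M a ω))⁻¹ i‖ ≤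
          ‖(Matrix.of (minor M a ω))⁻¹ i j‖).card ≤ 2 * k} := by
    rintro ω ⟨h1, h2, h3⟩
    by_cases hr : rest M a ω ∈ R
    · exact Or.inr ⟨fun i j => h1 i j, h2, hr⟩
    · exact Or.inl ⟨⟨⟨fun i j => h1 i j, h2⟩, hr⟩, h3⟩
  have hrows := hmin.measure_exists_inv_row_compressible_le hq0 hε0.le hε K η hK hη0 hη2 hηW
    (2 * k) hlW
  rw [hcW] at hrows
  refine (measure_mono hcover).trans ((measure_union_le _ _).trans ?_)
  refine add_le_add ?_ (hrows.trans ?_)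
  swap
  · gcongr
    omega
  rw [h.measure_split a hA]
  -- The set `I` is taken among large entries of the largest row of `B`, so it depends on the frozen
  -- minor. Summing over all `k`-subsets removes this dependence at the price of a factor `n ^ k`,
  -- which `q ^ (n - 2)` beats.
  have hpt : ∀ ω, Measure.pi μ {y | (rest M a ω, y) ∈ A} ≤ ENNReal.ofReal s +
      ENNReal.ofReal s⁻¹ * (2 * f + ∑ I ∈ Finset.univ.powersetCard k,
        μ2 I {p | (rest M a ω, p) ∈ Bad I}) := by
    intro ω
    by_cases hz : rest M a ω ∈ G \ R
    swap
    · have : {y | (rest M a ω, y) ∈ A} = ∅ := by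
        ext y; simp only [A, Set.mem_ofPred_eq, Set.mem_empty_iff_false, iff_false]
        exact fun hh => hz hh.1
      rw [this, measure_empty]; exact zero_le
    obtain ⟨hzG, hzR⟩ := hz
    set B := (Matrix.of (rest M a ω).1)⁻¹ with hB
    set β := ‖fun i j => B i j‖ with hβ
    have hdetz : (Matrix.of (rest M a ω).1).det ≠ 0 := hzG.2
    obtain ⟨i₀, -, hi₀⟩ := Finset.exists_max_image Finset.univ
      (fun i => ‖(fun j => B i j)‖) Finset.univ_nonempty
    have hrow : ‖(fun j => B i₀ j)‖ = β := le_antisymm (norm_le_pi_norm (fun i j => B i j) i₀)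
      ((pi_norm_le_iff_of_nonneg (norm_nonneg _)).mpr fun i => hi₀ i (Finset.mem_univ i))
    have hβ0 : 0 < β := by
      rw [hβ, norm_pos_iff]
      intro h0
      have hB0 : B = 0 := by ext i j; exact congrFun (congrFun h0 i) j
      have h1 := Matrix.mul_nonsing_inv _ (isUnit_iff_ne_zero.mpr hdetz)
      rw [← hB, hB0, Matrix.mul_zero] at h1
      have h2 := congrFun (congrFun h1 i₀) i₀
      simp at h2
    have hbig : 2 * k < (Finset.univ.filter fun j => η * β ≤ ‖B i₀ j‖).card := by
      by_contra hlt
      refine hzR ⟨i₀, ?_⟩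
      rw [← hrow] at hlt
      exact not_lt.mp hlt
    obtain ⟨I, hIsub, hIc⟩ := Finset.exists_subset_card_eq (n := k)
      (s := Finset.univ.filter fun j => η * β ≤ ‖B i₀ j‖) (by omega)
    have hmain := pi_bilinearForm_smallBall_le μ hε0 hq (fun i => h.spread_rowCol a i) B
      (rest M a ω).2 hβ0 hη0 hs hk I hIc i₀ (fun j hj => (Finset.mem_filter.mp (hIsub hj)).2)
    refine le_trans (measure_mono ?_) (hmain.trans ?_)
    · intro y hy
      exact hy.2
    · gcongr
      refine le_trans (measure_mono ?_) (Finset.single_le_sum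
        (f := fun I => μ2 I {p | (rest M a ω, p) ∈ Bad I}) (fun _ _ => zero_le)
        (Finset.mem_powersetCard.mpr ⟨Finset.subset_univ I, hIc⟩))
      intro p hp
      exact ⟨hzG, hp⟩
  refine (lintegral_mono hpt).trans ?_
  have hrest : Measurable (rest M a) := h.measurable_rest a
  have hmB : ∀ I, Measurable fun ω => μ2 I {p | (rest M a ω, p) ∈ Bad I} := fun I =>
    (measurable_measure_prodMk_left (hBad I)).comp hrest
  rw [lintegral_add_left measurable_const, lintegral_const_mul _
      ((Finset.measurable_sum _ fun I _ => hmB I).const_add (2 * f)),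
    lintegral_add_left measurable_const, lintegral_finsetSum _ fun I _ => hmB I]
  simp only [lintegral_const, measure_univ, mul_one]
  gcongr
  -- The order of integration is exchanged: with `p` frozen, `sndDiff I p` is a fixed vector, and
  -- the inverse of the random minor rarely maps it to an almost sparse one.
  have hI : ∀ I, ∫⁻ ω, μ2 I {p | (rest M a ω, p) ∈ Bad I} ∂P ≤ NB := by
    intro I
    have hm : MeasurableSet {x : Ω × (({i // i ∈ I} → ℂ × ℂ) × ({i // i ∈ I} → ℂ × ℂ)) |
        (rest M a x.1, x.2) ∈ Bad I} :=
      (hBad I).preimage ((hrest.comp measurable_fst).prodMk measurable_snd)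
    have h1 := Measure.prod_apply (μ := P) (ν := μ2 I) hm
    have h2 := Measure.prod_apply_symm (μ := P) (ν := μ2 I) hm
    have h3 : ∫⁻ ω, μ2 I {p | (rest M a ω, p) ∈ Bad I} ∂P =
      ∫⁻ p, P {ω | (rest M a ω, p) ∈ Bad I} ∂(μ2 I) := h1.symm.trans h2
    rw [h3]
    calc ∫⁻ p, P {ω | (rest M a ω, p) ∈ Bad I} ∂(μ2 I) ≤ ∫⁻ _p, NB ∂(μ2 I) := by
          refine lintegral_mono fun p => ?_
          by_cases hv : sndDiff I p = 0
          · have : {ω | (rest M a ω, p) ∈ Bad I} = ∅ := by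
              ext ω
              simp only [Bad, Set.mem_ofPred_eq, Set.mem_empty_iff_false, iff_false]
              exact fun hh => hh.2.1 hv
            rw [this, measure_empty]; exact zero_le
          · have h4 := hmin.measure_inv_mulVec_compressible_le hq0 hε0.le hε K η hK hη0 hη2 hηW
              (2 * k) hlW _ hv
            rw [hcW] at h4
            refine le_trans (measure_mono ?_) h4
            rintro ω ⟨hzG, -, hc⟩
            exact ⟨hzG.1, hzG.2, hc⟩
      _ = NB := by simp
  calc ∑ I ∈ Finset.univ.powersetCard k, ∫⁻ ω, μ2 I {p | (rest M a ω, p) ∈ Bad I} ∂P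
      ≤ ∑ _I ∈ (Finset.univ : Finset Wt).powersetCard k, NB := Finset.sum_le_sum fun I _ => hI I
    _ = ((Fintype.card V - 1).choose k : ℕ) * NB := by
        rw [Finset.sum_const, Finset.card_powersetCard, Finset.card_univ, hcW, nsmul_eq_mul]
    _ ≤ _ := by
        gcongr
        exact (Nat.choose_le_pow _ _).trans (Nat.pow_le_pow_left (by omega) _)

end IsPairIndep

/-! ### From approximate null vectors to Schur complements. -/

/-- Double counting: on `S` at least `L` of the events occur, so Markov's inequality for their
number applies. Measurable hulls avoid any measurability condition on the sets or on `T`. -/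
theorem mul_measure_le_sum_measure {Ω V : Type*} [MeasurableSpace Ω] [Fintype V] (P : Measure Ω)
    (F : V → Set Ω) (S : Set Ω) (L : ℕ) (T : Ω → Finset V)
    (h : ∀ ω ∈ S, L ≤ (T ω).card ∧ ∀ a ∈ T ω, ω ∈ F a) :
    L * P S ≤ ∑ a, P (F a) := by
  classical
  let g : Ω → ℝ≥0∞ := fun ω => ∑ a, (toMeasurable P (F a)).indicator 1 ω
  have hgm : Measurable g := Finset.measurable_sum _ fun a _ =>
    measurable_one.indicator (measurableSet_toMeasurable _ _)
  have hg : ∫⁻ ω, g ω ∂P = ∑ a, P (F a) := by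
    rw [lintegral_finsetSum _ fun a _ => measurable_one.indicator (measurableSet_toMeasurable _ _)]
    refine Finset.sum_congr rfl fun a _ => ?_
    rw [lintegral_indicator_one (measurableSet_toMeasurable _ _), measure_toMeasurable]
  rw [← hg]
  refine le_trans ?_ (mul_meas_ge_le_lintegral hgm (L : ℝ≥0∞))
  gcongr
  intro ω hω
  obtain ⟨h1, h2⟩ := h ω hω
  simp only [Set.mem_ofPred_eq, g]
  calc (L : ℝ≥0∞) ≤ ((T ω).card : ℝ≥0∞) := by exact_mod_cast h1
    _ = ∑ a ∈ T ω, (1 : ℝ≥0∞) := by simp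
    _ ≤ ∑ a ∈ T ω, (toMeasurable P (F a)).indicator 1 ω := by
        refine Finset.sum_le_sum fun a ha => ?_
        rw [Set.indicator_of_mem (subset_toMeasurable _ _ (h2 a ha))]
        simp
    _ ≤ _ := Finset.sum_le_univ_sum_of_nonneg fun _ => zero_le

/-- A coordinate of size at least `η` of an approximate null vector forces the corresponding Schur
complement to be small. -/
theorem norm_schur_le_of_approx_null {V : Type*} [Fintype V] [DecidableEq V] (A : V → V → ℂ)
    {K η σ ρ : ℝ} (hK : ∀ i j, ‖A i j‖ ≤ K) (hK0 : 0 ≤ K) (hη : 0 < η) (hσ : 0 ≤ σ)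
    (hV : 2 ≤ Fintype.card V)
    (hρ : 2 * (Fintype.card V : ℝ) ^ 2 * K * σ ≤ ρ * η) (y : V → ℂ)
    (hy : ∀ i, ‖∑ j, A i j * y j‖ ≤ σ) (a : V) (ha : η ≤ ‖y a‖)
    (B : Matrix {i // i ≠ a} {i // i ≠ a} ℂ)
    (hBA : B * Matrix.of (fun i j : {i // i ≠ a} => A i j) = 1) :
    ‖A a a - ∑ i : {i // i ≠ a}, ∑ j : {i // i ≠ a}, A a i * B i j * A j a‖ ≤
      ρ * ‖fun i j => B i j‖ := by
  set n : ℝ := (Fintype.card V : ℝ) with hn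
  have hcW : Fintype.card {i // i ≠ a} = Fintype.card V - 1 := by
    simp [Fintype.card_subtype_compl]
  have hcW' : (Fintype.card {i // i ≠ a} : ℝ) ≤ n := by rw [hcW, hn]; gcongr; omega
  have hn1 : 1 ≤ n := by rw [hn]; exact_mod_cast (by omega : 1 ≤ Fintype.card V)
  set β := ‖fun i j => B i j‖ with hβ
  have hβ0 : 0 ≤ β := norm_nonneg _
  have hBβ : ∀ i j, ‖B i j‖ ≤ β := fun i j =>
    (norm_le_pi_norm (fun j => B i j) j).trans (norm_le_pi_norm (fun i j => B i j) i)
  -- A diagonal entry of `B * minor = 1` prevents `B` from being too small. This lets the residual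
  -- of equation `a`, which carries no factor `β`, be absorbed.
  have hβ1 : 1 ≤ n * K * β := by
    have hW : Nonempty {i // i ≠ a} := Fintype.card_pos_iff.mp (by omega)
    obtain ⟨i⟩ := hW
    have h1 : ∑ j, B i j * A j i = 1 := by
      have := congrFun (congrFun hBA i) i
      simpa [Matrix.mul_apply] using this
    calc (1 : ℝ) = ‖∑ j, B i j * A j i‖ := by rw [h1, norm_one]
      _ ≤ ∑ j : {i // i ≠ a}, β * K := by
          refine (norm_sum_le _ _).trans (Finset.sum_le_sum fun j _ => ?_)
          rw [norm_mul]
          exact mul_le_mul (hBβ _ _) (hK _ _) (norm_nonneg _) hβ0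
      _ = Fintype.card {i // i ≠ a} * (β * K) := by
          rw [Finset.sum_const, Finset.card_univ, nsmul_eq_mul]
      _ ≤ n * (β * K) := by gcongr
      _ = n * K * β := by ring
  set e : V → ℂ := fun i => ∑ j, A i j * y j with he
  have hrow : ∀ i, e i = A i a * y a + ∑ j : {i // i ≠ a}, A i j * y j := fun i =>
    Fintype.sum_eq_add_sum_subtype_ne _ a
  have hsolve : ∀ i : {i // i ≠ a}, y i = ∑ j, B i j * (e j - A j a * y a) := by
    intro i
    have h1 : (fun j : {i // i ≠ a} => e j - A j a * y a) =
        (Matrix.of (fun i j : {i // i ≠ a} => A i j)).mulVec (fun j : {i // i ≠ a} => y j) := by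
      ext j
      rw [hrow j]
      simp [Matrix.mulVec, dotProduct]
    have h2 : B.mulVec (fun j : {i // i ≠ a} => e j - A j a * y a) = fun j : {i // i ≠ a} => y j := by
      rw [h1, Matrix.mulVec_mulVec, hBA, Matrix.one_mulVec]
    exact (congrFun h2 i).symm
  -- Block elimination: solving the other equations for the other coordinates leaves the Schur
  -- complement times `y a`, with only residuals on the right.
  have hkey : (A a a - ∑ i : {i // i ≠ a}, ∑ j : {i // i ≠ a}, A a i * B i j * A j a) * y a =
      e a - ∑ i : {i // i ≠ a}, ∑ j : {i // i ≠ a}, A a i * B i j * e j := by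
    have h1 : ∑ i : {i // i ≠ a}, A a i * y i =
        ∑ i : {i // i ≠ a}, ∑ j : {i // i ≠ a}, A a i * B i j * e j -
        (∑ i : {i // i ≠ a}, ∑ j : {i // i ≠ a}, A a i * B i j * A j a) * y a := by
      rw [Finset.sum_mul, ← Finset.sum_sub_distrib]
      refine Finset.sum_congr rfl fun i _ => ?_
      rw [hsolve i, Finset.mul_sum, Finset.sum_mul, ← Finset.sum_sub_distrib]
      exact Finset.sum_congr rfl fun j _ => by ring
    rw [hrow a, h1]; ring
  have hrhs : ‖e a - ∑ i : {i // i ≠ a}, ∑ j : {i // i ≠ a}, A a i * B i j * e j‖ ≤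
      σ + n * (n * (K * β * σ)) := by
    refine (norm_sub_le _ _).trans (add_le_add (hy a) ?_)
    refine (norm_sum_le _ _).trans ?_
    calc ∑ i : {i // i ≠ a}, ‖∑ j : {i // i ≠ a}, A a i * B i j * e j‖
        ≤ ∑ _i : {i // i ≠ a}, ∑ _j : {i // i ≠ a}, K * β * σ := by
          refine Finset.sum_le_sum fun i _ => (norm_sum_le _ _).trans
            (Finset.sum_le_sum fun j _ => ?_)
          rw [norm_mul, norm_mul]
          exact mul_le_mul (mul_le_mul (hK _ _) (hBβ _ _) (norm_nonneg _) hK0) (hy _)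
            (norm_nonneg _) (by positivity)
      _ = Fintype.card {i // i ≠ a} * (Fintype.card {i // i ≠ a} * (K * β * σ)) := by
          simp [Finset.sum_const, nsmul_eq_mul]
      _ ≤ n * (n * (K * β * σ)) := by gcongr
  set D := ‖A a a - ∑ i : {i // i ≠ a}, ∑ j : {i // i ≠ a}, A a i * B i j * A j a‖ with hD
  have h1 : D * η ≤ σ + n * (n * (K * β * σ)) := by
    calc D * η ≤ D * ‖y a‖ := by gcongr
      _ = _ := by rw [hD, ← norm_mul, hkey]
      _ ≤ _ := hrhs
  have h2 : σ + n * (n * (K * β * σ)) ≤ (2 * n ^ 2 * K * σ) * β := by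
    have h3 : σ * 1 ≤ σ * (n * K * β) := by gcongr
    have h4 : n * K * β ≤ n * (n * K * β) := le_mul_of_one_le_left (by positivity) hn1
    nlinarith [mul_le_mul_of_nonneg_left h4 hσ]
  have h5 : D * η ≤ (ρ * β) * η := by
    calc D * η ≤ (2 * n ^ 2 * K * σ) * β := h1.trans h2
      _ ≤ (ρ * η) * β := by gcongr
      _ = _ := by ring
  exact le_of_mul_le_mul_right h5 hη

namespace IsPairIndep

variable {V Ω : Type*} [LinearOrder V] [Fintype V] [MeasurableSpace Ω] {P : Measure Ω}
  {M : Ω → V → V → ℂ} {ε q : ℝ}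

/-- Either `y` is almost sparse, which the net bound with `t = 0` excludes, or the Schur complement
is small at more than `2k` indices at once. Averaging over the index then costs `n / (2k)` instead
of the `n` of a union bound. -/
theorem measure_approx_null_le (h : IsPairIndep P M ε q) (hq0 : 0 ≤ q) (hq : q < 1) (hε0 : 0 < ε)
    (hε : ε ≤ 1) {K η s σ : ℝ} (hK : 0 ≤ K) (hη0 : 0 < η) (hη2 : η ≤ 1 / 2) (hs : 0 < s)
    (hη : (Fintype.card V * K + 1) * η ≤ ε / 4) {k : ℕ} (hk : 0 < k)
    (hl : 2 * k + 1 ≤ Fintype.card V) (hσ0 : 0 ≤ σ) (hσε : σ ≤ ε / 4)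
    (hσ : 2 * (Fintype.card V : ℝ) ^ 2 * K * σ ≤ ε ^ 2 * η ^ 2 / 32 * η)
    (hdet : ∀ a, P {ω | (Matrix.of (minor M a ω)).det = 0} = 0) :
    P {ω | (∀ i j, ‖M ω i j‖ ≤ K) ∧ ∃ y : V → ℂ, (∀ j, ‖y j‖ ≤ 1) ∧ (∃ j, ‖y j‖ = 1) ∧
        ∀ i, ‖∑ j, M ω i j * y j‖ ≤ σ} ≤
      netBound (Fintype.card V) (2 * k) K η q + (Fintype.card V / (2 * k : ℕ) : ℝ≥0∞) *
      (ENNReal.ofReal s + ENNReal.ofReal s⁻¹ *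
        (2 * ENNReal.ofReal (3 / ((1 - q) ^ 2 * Real.sqrt k)) +
          (Fintype.card V ^ k : ℕ) * netBound (Fintype.card V - 1) (2 * k) K η q) +
      Fintype.card V * netBound (Fintype.card V - 1) (2 * k) K η q) := by
  classical
  set R := ENNReal.ofReal s + ENNReal.ofReal s⁻¹ *
        (2 * ENNReal.ofReal (3 / ((1 - q) ^ 2 * Real.sqrt k)) +
          (Fintype.card V ^ k : ℕ) * netBound (Fintype.card V - 1) (2 * k) K η q) +
      Fintype.card V * netBound (Fintype.card V - 1) (2 * k) K η q with hR
  let F : V → Set Ω := fun a => {ω | (∀ i j, ‖M ω i j‖ ≤ K) ∧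
        (Matrix.of (minor M a ω)).det ≠ 0 ∧
        ‖M ω a a - ∑ i : {i // i ≠ a}, ∑ j : {i // i ≠ a},
          M ω a i * (Matrix.of (minor M a ω))⁻¹ i j * M ω j a‖ ≤
          ε ^ 2 * η ^ 2 / 32 * ‖fun i j => (Matrix.of (minor M a ω))⁻¹ i j‖}
  have hF : ∀ a, P (F a) ≤ R := fun a =>
    h.measure_schur_small_le hq0 hq hε0 hε hK hη0 hη2 hs hη hk hl a
  let S : Set Ω := {ω | (∀ i j, ‖M ω i j‖ ≤ K) ∧ (∀ a, (Matrix.of (minor M a ω)).det ≠ 0) ∧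
    ∃ y : V → ℂ, 2 * k < (Finset.univ.filter fun j => η ≤ ‖y j‖).card ∧
      ∀ i, ‖∑ j, M ω i j * y j‖ ≤ σ}
  have hS : P S ≤ (Fintype.card V / (2 * k : ℕ) : ℝ≥0∞) * R := by
    have h1 : ∀ ω, ∃ T : Finset V, ω ∈ S → 2 * k ≤ T.card ∧ ∀ a ∈ T, ω ∈ F a := by
      intro ω
      by_cases hω : ω ∈ S
      · obtain ⟨hMK, hd, y, hcard, hy⟩ := hω
        refine ⟨Finset.univ.filter fun j => η ≤ ‖y j‖, fun _ => ⟨hcard.le, fun a ha => ?_⟩⟩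
        refine ⟨hMK, hd a, ?_⟩
        exact norm_schur_le_of_approx_null (M ω) hMK hK hη0 hσ0 (by omega) hσ y hy a
          (Finset.mem_filter.mp ha).2 _
          (Matrix.nonsing_inv_mul (Matrix.of (minor M a ω)) (isUnit_iff_ne_zero.mpr (hd a)))
      · exact ⟨∅, fun hh => absurd hh hω⟩
    choose T hT using h1
    have h2 := mul_measure_le_sum_measure P F S (2 * k) T hT
    have h3 : ((2 * k : ℕ) : ℝ≥0∞) * P S ≤ Fintype.card V * R := by
      refine h2.trans ?_
      calc ∑ a, P (F a) ≤ ∑ _a : V, R := Finset.sum_le_sum fun a _ => hF a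
        _ = _ := by rw [Finset.sum_const, Finset.card_univ, nsmul_eq_mul]
    rw [ENNReal.mul_comm_div, ← mul_div_assoc, ENNReal.le_div_iff_mul_le, mul_comm]
    · exact h3
    · left; simp; omega
    · left; exact ENNReal.natCast_ne_top _
  have hV : Nonempty V := Fintype.card_pos_iff.mp (by omega)
  have hcomp := h.measure_exists_compressible_le hq0 hε K η hK hη0 hη2 hη (2 * k) (by omega)
    (fun _ => 1) (by simp) ⟨Classical.arbitrary V, by simp⟩
  set Cmp := {ω | (∀ i j, ‖M ω i j‖ ≤ K) ∧ ∃ (y : V → ℂ) (t : ℂ), (∀ j, ‖y j‖ ≤ 1) ∧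
        (∃ j, ‖y j‖ = 1) ∧ (Finset.univ.filter fun j => η ≤ ‖y j‖).card ≤ 2 * k ∧
        ∀ i, ‖∑ j, M ω i j * y j - t * 1‖ ≤ ε / 4}
  have hnull : P (⋃ a, {ω | (Matrix.of (minor M a ω)).det = 0}) = 0 := measure_iUnion_null hdet
  have hcover : {ω | (∀ i j, ‖M ω i j‖ ≤ K) ∧ ∃ y : V → ℂ, (∀ j, ‖y j‖ ≤ 1) ∧ (∃ j, ‖y j‖ = 1) ∧
        ∀ i, ‖∑ j, M ω i j * y j‖ ≤ σ} ⊆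
      (Cmp ∪ S) ∪ ⋃ a, {ω | (Matrix.of (minor M a ω)).det = 0} := by
    rintro ω ⟨hMK, y, hy1, hy2, hy⟩
    by_cases hd : ∀ a, (Matrix.of (minor M a ω)).det ≠ 0
    · refine Or.inl ?_
      by_cases hc : (Finset.univ.filter fun j => η ≤ ‖y j‖).card ≤ 2 * k
      · exact Or.inl ⟨hMK, y, 0, hy1, hy2, hc, fun i => by simpa using (hy i).trans hσε⟩
      · exact Or.inr ⟨hMK, hd, y, not_le.mp hc, hy⟩
    · push Not at hd
      obtain ⟨a, ha⟩ := hd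
      exact Or.inr (Set.mem_iUnion.mpr ⟨a, ha⟩)
  calc _ ≤ P (Cmp ∪ S) + P (⋃ a, {ω | (Matrix.of (minor M a ω)).det = 0}) :=
        (measure_mono hcover).trans (measure_union_le _ _)
    _ ≤ P Cmp + P S := by rw [hnull, add_zero]; exact measure_union_le _ _
    _ ≤ _ := add_le_add hcomp hS

end IsPairIndep

/-! ### Singular vectors, and the spread and size of the atoms. -/

theorem exists_norm_le_leastSingularValue {n : ℕ} (hn : 0 < n) (A : Matrix (Fin n) (Fin n) ℂ) :
    ∃ x : Fin n → ℂ, x ≠ 0 ∧ ∀ i, ‖∑ j, A i j * x j‖ ≤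
      leastSingularValue A * Real.sqrt (∑ j, ‖x j‖ ^ 2) := by
  set T := Matrix.toEuclideanLin A with hT
  have hfr : n - 1 < Module.finrank ℂ (EuclideanSpace ℂ (Fin n)) := by
    rw [finrank_euclideanSpace_fin]; omega
  obtain ⟨x, hx⟩ := (LinearMap.hasEigenvalue_adjoint_comp_self_sq_singularValues T hfr).exists_hasEigenvector
  have hσ : T.singularValues (n - 1) = leastSingularValue A := rfl
  have hσ0 : 0 ≤ leastSingularValue A := T.singularValues_nonneg _
  have h1 := hx.apply_eq_smul
  have h2 : ‖T x‖ ^ 2 = (leastSingularValue A * ‖x‖) ^ 2 := by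
    have h3 : inner ℂ (T x) (T x) = inner ℂ x ((LinearMap.adjoint T ∘ₗ T) x) := by
      rw [LinearMap.comp_apply, LinearMap.adjoint_inner_right]
    rw [h1, hσ, inner_smul_right, inner_self_eq_norm_sq_to_K, inner_self_eq_norm_sq_to_K] at h3
    rw [mul_pow]
    exact_mod_cast h3
  have h3 : ‖T x‖ = leastSingularValue A * ‖x‖ :=
    (pow_left_inj₀ (norm_nonneg _) (by positivity) two_ne_zero).mp h2
  refine ⟨fun j => x j, ?_, fun i => ?_⟩
  · intro h0
    apply hx.2
    ext j
    exact congrFun h0 j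
  · have h4 : T x i = ∑ j, A i j * x j := by
      simp [hT, Matrix.toLpLin_apply, Matrix.mulVec, dotProduct]
    rw [← h4, ← EuclideanSpace.norm_eq, ← h3]
    exact PiLp.norm_apply_le (T x) i

/-- The truncated mean of `‖a ξ₁ + b ξ₂ - u‖` is continuous in `(a, b, u)` and positive, hence
bounded below for `‖(a, b)‖ = 1` and `‖u‖ ≤ R + 1`. For larger `u` the ball misses the range taken
with probability at least one half. Larger coefficients only help, by scaling. -/
theorem exists_spread {Ω₀ : Type*} [MeasurableSpace Ω₀] (ν : Measure Ω₀) [IsProbabilityMeasure ν]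
    (ξ₁ ξ₂ : Ω₀ → ℂ) (hξ₁ : Measurable ξ₁) (hξ₂ : Measurable ξ₂)
    (hnd : ∀ a b u : ℂ, (a, b) ≠ (0, 0) → ¬ ∀ᵐ ω ∂ν, a * ξ₁ ω + b * ξ₂ ω = u) :
    ∃ ε q : ℝ, 0 < ε ∧ ε ≤ 1 ∧ 0 ≤ q ∧ q < 1 ∧ ∀ a b u : ℂ, (1 ≤ ‖a‖ ∨ 1 ≤ ‖b‖) →
      ν.real {ω | ‖a * ξ₁ ω + b * ξ₂ ω - u‖ ≤ ε} ≤ q := by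
  obtain ⟨R, hR⟩ : ∃ R : ℕ, 1 / 2 < ν {ω | ‖ξ₁ ω‖ + ‖ξ₂ ω‖ ≤ R} := by
    have hmono : Monotone fun R : ℕ => {ω | ‖ξ₁ ω‖ + ‖ξ₂ ω‖ ≤ R} := by
      intro R S hRS ω hω
      have hω' : ‖ξ₁ ω‖ + ‖ξ₂ ω‖ ≤ R := hω
      exact hω'.trans (by exact_mod_cast hRS)
    have h1 := tendsto_measure_iUnion_atTop (μ := ν) hmono
    have h2 : ⋃ R : ℕ, {ω | ‖ξ₁ ω‖ + ‖ξ₂ ω‖ ≤ R} = Set.univ := by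
      ext ω
      simp only [Set.mem_iUnion, Set.mem_ofPred_eq, Set.mem_univ, iff_true]
      exact exists_nat_ge _
    rw [h2, measure_univ] at h1
    exact (h1.eventually (lt_mem_nhds (by
      rw [one_div]; exact ENNReal.inv_lt_one.mpr ENNReal.one_lt_two))).exists
  have hR' : 1 / 2 ≤ ν.real {ω | ‖ξ₁ ω‖ + ‖ξ₂ ω‖ ≤ R} := by
    have := ENNReal.toReal_mono (measure_ne_top _ _) hR.le
    simpa [measureReal_def] using this
  let φ : (ℂ × ℂ) × ℂ → Ω₀ → ℝ := fun p ω => min 1 ‖p.1.1 * ξ₁ ω + p.1.2 * ξ₂ ω - p.2‖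
  have hφm : ∀ p, Measurable (φ p) := fun p => by fun_prop
  have hφ0 : ∀ p ω, 0 ≤ φ p ω := fun p ω => le_min zero_le_one (norm_nonneg _)
  have hφ1 : ∀ p ω, φ p ω ≤ 1 := fun p ω => min_le_left _ _
  have hφi : ∀ p, Integrable (φ p) ν := fun p =>
    Integrable.of_bound (hφm p).aestronglyMeasurable 1 (ae_of_all _ fun ω => by
      rw [Real.norm_eq_abs, abs_of_nonneg (hφ0 p ω)]; exact hφ1 p ω)
  let h : (ℂ × ℂ) × ℂ → ℝ := fun p => ∫ ω, φ p ω ∂ν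
  have hcont : Continuous h := by
    refine continuous_of_dominated (bound := fun _ => 1)
      (fun p => (hφm p).aestronglyMeasurable) (fun p => ae_of_all _ fun ω => by
        rw [Real.norm_eq_abs, abs_of_nonneg (hφ0 p ω)]; exact hφ1 p ω) (integrable_const _)
      (ae_of_all _ fun ω => by fun_prop)
  have hpos : ∀ p : (ℂ × ℂ) × ℂ, p.1 ≠ 0 → 0 < h p := by
    intro p hp
    refine lt_of_le_of_ne (integral_nonneg (hφ0 p)) fun h0 => ?_
    have h1 := (integral_eq_zero_iff_of_nonneg (hφ0 p) (hφi p)).mp h0.symm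
    refine hnd p.1.1 p.1.2 p.2 hp ?_
    filter_upwards [h1] with ω hω
    have h2 : ‖p.1.1 * ξ₁ ω + p.1.2 * ξ₂ ω - p.2‖ = 0 := by
      by_contra hne
      have h3 : 0 < φ p ω := lt_min one_pos (lt_of_le_of_ne (norm_nonneg _) (Ne.symm hne))
      exact h3.ne' hω
    exact sub_eq_zero.mp (norm_eq_zero.mp h2)
  let Kc : Set ((ℂ × ℂ) × ℂ) := Metric.sphere 0 1 ×ˢ Metric.closedBall 0 (R + 1)
  have hKc : IsCompact Kc := (isCompact_sphere _ _).prod (isCompact_closedBall _ _)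
  have hne : Kc.Nonempty := by
    refine ⟨((1, 0), 0), ?_, ?_⟩
    · simp [Prod.norm_def]
    · simp; positivity
  obtain ⟨p₀, hp₀, hmin⟩ := hKc.exists_isMinOn hne hcont.continuousOn
  set c₀ := h p₀ with hc₀
  have hc₀pos : 0 < c₀ := hpos p₀ fun h0 => by
    have : ‖p₀.1‖ = 1 := by simpa using hp₀.1
    rw [h0, norm_zero] at this
    exact zero_ne_one this
  have hc₀1 : c₀ ≤ 1 := by
    calc c₀ ≤ ∫ _ω, (1 : ℝ) ∂ν := integral_mono (hφi p₀) (integrable_const _) (hφ1 p₀)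
      _ = 1 := by simp
  refine ⟨c₀ / 2, max (1 / 2) (1 - c₀ / 2), by positivity, by linarith, by positivity,
    max_lt (by norm_num) (by linarith), ?_⟩
  have hnorm : ∀ a b u : ℂ, ‖(a, b)‖ = 1 →
      ν.real {ω | ‖a * ξ₁ ω + b * ξ₂ ω - u‖ ≤ c₀ / 2} ≤ max (1 / 2) (1 - c₀ / 2) := by
    intro a b u hab
    have ha : ‖a‖ ≤ 1 := hab ▸ norm_fst_le (a, b)
    have hb : ‖b‖ ≤ 1 := hab ▸ norm_snd_le (a, b)
    by_cases hu : ‖u‖ ≤ R + 1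
    · refine le_trans ?_ (le_max_right _ _)
      have h1 : c₀ ≤ h ((a, b), u) := hmin (a := ((a, b), u)) ⟨by simpa using hab, by simpa using hu⟩
      set E := {ω | ‖a * ξ₁ ω + b * ξ₂ ω - u‖ ≤ c₀ / 2}
      have hE : MeasurableSet E := measurableSet_le (by fun_prop) measurable_const
      have h2 : h ((a, b), u) ≤ ∫ ω, (c₀ / 2 + Eᶜ.indicator (fun _ => (1 : ℝ)) ω) ∂ν := by
        refine integral_mono (hφi _) ((integrable_const _).add
          ((integrable_const _).indicator hE.compl)) fun ω => ?_
        by_cases hω : ω ∈ E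
        · simp only [Set.indicator_of_notMem (Set.notMem_compl_iff.mpr hω), add_zero]
          exact (min_le_right _ _).trans hω
        · simp only [Set.indicator_of_mem (Set.mem_compl hω)]
          exact (min_le_left _ _).trans (by linarith)
      rw [integral_add (integrable_const _) ((integrable_const _).indicator hE.compl),
        integral_indicator hE.compl] at h2
      simp only [integral_const, smul_eq_mul, mul_one, probReal_univ, one_mul,
        measureReal_restrict_apply_univ] at h2
      rw [probReal_compl_eq_one_sub hE] at h2
      linarith
    · refine le_trans ?_ (le_max_left _ _)
      have hS : MeasurableSet {ω | ‖ξ₁ ω‖ + ‖ξ₂ ω‖ ≤ R} :=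
        measurableSet_le (by fun_prop) measurable_const
      have hsub : {ω | ‖a * ξ₁ ω + b * ξ₂ ω - u‖ ≤ c₀ / 2} ⊆ {ω | ‖ξ₁ ω‖ + ‖ξ₂ ω‖ ≤ R}ᶜ := by
        intro ω hω hω'
        simp only [Set.mem_ofPred_eq] at hω hω'
        have h1 : ‖a * ξ₁ ω + b * ξ₂ ω‖ ≤ R := by
          refine (norm_add_le _ _).trans (le_trans ?_ hω')
          rw [norm_mul, norm_mul]
          have := mul_le_of_le_one_left (norm_nonneg (ξ₁ ω)) ha
          have := mul_le_of_le_one_left (norm_nonneg (ξ₂ ω)) hb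
          linarith
        have h2 : ‖u‖ ≤ ‖a * ξ₁ ω + b * ξ₂ ω‖ + ‖a * ξ₁ ω + b * ξ₂ ω - u‖ := by
          calc ‖u‖ = ‖(a * ξ₁ ω + b * ξ₂ ω) - (a * ξ₁ ω + b * ξ₂ ω - u)‖ := by ring_nf
            _ ≤ _ := norm_sub_le _ _
        linarith
      have := measureReal_mono hsub (measure_ne_top ν _)
      rw [probReal_compl_eq_one_sub hS] at this
      linarith
  intro a b u hab
  set r := ‖(a, b)‖ with hr
  have hr1 : 1 ≤ r := by
    rcases hab with h1 | h1
    · exact h1.trans (norm_fst_le (a, b))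
    · exact h1.trans (norm_snd_le (a, b))
  have hr0 : 0 < r := by linarith
  have hrc : (r : ℂ) ≠ 0 := by exact_mod_cast hr0.ne'
  have hunit : ‖(a / (r : ℂ), b / (r : ℂ))‖ = 1 := by
    have h1 : (a / (r : ℂ), b / (r : ℂ)) = (r : ℂ)⁻¹ • (a, b) := by
      simp [div_eq_inv_mul]
    rw [h1, norm_smul, norm_inv, Complex.norm_real, Real.norm_eq_abs, abs_of_pos hr0,
      inv_mul_cancel₀ hr0.ne']
  refine le_trans (measureReal_mono ?_ (measure_ne_top _ _)) (hnorm (a / r) (b / r) (u / r) hunit)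
  intro ω hω
  simp only [Set.mem_ofPred_eq] at hω ⊢
  have h1 : a / r * ξ₁ ω + b / r * ξ₂ ω - u / r = (a * ξ₁ ω + b * ξ₂ ω - u) / r := by
    field_simp
  rw [h1, norm_div, Complex.norm_real, Real.norm_eq_abs, abs_of_pos hr0]
  exact (div_le_self (norm_nonneg _) hr1).trans hω

theorem powerMeasure_Ici_one_lt_top {α : ℝ} (hα : 0 < α) : powerMeasure α (Set.Ici 1) < ∞ := by
  rw [powerMeasure, withDensity_apply _ measurableSet_Ici,
    Measure.restrict_restrict measurableSet_Ici]
  have h1 : Set.Ici (1 : ℝ) ∩ Set.Ioi 0 = Set.Ici 1 := by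
    ext x; simp only [Set.mem_inter_iff, Set.mem_Ici, Set.mem_Ioi, and_iff_left_iff_imp]
    intro h; linarith
  rw [h1, Measure.restrict_congr_set Ioi_ae_eq_Ici.symm]
  have h2 : IntegrableOn (fun r : ℝ => α * r ^ (-(1 + α))) (Set.Ioi 1) :=
    (integrableOn_Ioi_rpow_of_lt (by linarith) one_pos).const_mul α
  exact h2.setLIntegral_lt_top

theorem powerMeasure_Ici_one_pos {α : ℝ} (hα : 0 < α) : 0 < powerMeasure α (Set.Ici 1) := by
  rw [powerMeasure, withDensity_apply _ measurableSet_Ici,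
    Measure.restrict_restrict measurableSet_Ici]
  have hsub : Set.Icc (1 : ℝ) 2 ⊆ Set.Ici 1 ∩ Set.Ioi 0 := by
    intro x hx
    exact ⟨hx.1, lt_of_lt_of_le one_pos hx.1⟩
  refine lt_of_lt_of_le ?_ (lintegral_mono_set hsub)
  calc (0 : ℝ≥0∞) < ∫⁻ _r in Set.Icc (1 : ℝ) 2, ENNReal.ofReal (α * 2 ^ (-(1 + α))) := by
        rw [setLIntegral_const, Real.volume_Icc]
        refine ENNReal.mul_pos ?_ ?_
        · simp only [ne_eq, ENNReal.ofReal_eq_zero, not_le]; positivity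
        · norm_num
    _ ≤ _ := by
        refine setLIntegral_mono' measurableSet_Icc fun r hr => ENNReal.ofReal_le_ofReal ?_
        refine mul_le_mul_of_nonneg_left ?_ hα.le
        exact Real.rpow_le_rpow_of_nonpos (by linarith [hr.1]) hr.2 (by linarith)

section Condition

variable {Ω₀ : Type*} [MeasurableSpace Ω₀] {ν : Measure Ω₀} {ξ₁ ξ₂ ζ : Ω₀ → ℂ} {α : ℝ} {a : ℕ → ℝ}
  {θ : Measure UnitSphereC2}

theorem ConditionC2.eventually_pos (h : ConditionC2 ν ξ₁ ξ₂ ζ α a θ) : ∀ᶠ n in atTop, 0 < a n := by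
  obtain ⟨c, hc, hlim⟩ := h.scaling
  filter_upwards [hlim.eventually (lt_mem_nhds hc), eventually_gt_atTop 0] with n hn hn0
  have : 0 < (n : ℝ) ^ (1 / α) := by positivity
  exact (div_pos_iff_of_pos_right this).mp hn

theorem ConditionC2.tendsto_atTop (h : ConditionC2 ν ξ₁ ξ₂ ζ α a θ) : Tendsto a atTop atTop := by
  obtain ⟨c, hc, hlim⟩ := h.scaling
  have hα := h.pos
  have h1 : Tendsto (fun n : ℕ => (n : ℝ) ^ (1 / α)) atTop atTop :=
    (tendsto_rpow_atTop (by positivity)).comp tendsto_natCast_atTop_atTop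
  refine (hlim.pos_mul_atTop hc h1).congr' ?_
  filter_upwards [eventually_gt_atTop 0] with n hn
  have : 0 < (n : ℝ) ^ (1 / α) := by positivity
  field_simp

theorem ConditionC2.eventually_le (h : ConditionC2 ν ξ₁ ξ₂ ζ α a θ) :
    ∃ C : ℝ, 0 < C ∧ ∀ᶠ n : ℕ in atTop, a n ≤ C * (n : ℝ) ^ (1 / α) := by
  obtain ⟨c, hc, hlim⟩ := h.scaling
  refine ⟨c + 1, by positivity, ?_⟩
  filter_upwards [hlim.eventually (gt_mem_nhds (lt_add_one c)), eventually_gt_atTop 0] with n hn hn0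
  have : 0 < (n : ℝ) ^ (1 / α) := by positivity
  exact (div_le_iff₀ this).mp hn.le

/-- If `c ξ₁ + d ξ₂ = u` almost surely, then whenever `(ξ₁, ξ₂)` has norm at least `a n` its
direction `p` satisfies `‖c p₀ + d p₁‖ ≤ ‖u‖ / a n`, which tends to zero. So `θ` charges no region
where this quantity stays above a positive level, and its support lies on a complex line. -/
theorem ConditionC2.not_ae_const [IsProbabilityMeasure ν] (h : ConditionC2 ν ξ₁ ξ₂ ζ α a θ)
    (c d u : ℂ) (hcd : (c, d) ≠ (0, 0)) : ¬ ∀ᵐ ω ∂ν, c * ξ₁ ω + d * ξ₂ ω = u := by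
  intro hae
  apply h.nondegenerate
  refine ⟨c, d, hcd, ?_⟩
  have := h.finite
  let g : UnitSphereC2 → ℝ := fun p => ‖c * p.val 0 + d * p.val 1‖
  have hg : Continuous g := by fun_prop
  have hcl : IsClosed {p : UnitSphereC2 | c * p.val 0 + d * p.val 1 = 0} :=
    isClosed_eq (by fun_prop) continuous_const
  refine Measure.support_subset_of_isClosed hcl ?_
  have hlevel : ∀ η : ℝ, 0 < η → θ {p | g p = η} = 0 → θ {p | η < g p} = 0 := by
    intro η hη hη0
    have hopen : IsOpen {p | η < g p} := isOpen_lt continuous_const hg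
    have hfr : θ (frontier {p | η < g p}) = 0 := by
      refine measure_mono_null ?_ hη0
      intro p hp
      exact (frontier_lt_subset_eq continuous_const hg hp).symm
    have hlim := h.tail {p | η < g p} hopen.measurableSet hfr 1 one_pos
    have hzero : ∀ᶠ n : ℕ in atTop, (n : ℝ≥0∞) *
        ν {ω | ‖(!₂[ξ₁ ω, ξ₂ ω] : EuclideanSpace ℂ (Fin 2))‖⁻¹ •
                  (!₂[ξ₁ ω, ξ₂ ω] : EuclideanSpace ℂ (Fin 2)) ∈ Subtype.val '' {p | η < g p} ∧
                1 * a n ≤ ‖(!₂[ξ₁ ω, ξ₂ ω] : EuclideanSpace ℂ (Fin 2))‖} = 0 := by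
      filter_upwards [h.tendsto_atTop.eventually_ge_atTop (‖u‖ / η), h.eventually_pos] with n hn hn0
      rw [mul_eq_zero]; right
      refine measure_mono_null ?_ hae
      rintro ω ⟨⟨p, hp, hpe⟩, hω⟩ heq
      set N := ‖(!₂[ξ₁ ω, ξ₂ ω] : EuclideanSpace ℂ (Fin 2))‖ with hN
      rw [one_mul] at hω
      have hN0 : 0 < N := hn0.trans_le hω
      have hgp : η < g p := hp
      have h0 : p.val 0 = (N : ℂ)⁻¹ * ξ₁ ω := by rw [hpe]; simp
      have h1 : p.val 1 = (N : ℂ)⁻¹ * ξ₂ ω := by rw [hpe]; simp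
      have h2 : g p = N⁻¹ * ‖u‖ := by
        simp only [g]
        rw [h0, h1, show c * ((N : ℂ)⁻¹ * ξ₁ ω) + d * ((N : ℂ)⁻¹ * ξ₂ ω) =
          (N : ℂ)⁻¹ * (c * ξ₁ ω + d * ξ₂ ω) by ring, heq, norm_mul, norm_inv, Complex.norm_real,
          Real.norm_eq_abs, abs_of_pos hN0]
      rw [h2, ← div_eq_inv_mul, lt_div_iff₀ hN0] at hgp
      have h3 : ‖u‖ / η ≤ N := hn.trans hω
      rw [div_le_iff₀ hη] at h3
      linarith
    have h4 := tendsto_nhds_unique (hlim.congr' hzero) tendsto_const_nhds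
    rcases mul_eq_zero.mp h4 with h5 | h5
    · exact h5
    · exact absurd h5 (powerMeasure_Ici_one_pos h.pos).ne'
  -- The tail condition needs a `θ`-null boundary. Only countably many levels of `g` carry mass, so
  -- admissible levels exist arbitrarily close to zero.
  have hcount : {t : ℝ | 0 < θ {p | g p = t}}.Countable :=
    Measure.countable_meas_level_set_pos hg.measurable
  have hdense : ∀ n : ℕ, ∃ η : ℝ, 0 < η ∧ η < 1 / (n + 1 : ℝ) ∧ θ {p | g p = η} = 0 := by
    intro n
    have hpos : (0 : ℝ) < 1 / (n + 1) := by positivity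
    by_contra! hno
    have hsub : Set.Ioo (0 : ℝ) (1 / (n + 1)) ⊆ {t : ℝ | 0 < θ {p | g p = t}} := fun t ht =>
      pos_iff_ne_zero.mpr (hno t ht.1 ht.2)
    exact (Cardinal.Real.Ioo_countable_iff.mp (hcount.mono hsub)).not_gt hpos
  choose η hη0 hη1 hη2 using hdense
  have hcover : {p : UnitSphereC2 | c * p.val 0 + d * p.val 1 = 0}ᶜ ⊆ ⋃ n, {p | η n < g p} := by
    intro p hp
    have hgp : 0 < g p := norm_pos_iff.mpr hp
    obtain ⟨n, hn⟩ := exists_nat_one_div_lt hgp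
    exact Set.mem_iUnion.mpr ⟨n, (hη1 n).trans hn⟩
  exact measure_mono_null hcover (measure_iUnion_null fun n => hlevel _ (hη0 n) (hη2 n))

/-- Reading the tail condition at index `n ^ 4` gives probability `O(n⁻⁴)` beyond `a (n ^ 4)`,
itself polynomial in `n`. A union over `n²` entries then leaves `O(n⁻²)`. In `B ≥ 4 / α + 1` the
extra one absorbs the constant in the bound on `a`. -/
theorem ConditionC2.exists_tail_bound (h : ConditionC2 ν ξ₁ ξ₂ ζ α a θ) [IsProbabilityMeasure ν] :
    ∃ (B : ℕ) (C : ℝ), 0 < C ∧ ∀ᶠ n : ℕ in atTop, a n ≤ (n : ℝ) ^ B ∧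
      (∀ ξ ∈ ({ξ₁, ξ₂, ζ} : Set (Ω₀ → ℂ)), ν.real {ω | (n : ℝ) ^ B ≤ ‖ξ ω‖} ≤ C / (n : ℝ) ^ 4) := by
  have := h.finite
  have hα := h.pos
  obtain ⟨C₁, hC₁, hle⟩ := h.eventually_le
  obtain ⟨C₂, hC₂, hdiag⟩ := h.diag_tail
  have hlim := h.tail Set.univ MeasurableSet.univ (by simp) 1 one_pos
  have hL : θ Set.univ * powerMeasure α (Set.Ici 1) < ∞ :=
    ENNReal.mul_lt_top (measure_lt_top _ _) (powerMeasure_Ici_one_lt_top hα)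
  set L := θ Set.univ * powerMeasure α (Set.Ici 1) with hLdef
  have hev := hlim.eventually (gt_mem_nhds (ENNReal.lt_add_right hL.ne one_ne_zero))
  obtain ⟨B, hB⟩ := exists_nat_ge (4 / α + 1)
  have hpow4 : Tendsto (fun n : ℕ => n ^ 4) atTop atTop := tendsto_pow_atTop (by norm_num)
  refine ⟨B, L.toReal + 1 + C₂, by positivity, ?_⟩
  filter_upwards [hpow4.eventually hev, hpow4.eventually hle, hle, hpow4.eventually h.eventually_pos,
    eventually_ge_atTop 1, tendsto_natCast_atTop_atTop.eventually_ge_atTop C₁] with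
    n hn1 hn2 hn3 hn4 hn hnC
  have hn' : (1 : ℝ) ≤ n := by exact_mod_cast hn
  have hn0 : (0 : ℝ) < n := by linarith
  have hstep : ∀ t : ℝ, t ≤ 4 / α → C₁ * (n : ℝ) ^ t ≤ (n : ℝ) ^ B := by
    intro t ht
    calc C₁ * (n : ℝ) ^ t ≤ n * (n : ℝ) ^ (4 / α) := by gcongr
      _ = (n : ℝ) ^ (4 / α + 1) := by rw [Real.rpow_add hn0, Real.rpow_one]; ring
      _ ≤ (n : ℝ) ^ (B : ℝ) := by gcongr
      _ = (n : ℝ) ^ B := Real.rpow_natCast _ _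
  have haB : a n ≤ (n : ℝ) ^ B :=
    hn3.trans (hstep _ (div_le_div_of_nonneg_right (by norm_num) hα.le))
  have ha4 : a (n ^ 4) ≤ (n : ℝ) ^ B := by
    refine hn2.trans (le_trans (le_of_eq ?_) (hstep (4 / α) le_rfl))
    push_cast
    rw [← Real.rpow_natCast, ← Real.rpow_mul hn0.le]
    congr 2; push_cast; ring
  have hn4pos : (0 : ℝ) < (n : ℝ) ^ 4 := by positivity
  set S := {ω | ‖(!₂[ξ₁ ω, ξ₂ ω] : EuclideanSpace ℂ (Fin 2))‖⁻¹ •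
                  (!₂[ξ₁ ω, ξ₂ ω] : EuclideanSpace ℂ (Fin 2)) ∈
                    Subtype.val '' (Set.univ : Set UnitSphereC2) ∧
                1 * a (n ^ 4) ≤ ‖(!₂[ξ₁ ω, ξ₂ ω] : EuclideanSpace ℂ (Fin 2))‖} with hS
  have hSb : ν.real S ≤ (L.toReal + 1) / (n : ℝ) ^ 4 := by
    have h1 := ENNReal.toReal_mono (ENNReal.add_ne_top.mpr ⟨hL.ne, ENNReal.one_ne_top⟩) hn1.le
    rw [ENNReal.toReal_mul, ENNReal.toReal_add hL.ne ENNReal.one_ne_top] at h1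
    rw [le_div_iff₀ hn4pos, mul_comm]
    simpa [measureReal_def] using h1
  have hoff : ∀ ξ : Ω₀ → ℂ, (∀ ω, ‖ξ ω‖ ≤ ‖(!₂[ξ₁ ω, ξ₂ ω] : EuclideanSpace ℂ (Fin 2))‖) →
      ν.real {ω | (n : ℝ) ^ B ≤ ‖ξ ω‖} ≤ (L.toReal + 1 + C₂) / (n : ℝ) ^ 4 := by
    intro ξ hξ
    refine le_trans (measureReal_mono ?_ (measure_ne_top _ _)) (hSb.trans ?_)
    · intro ω hω
      have h1 : a (n ^ 4) ≤ ‖(!₂[ξ₁ ω, ξ₂ ω] : EuclideanSpace ℂ (Fin 2))‖ :=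
        ha4.trans (le_trans hω (hξ ω))
      refine ⟨?_, by rwa [one_mul]⟩
      have h2 : ‖(!₂[ξ₁ ω, ξ₂ ω] : EuclideanSpace ℂ (Fin 2))‖ ≠ 0 := (hn4.trans_le h1).ne'
      exact ⟨⟨_, by simp [norm_smul, h2]⟩, trivial, rfl⟩
    · exact div_le_div_of_nonneg_right (by linarith) hn4pos.le
  refine ⟨haB, ?_⟩
  rintro ξ (rfl | rfl | rfl)
  · exact hoff _ fun ω => by
      simpa using PiLp.norm_apply_le (!₂[ξ ω, ξ₂ ω] : EuclideanSpace ℂ (Fin 2)) 0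
  · exact hoff _ fun ω => by
      simpa using PiLp.norm_apply_le (!₂[ξ₁ ω, ξ ω] : EuclideanSpace ℂ (Fin 2)) 1
  · refine (hdiag _ (by positivity)).trans ?_
    have h1 : ((n : ℝ) ^ B) ^ (-α) ≤ 1 / (n : ℝ) ^ 4 := by
      rw [Real.rpow_neg (by positivity), ← one_div]
      apply one_div_le_one_div_of_le hn4pos
      rw [← Real.rpow_natCast, ← Real.rpow_natCast, ← Real.rpow_mul hn0.le]
      refine Real.rpow_le_rpow_of_exponent_le hn' ?_
      have : 4 / α ≤ B := by linarith
      rw [div_le_iff₀ hα] at this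
      exact_mod_cast this
    calc C₂ * ((n : ℝ) ^ B) ^ (-α) ≤ C₂ * (1 / (n : ℝ) ^ 4) := by gcongr
      _ = C₂ / (n : ℝ) ^ 4 := by ring
      _ ≤ _ := by gcongr; linarith [ENNReal.toReal_nonneg (a := L)]

end Condition

theorem IsEllipticRandomMatrix.isPairIndep {Ω₀ Ω : Type*} [MeasurableSpace Ω₀] [MeasurableSpace Ω]
    {ν : Measure Ω₀} {ξ₁ ξ₂ ζ : Ω₀ → ℂ} {P : Measure Ω} {n : ℕ}
    {X : Ω → Matrix (Fin n) (Fin n) ℂ} (h : IsEllipticRandomMatrix ν ξ₁ ξ₂ ζ P X) {ε q : ℝ}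
    (hs : ∀ a b u : ℂ, (1 ≤ ‖a‖ ∨ 1 ≤ ‖b‖) →
      ν.real {ω | ‖a * ξ₁ ω + b * ξ₂ ω - u‖ ≤ ε} ≤ q) :
    IsPairIndep P (fun ω i j => X ω i j) ε q where
  measurable := h.measurable
  indep := h.indep
  spread := by
    have key : ∀ i j, i < j → ∀ a b u : ℂ, P.real {ω | ‖a * X ω i j + b * X ω j i - u‖ ≤ ε} =
        ν.real {ω | ‖a * ξ₁ ω + b * ξ₂ ω - u‖ ≤ ε} := by
      intro i j hij a b u
      have hm : MeasurableSet {p : ℂ × ℂ | ‖a * p.1 + b * p.2 - u‖ ≤ ε} :=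
        measurableSet_le (by fun_prop) measurable_const
      exact congrArg ENNReal.toReal ((h.off_diag i j hij).measure_mem_eq hm)
    intro i j hij a b u hab
    rcases lt_or_gt_of_ne hij with hlt | hlt
    · rw [key i j hlt]; exact hs a b u hab
    · have h1 := key j i hlt b a u
      simp only [add_comm (b * _)] at h1
      rw [h1]
      simpa only [add_comm (b * _)] using hs b a u hab.symm

theorem IsEllipticRandomMatrix.measureReal_exists_le {Ω₀ Ω : Type*} [MeasurableSpace Ω₀]
    [MeasurableSpace Ω] {ν : Measure Ω₀} {ξ₁ ξ₂ ζ : Ω₀ → ℂ} {P : Measure Ω}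
    [IsProbabilityMeasure P] {n : ℕ} {X : Ω → Matrix (Fin n) (Fin n) ℂ}
    (h : IsEllipticRandomMatrix ν ξ₁ ξ₂ ζ P X) {t c : ℝ}
    (hc : ∀ ξ ∈ ({ξ₁, ξ₂, ζ} : Set (Ω₀ → ℂ)), ν.real {ω | t ≤ ‖ξ ω‖} ≤ c) :
    P.real {ω | ∃ i j, t ≤ ‖X ω i j‖} ≤ n ^ 2 * c := by
  have hm : MeasurableSet {p : ℂ | t ≤ ‖p‖} := measurableSet_le measurable_const (by fun_prop)
  have hm1 : MeasurableSet {p : ℂ × ℂ | t ≤ ‖p.1‖} := measurableSet_le measurable_const (by fun_prop)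
  have hm2 : MeasurableSet {p : ℂ × ℂ | t ≤ ‖p.2‖} := measurableSet_le measurable_const (by fun_prop)
  have key : ∀ i j, P.real {ω | t ≤ ‖X ω i j‖} ≤ c := by
    intro i j
    rcases lt_trichotomy i j with hij | rfl | hij
    · refine le_trans (le_of_eq ?_) (hc ξ₁ (by simp))
      exact congrArg ENNReal.toReal ((h.off_diag i j hij).measure_mem_eq hm1)
    · refine le_trans (le_of_eq ?_) (hc ζ (by simp))
      exact congrArg ENNReal.toReal ((h.diag i).measure_mem_eq hm)
    · refine le_trans (le_of_eq ?_) (hc ξ₂ (by simp))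
      exact congrArg ENNReal.toReal ((h.off_diag j i hij).measure_mem_eq hm2)
  have hset : {ω | ∃ i j, t ≤ ‖X ω i j‖} = ⋃ i, ⋃ j, {ω | t ≤ ‖X ω i j‖} := by
    ext ω; simp
  rw [hset]
  calc P.real (⋃ i, ⋃ j, {ω | t ≤ ‖X ω i j‖}) ≤ ∑ i, P.real (⋃ j, {ω | t ≤ ‖X ω i j‖}) :=
        measureReal_iUnion_fintype_le _
    _ ≤ ∑ i : Fin n, ∑ j : Fin n, P.real {ω | t ≤ ‖X ω i j‖} :=
        Finset.sum_le_sum fun i _ => measureReal_iUnion_fintype_le _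
    _ ≤ ∑ _i : Fin n, ∑ _j : Fin n, c :=
        Finset.sum_le_sum fun i _ => Finset.sum_le_sum fun j _ => key i j
    _ = n ^ 2 * c := by simp; ring

/-! ### Making all minors invertible by a small shift. -/

theorem Matrix.volume_det_add_eq_zero {W : Type*} [Fintype W] [DecidableEq W] (N : Matrix W W ℂ) :
    volume {t : ℝ | (N + Matrix.scalar W (t : ℂ)).det = 0} = 0 := by
  refine Set.Finite.measure_zero ?_ _
  have h1 : {z : ℂ | (-N).charpoly.IsRoot z}.Finite :=
    Polynomial.finite_setOfPred_isRoot (Matrix.charpoly_monic _).ne_zero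
  refine (h1.preimage (f := fun t : ℝ => (t : ℂ)) Complex.ofReal_injective.injOn).subset ?_
  intro t ht
  simp only [Set.mem_preimage, Set.mem_ofPred_eq, Polynomial.IsRoot, Matrix.eval_charpoly]
  rw [sub_neg_eq_add, add_comm]
  exact ht

namespace IsPairIndep

/-- A small real shift of the diagonal makes all minors almost surely invertible. -/
theorem exists_shift {V Ω : Type*} [LinearOrder V] [Fintype V] [MeasurableSpace Ω] {P : Measure Ω}
    {M : Ω → V → V → ℂ} {ε q : ℝ} (h : IsPairIndep P M ε q) {δ : ℝ} (hδ : 0 < δ) :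
    ∃ t : ℝ, 0 < t ∧ t < δ ∧ ∀ a, P {ω | (Matrix.of (minor
      (fun ω i j => M ω i j + if i = j then (t : ℂ) else 0) a ω)).det = 0} = 0 := by
  have := h.isProbabilityMeasure
  have hae : ∀ a, ∀ᵐ t : ℝ, P {ω | (Matrix.of (minor
      (fun ω i j => M ω i j + if i = j then (t : ℂ) else 0) a ω)).det = 0} = 0 := by
    intro a
    let S : Set (Ω × ℝ) := {p | (Matrix.of (minor
      (fun ω i j => M ω i j + if i = j then (p.2 : ℂ) else 0) a p.1)).det = 0}
    have hS : MeasurableSet S := by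
      have h1 : Measurable fun p : Ω × ℝ => minor
          (fun ω i j => M ω i j + if i = j then (p.2 : ℂ) else 0) a p.1 := by
        refine measurable_pi_lambda _ fun i => measurable_pi_lambda _ fun j => ?_
        refine ((h.measurable i j).comp measurable_fst).add ?_
        by_cases hij : (i : V) = j
        · simp only [hij, if_true]; fun_prop
        · simp only [hij, if_false]; fun_prop
      exact (Matrix.measurable_det_of.comp h1) (measurableSet_singleton 0)
    -- For each `ω` only finitely many shifts are bad, being roots of a characteristic polynomial;
    -- by Fubini almost every fixed shift is good for almost every `ω`.
    have h0 : (P.prod volume) S = 0 := by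
      rw [Measure.measure_prod_null hS]
      refine ae_of_all _ fun ω => ?_
      refine measure_mono_null ?_ (Matrix.volume_det_add_eq_zero (Matrix.of (minor M a ω)))
      intro t ht
      have ht' : (Matrix.of (minor
        (fun ω i j => M ω i j + if i = j then (t : ℂ) else 0) a ω)).det = 0 := ht
      have h2 : Matrix.of (minor (fun ω i j => M ω i j + if i = j then (t : ℂ) else 0) a ω) =
          Matrix.of (minor M a ω) + Matrix.scalar _ (t : ℂ) := by
        ext i j
        by_cases hij : i = j
        · subst hij; simp [minor]
        · simp [minor, hij, Subtype.coe_injective.ne hij]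
      rw [h2] at ht'
      exact ht'
    rw [Measure.prod_apply_symm hS, lintegral_eq_zero_iff
      (measurable_measure_prodMk_right hS)] at h0
    exact h0
  have hall := ae_all_iff.mpr hae
  obtain ⟨t, ht, htp⟩ := Measure.exists_mem_of_measure_ne_zero_of_ae (μ := volume) (s := Set.Ioo 0 δ)
    (by simp [hδ]) (ae_restrict_of_ae hall)
  exact ⟨t, ht.1, ht.2, htp⟩

end IsPairIndep

/-- Approximate null vector, normalized in the sup norm, of `X - w z` when the least singular value
of `w⁻¹ X - z` is small. -/
theorem exists_approx_null_of_leastSingularValue_le {n : ℕ} (hn : 0 < n)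
    (X : Matrix (Fin n) (Fin n) ℂ) (z : ℂ) {w τ : ℝ} (hw : 0 < w)
    (h : leastSingularValue (w⁻¹ • X - z • (1 : Matrix (Fin n) (Fin n) ℂ)) ≤ τ) :
    ∃ y : Fin n → ℂ, (∀ j, ‖y j‖ ≤ 1) ∧ (∃ j, ‖y j‖ = 1) ∧
      ∀ i, ‖∑ j, (X i j + if i = j then -(w * z) else 0) * y j‖ ≤ w * (τ * n) := by
  obtain ⟨x, hx0, hx⟩ := exists_norm_le_leastSingularValue hn
    (w⁻¹ • X - z • (1 : Matrix (Fin n) (Fin n) ℂ))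
  have : Nonempty (Fin n) := ⟨⟨0, hn⟩⟩
  have hwc : (w : ℂ) ≠ 0 := by exact_mod_cast hw.ne'
  obtain ⟨j₀, -, hj₀⟩ := Finset.exists_max_image Finset.univ (fun j => ‖x j‖) Finset.univ_nonempty
  have hpos : 0 < ‖x j₀‖ := by
    by_contra hle
    apply hx0
    ext j
    exact norm_le_zero_iff.mp ((hj₀ j (Finset.mem_univ j)).trans (not_lt.mp hle))
  set s := leastSingularValue (w⁻¹ • X - z • (1 : Matrix (Fin n) (Fin n) ℂ)) with hs
  have hs0 : 0 ≤ s := LinearMap.singularValues_nonneg _ _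
  have hτ : 0 ≤ τ := hs0.trans h
  have hnorm : ∀ u : ℂ, ‖u / (‖x j₀‖ : ℂ)‖ = ‖u‖ / ‖x j₀‖ := by intro u; simp
  refine ⟨fun j => x j / ‖x j₀‖, fun j => ?_, ⟨j₀, ?_⟩, fun i => ?_⟩
  · rw [hnorm, div_le_one hpos]; exact hj₀ j (Finset.mem_univ j)
  · rw [hnorm, div_self hpos.ne']
  · have h1 : ∑ j, (X i j + if i = j then -(w * z) else 0) * (x j / (‖x j₀‖ : ℂ)) =
        (w * ∑ j, (w⁻¹ • X - z • (1 : Matrix (Fin n) (Fin n) ℂ)) i j * x j) / (‖x j₀‖ : ℂ) := by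
      rw [Finset.mul_sum, Finset.sum_div]
      refine Finset.sum_congr rfl fun j _ => ?_
      by_cases hij : i = j
      · subst hij
        simp only [Matrix.sub_apply, Matrix.smul_apply, Matrix.one_apply_eq, if_true,
          Complex.real_smul, smul_eq_mul, Complex.ofReal_inv]
        field_simp
        ring
      · simp only [Matrix.sub_apply, Matrix.smul_apply, Matrix.one_apply_ne hij, hij, if_false,
          Complex.real_smul, smul_eq_mul, Complex.ofReal_inv]
        field_simp
        ring
    have h2 : Real.sqrt (∑ j, ‖x j‖ ^ 2) ≤ n * ‖x j₀‖ := by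
      rw [Real.sqrt_le_left (by positivity)]
      calc ∑ j, ‖x j‖ ^ 2 ≤ ∑ _j : Fin n, ‖x j₀‖ ^ 2 := by
            refine Finset.sum_le_sum fun j _ => ?_
            have := hj₀ j (Finset.mem_univ j)
            gcongr
        _ = n * ‖x j₀‖ ^ 2 := by simp
        _ ≤ (n * ‖x j₀‖) ^ 2 := by
            rw [mul_pow]
            gcongr
            have : (1 : ℝ) ≤ n := by exact_mod_cast hn
            nlinarith
    rw [h1, hnorm, norm_mul, Complex.norm_real, Real.norm_eq_abs, abs_of_pos hw, div_le_iff₀ hpos]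
    calc w * ‖∑ j, (w⁻¹ • X - z • (1 : Matrix (Fin n) (Fin n) ℂ)) i j * x j‖
        ≤ w * (s * Real.sqrt (∑ j, ‖x j‖ ^ 2)) := by gcongr; exact hx i
      _ ≤ w * (τ * (n * ‖x j₀‖)) := by gcongr
      _ = _ := by ring

/-! ### Polynomial scales and the limit of the bounds. -/

/-- The grid has side at most `n ^ (2D + 6)`, so `n ^ (4D + 12)` points, and one more power per
coordinate pays for choosing the support. The exponent `n - 2` covers both the full matrix and its
minors. -/
theorem netBound_le {m n l D : ℕ} {q : ℝ} (hmn : m ≤ n) (hn : 5 ≤ n) (hnm : n ≤ m + 1)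
    (hq0 : 0 ≤ q) (hq1 : q ≤ 1) :
    netBound m l ((n : ℝ) ^ D) (((n : ℝ) ^ (D + 3))⁻¹) q ≤
      ENNReal.ofReal ((n : ℝ) ^ ((4 * D + 13) * (l + 1)) * q ^ (n - 2)) := by
  have hn' : (5 : ℝ) ≤ n := by exact_mod_cast hn
  have hmn' : (m : ℝ) ≤ n := by exact_mod_cast hmn
  have hg : 2 * ⌈(m * (n : ℝ) ^ D + 1) / ((n : ℝ) ^ (D + 3))⁻¹⌉₊ + 1 ≤ n ^ (2 * D + 6) := by
    set x := (m * (n : ℝ) ^ D + 1) / ((n : ℝ) ^ (D + 3))⁻¹ with hx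
    have hx0 : 0 ≤ x := by positivity
    have h1 : (⌈x⌉₊ : ℝ) < x + 1 := Nat.ceil_lt_add_one hx0
    have h2 : x ≤ 2 * (n : ℝ) ^ (2 * D + 4) := by
      rw [hx, div_inv_eq_mul]
      have h3 : (1 : ℝ) ≤ (n : ℝ) ^ (D + 1) := one_le_pow₀ (by linarith)
      calc (m * (n : ℝ) ^ D + 1) * (n : ℝ) ^ (D + 3)
          ≤ (n * (n : ℝ) ^ D + (n : ℝ) ^ (D + 1)) * (n : ℝ) ^ (D + 3) := by gcongr
        _ = _ := by ring
    have h4 : (1 : ℝ) ≤ (n : ℝ) ^ (2 * D + 4) := one_le_pow₀ (by linarith)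
    have h5 : (2 * ⌈x⌉₊ + 1 : ℝ) ≤ (n : ℝ) ^ (2 * D + 6) := by
      have h6 : (n : ℝ) ^ (2 * D + 6) = (n : ℝ) ^ (2 * D + 4) * n ^ 2 := by ring
      have h7 : (25 : ℝ) ≤ (n : ℝ) ^ 2 := by nlinarith
      rw [h6]
      nlinarith
    exact_mod_cast h5
  have hcount : m ^ l * ((2 * ⌈(m * (n : ℝ) ^ D + 1) / ((n : ℝ) ^ (D + 3))⁻¹⌉₊ + 1) ^ 2) ^ (l + 1) ≤
      n ^ ((4 * D + 13) * (l + 1)) := by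
    calc m ^ l * ((2 * ⌈(m * (n : ℝ) ^ D + 1) / ((n : ℝ) ^ (D + 3))⁻¹⌉₊ + 1) ^ 2) ^ (l + 1)
        ≤ n ^ (l + 1) * ((n ^ (2 * D + 6)) ^ 2) ^ (l + 1) := by
          refine Nat.mul_le_mul ?_ (Nat.pow_le_pow_left (Nat.pow_le_pow_left hg 2) _)
          exact (Nat.pow_le_pow_left hmn l).trans (Nat.pow_le_pow_right (by omega) (by omega))
      _ = _ := by rw [← pow_mul, ← pow_mul, ← pow_add]; congr 1; ring
  rw [netBound, ENNReal.ofReal_mul (by positivity), ENNReal.ofReal_pow hq0]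
  gcongr ?_ * ?_
  · have h1 : ENNReal.ofReal ((n : ℝ) ^ ((4 * D + 13) * (l + 1))) =
        ((n ^ ((4 * D + 13) * (l + 1)) : ℕ) : ℝ≥0∞) := by
      rw [← ENNReal.ofReal_natCast, Nat.cast_pow]
    rw [h1]
    exact Nat.cast_le.mpr hcount
  · exact pow_le_pow_right_of_le_one' (by simpa using hq1) (by omega)

/-- The number of coordinates separating sparse from spread vectors in dimension `n`. -/
noncomputable def sparsity (n : ℕ) : ℕ := ⌊(n : ℝ) ^ (9 / 10 : ℝ)⌋₊

theorem sparsity_le (n : ℕ) : (sparsity n : ℝ) ≤ (n : ℝ) ^ (9 / 10 : ℝ) :=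
  Nat.floor_le (by positivity)

theorem tendsto_rpow_sub_one {r : ℝ} (hr : r < 1) :
    Tendsto (fun n : ℕ => (n : ℝ) ^ r / n) atTop (𝓝 0) := by
  have h1 := (tendsto_rpow_neg_atTop (y := 1 - r) (by linarith)).comp
    (tendsto_natCast_atTop_atTop (R := ℝ))
  refine h1.congr' ?_
  filter_upwards [eventually_gt_atTop 0] with n hn
  have hn' : (0 : ℝ) < n := by exact_mod_cast hn
  simp only [Function.comp_apply]
  rw [neg_sub, Real.rpow_sub_one hn'.ne']

theorem eventually_le_sparsity : ∀ᶠ n : ℕ in atTop, (n : ℝ) ^ (9 / 10 : ℝ) / 2 ≤ sparsity n := by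
  have h1 : Tendsto (fun n : ℕ => (n : ℝ) ^ (9 / 10 : ℝ)) atTop atTop :=
    (tendsto_rpow_atTop (by norm_num)).comp tendsto_natCast_atTop_atTop
  filter_upwards [h1.eventually_ge_atTop 2] with n hn
  have := Nat.lt_floor_add_one ((n : ℝ) ^ (9 / 10 : ℝ))
  rw [sparsity]
  linarith

theorem eventually_two_mul_sparsity_lt : ∀ᶠ n : ℕ in atTop, 2 * sparsity n + 1 ≤ n := by
  have h1 := tendsto_rpow_sub_one (r := 9 / 10) (by norm_num)
  filter_upwards [h1.eventually (gt_mem_nhds (show (0 : ℝ) < 1 / 4 by norm_num)),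
    eventually_ge_atTop 2] with n hn hn2
  have hn' : (2 : ℝ) ≤ n := by exact_mod_cast hn2
  rw [div_lt_iff₀ (by linarith)] at hn
  have h2 := sparsity_le n
  have h3 : (2 * sparsity n + 1 : ℝ) ≤ n := by linarith
  exact_mod_cast h3

/-- The logarithm is at most `H n ^ (9/10) log n + (n - 2) log q`, where the negative linear term
dominates. -/
theorem tendsto_pow_sparsity_mul_pow {q : ℝ} (hq0 : 0 < q) (hq1 : q < 1) (H : ℕ) :
    Tendsto (fun n : ℕ => (n : ℝ) ^ (H * sparsity n) * q ^ (n - 2)) atTop (𝓝 0) := by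
  have hlogq : Real.log q < 0 := Real.log_neg hq0 hq1
  have hlim : Tendsto (fun n : ℕ => (n : ℝ) * (H * ((n : ℝ) ^ (9 / 10 : ℝ) * Real.log n / n) +
      (1 - 2 / n) * Real.log q)) atTop atBot := by
    have h1 : Tendsto (fun n : ℕ => (n : ℝ) ^ (9 / 10 : ℝ) * Real.log n / n) atTop (𝓝 0) := by
      have h2 := ((isLittleO_log_rpow_atTop (r := 1 / 10) (by norm_num)).tendsto_div_nhds_zero).comp
        (tendsto_natCast_atTop_atTop (R := ℝ))
      refine h2.congr' ?_
      filter_upwards [eventually_gt_atTop 0] with n hn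
      have hn' : (0 : ℝ) < n := by exact_mod_cast hn
      simp only [Function.comp_apply]
      have h3 : (n : ℝ) = (n : ℝ) ^ (9 / 10 : ℝ) * (n : ℝ) ^ (1 / 10 : ℝ) := by
        rw [← Real.rpow_add hn']; norm_num
      have h4 : (0 : ℝ) < (n : ℝ) ^ (9 / 10 : ℝ) := by positivity
      have h5 : (0 : ℝ) < (n : ℝ) ^ (1 / 10 : ℝ) := by positivity
      rw [div_eq_div_iff h5.ne' hn'.ne']
      nth_rewrite 2 [h3]
      ring
    have h2 : Tendsto (fun n : ℕ => (2 : ℝ) / n) atTop (𝓝 0) :=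
      tendsto_const_nhds.div_atTop tendsto_natCast_atTop_atTop
    have h3 := (h1.const_mul (H : ℝ)).add ((h2.const_sub 1).mul_const (Real.log q))
    rw [mul_zero, sub_zero, one_mul, zero_add] at h3
    exact tendsto_natCast_atTop_atTop.atTop_mul_neg hlogq h3
  refine squeeze_zero' (Eventually.of_forall fun n => by positivity) ?_
    (Real.tendsto_exp_atBot.comp hlim)
  filter_upwards [eventually_ge_atTop 2] with n hn
  have hn' : (2 : ℝ) ≤ n := by exact_mod_cast hn
  have hn0 : (0 : ℝ) < n := by linarith
  have hlogn : 0 ≤ Real.log n := Real.log_nonneg (by linarith)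
  simp only [Function.comp_apply]
  have h1 : (n : ℝ) ^ (H * sparsity n) * q ^ (n - 2) =
      Real.exp ((H * sparsity n : ℕ) * Real.log n + ((n - 2 : ℕ) : ℝ) * Real.log q) := by
    rw [Real.exp_add, Real.exp_nat_mul, Real.exp_nat_mul, Real.exp_log hn0, Real.exp_log hq0]
  rw [h1]
  apply Real.exp_le_exp.mpr
  have h2 : (n : ℝ) * (H * ((n : ℝ) ^ (9 / 10 : ℝ) * Real.log n / n) +
      (1 - 2 / n) * Real.log q) = H * (n : ℝ) ^ (9 / 10 : ℝ) * Real.log n + (n - 2) * Real.log q := by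
    field_simp
  rw [h2, Nat.cast_sub hn]
  push_cast
  gcongr
  exact sparsity_le n

/-- The threshold `s = k ^ (-1/4)` balances `s` against `s⁻¹ k ^ (-1/2)`. The total is of order `n k
^ (-5/4)`, so `k = n ^ γ` needs `γ > 4/5`, while the net bound needs `γ < 1`; `9/10` gives `n ^
(-1/8)`. -/
theorem tendsto_div_sparsity_mul (c : ℝ) (hc : 0 ≤ c) :
    Tendsto (fun n : ℕ => (n : ℝ) / (2 * sparsity n : ℕ) *
      ((sparsity n : ℝ) ^ (-(1 / 4) : ℝ) + ((sparsity n : ℝ) ^ (-(1 / 4) : ℝ))⁻¹ *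
        (2 * (c / Real.sqrt (sparsity n))))) atTop (𝓝 0) := by
  have h1 := ((tendsto_rpow_neg_atTop (y := 1 / 8) (by norm_num)).comp
    (tendsto_natCast_atTop_atTop (R := ℝ))).const_mul ((1 + 2 * c) / 2 * 2 ^ (5 / 4 : ℝ))
  rw [mul_zero] at h1
  refine squeeze_zero' (Eventually.of_forall fun n => by positivity) ?_ h1
  filter_upwards [eventually_le_sparsity, eventually_gt_atTop 0] with n hn hn0
  have hn' : (0 : ℝ) < n := by exact_mod_cast hn0
  set k : ℝ := (sparsity n : ℝ) with hk
  have hk0 : 0 < k := lt_of_lt_of_le (by positivity) hn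
  simp only [Function.comp_apply]
  have e1 : k ^ (-(1 / 4) : ℝ) + (k ^ (-(1 / 4) : ℝ))⁻¹ * (2 * (c / Real.sqrt k)) =
      (1 + 2 * c) * k ^ (-(1 / 4) : ℝ) := by
    have h2 : (k ^ (-(1 / 4) : ℝ))⁻¹ * (Real.sqrt k)⁻¹ = k ^ (-(1 / 4) : ℝ) := by
      rw [Real.sqrt_eq_rpow, ← Real.rpow_neg hk0.le, ← Real.rpow_neg hk0.le, ← Real.rpow_add hk0]
      norm_num
    calc _ = k ^ (-(1 / 4) : ℝ) + 2 * c * ((k ^ (-(1 / 4) : ℝ))⁻¹ * (Real.sqrt k)⁻¹) := by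
          rw [div_eq_mul_inv]; ring
      _ = _ := by rw [h2]; ring
  have e2 : (n : ℝ) / (2 * sparsity n : ℕ) * ((1 + 2 * c) * k ^ (-(1 / 4) : ℝ)) =
      (1 + 2 * c) / 2 * (n * k ^ (-(5 / 4) : ℝ)) := by
    have h2 : k ^ (-(5 / 4) : ℝ) = k ^ (-(1 / 4) : ℝ) / k := by
      rw [← Real.rpow_sub_one hk0.ne']; norm_num
    rw [h2]; push_cast; rw [← hk]; field_simp
  rw [e1, e2, mul_assoc]
  refine mul_le_mul_of_nonneg_left ?_ (by positivity)
  have h3 : k ^ (-(5 / 4) : ℝ) ≤ ((n : ℝ) ^ (9 / 10 : ℝ) / 2) ^ (-(5 / 4) : ℝ) :=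
    Real.rpow_le_rpow_of_nonpos (by positivity) hn (by norm_num)
  calc n * k ^ (-(5 / 4) : ℝ) ≤ n * ((n : ℝ) ^ (9 / 10 : ℝ) / 2) ^ (-(5 / 4) : ℝ) := by gcongr
    _ = 2 ^ (5 / 4 : ℝ) * (n : ℝ) ^ (-(1 / 8) : ℝ) := by
        rw [Real.div_rpow (by positivity) (by norm_num), ← Real.rpow_mul hn'.le,
          Real.rpow_neg (by norm_num : (0 : ℝ) ≤ 2), div_inv_eq_mul]
        have h4 : (n : ℝ) ^ (-(1 / 8) : ℝ) = n * (n : ℝ) ^ (9 / 10 * -(5 / 4) : ℝ) := by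
          nth_rewrite 2 [← Real.rpow_one (n : ℝ)]
          rw [← Real.rpow_add hn']; norm_num
        rw [h4]; ring

/-- The bound of `IsPairIndep.measure_approx_null_le` at the polynomial scales `K = n ^ D`,
`η = n ^ (-(D + 3))`. -/
theorem IsPairIndep.measureReal_approx_null_le {Ω : Type*} [MeasurableSpace Ω] {P : Measure Ω}
    {n : ℕ} {M : Ω → Fin n → Fin n → ℂ} {ε q σ : ℝ} (h : IsPairIndep P M ε q) (hq0 : 0 ≤ q)
    (hq : q < 1) (hε0 : 0 < ε) (hε : ε ≤ 1) {D : ℕ} (hn5 : 5 ≤ n) (hnε : 8 / ε ≤ n)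
    (hk : 0 < sparsity n) (hl : 2 * sparsity n + 1 ≤ n) (hσ0 : 0 ≤ σ) (hσε : σ ≤ ε / 4)
    (hσ : 2 * (n : ℝ) ^ 2 * (n : ℝ) ^ D * σ ≤
      ε ^ 2 * (((n : ℝ) ^ (D + 3))⁻¹) ^ 2 / 32 * ((n : ℝ) ^ (D + 3))⁻¹)
    (hdet : ∀ a, P {ω | (Matrix.of (minor M a ω)).det = 0} = 0) :
    P.real {ω | (∀ i j, ‖M ω i j‖ ≤ (n : ℝ) ^ D) ∧ ∃ y : Fin n → ℂ, (∀ j, ‖y j‖ ≤ 1) ∧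
        (∃ j, ‖y j‖ = 1) ∧ ∀ i, ‖∑ j, M ω i j * y j‖ ≤ σ} ≤
      3 * ((n : ℝ) ^ ((12 * D + 42) * sparsity n) * q ^ (n - 2)) +
      (n : ℝ) / (2 * sparsity n : ℕ) *
      ((sparsity n : ℝ) ^ (-(1 / 4) : ℝ) + ((sparsity n : ℝ) ^ (-(1 / 4) : ℝ))⁻¹ *
        (2 * (3 / (1 - q) ^ 2 / Real.sqrt (sparsity n)))) := by
  set k := sparsity n with hkdef
  set η : ℝ := ((n : ℝ) ^ (D + 3))⁻¹ with hη
  set s : ℝ := (k : ℝ) ^ (-(1 / 4) : ℝ) with hs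
  have hn : (5 : ℝ) ≤ n := by exact_mod_cast hn5
  have hn0 : (0 : ℝ) < n := by linarith
  have hk1 : (1 : ℝ) ≤ k := by exact_mod_cast hk
  have hk0 : (0 : ℝ) < k := by linarith
  have hs0 : 0 < s := by positivity
  have hp : 0 < 1 - q := by linarith
  have hη0 : 0 < η := by positivity
  have hη1 : η * (n : ℝ) ^ (D + 1) = ((n : ℝ) ^ 2)⁻¹ := by
    rw [hη]; field_simp; ring
  have hηε : (n * (n : ℝ) ^ D + 1) * η ≤ ε / 4 := by
    have h1 : (1 : ℝ) ≤ (n : ℝ) ^ (D + 1) := one_le_pow₀ (by linarith)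
    have h2 : (n * (n : ℝ) ^ D + 1) * η ≤ 2 * ((n : ℝ) ^ 2)⁻¹ := by
      rw [← hη1]
      have : n * (n : ℝ) ^ D = (n : ℝ) ^ (D + 1) := by ring
      rw [this]
      nlinarith
    have h3 : 2 * ((n : ℝ) ^ 2)⁻¹ ≤ ε / 4 := by
      rw [div_le_iff₀ hε0] at hnε
      rw [← div_eq_mul_inv, div_le_iff₀ (by positivity)]
      nlinarith
    linarith
  have hη2 : η ≤ 1 / 2 := by
    have h1 : 0 ≤ n * (n : ℝ) ^ D * η := by positivity
    nlinarith
  have hmain := h.measure_approx_null_le (K := (n : ℝ) ^ D) (s := s) hq0 hq hε0 hε (by positivity)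
    hη0 hη2 hs0 (by simpa using hηε) hk (by simpa using hl) hσ0 hσε (by simpa using hσ) hdet
  simp only [Fintype.card_fin] at hmain
  set U : ℝ := (n : ℝ) ^ ((4 * D + 13) * (2 * k + 1)) * q ^ (n - 2) with hU
  have hU0 : 0 ≤ U := by positivity
  have hNB1 : netBound n (2 * k) ((n : ℝ) ^ D) η q ≤ ENNReal.ofReal U :=
    netBound_le le_rfl hn5 (by omega) hq0 hq.le
  have hNB2 : netBound (n - 1) (2 * k) ((n : ℝ) ^ D) η q ≤ ENNReal.ofReal U :=
    netBound_le (by omega) hn5 (by omega) hq0 hq.le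
  clear_value U
  have hdiv : ((n : ℝ≥0∞) / (2 * k : ℕ)) = ENNReal.ofReal ((n : ℝ) / (2 * k : ℕ)) := by
    rw [ENNReal.ofReal_div_of_pos (by positivity), ENNReal.ofReal_natCast, ENNReal.ofReal_natCast]
  have hpow : ((n ^ k : ℕ) : ℝ≥0∞) = ENNReal.ofReal ((n : ℝ) ^ k) := by
    rw [← ENNReal.ofReal_natCast, Nat.cast_pow]
  have hnn : (n : ℝ≥0∞) = ENNReal.ofReal n := (ENNReal.ofReal_natCast n).symm
  have h2 : (2 : ℝ≥0∞) = ENNReal.ofReal 2 := by simp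
  set f : ℝ := 3 / ((1 - q) ^ 2 * Real.sqrt k) with hf
  have hf0 : 0 ≤ f := by positivity
  have htotal := calc
    P {ω | (∀ i j, ‖M ω i j‖ ≤ (n : ℝ) ^ D) ∧ ∃ y : Fin n → ℂ, (∀ j, ‖y j‖ ≤ 1) ∧
        (∃ j, ‖y j‖ = 1) ∧ ∀ i, ‖∑ j, M ω i j * y j‖ ≤ σ}
      ≤ ENNReal.ofReal U + ENNReal.ofReal ((n : ℝ) / (2 * k : ℕ)) * (ENNReal.ofReal s +
          ENNReal.ofReal s⁻¹ * (ENNReal.ofReal 2 * ENNReal.ofReal f +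
            ENNReal.ofReal ((n : ℝ) ^ k) * ENNReal.ofReal U) +
          ENNReal.ofReal n * ENNReal.ofReal U) := by
        refine hmain.trans ?_
        rw [hdiv, hpow, hnn, h2]
        gcongr
    _ = ENNReal.ofReal (U + (n : ℝ) / (2 * k : ℕ) * (s + s⁻¹ * (2 * f + (n : ℝ) ^ k * U) + n * U)) := by
        rw [ENNReal.ofReal_add hU0 (by positivity), ENNReal.ofReal_mul (by positivity),
          ENNReal.ofReal_add (by positivity) (by positivity),
          ENNReal.ofReal_add hs0.le (by positivity), ENNReal.ofReal_mul (by positivity),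
          ENNReal.ofReal_add (by positivity) (by positivity), ENNReal.ofReal_mul (by norm_num),
          ENNReal.ofReal_mul (by positivity), ENNReal.ofReal_mul (by positivity)]
  refine (ENNReal.toReal_le_of_le_ofReal (by positivity) htotal).trans ?_
  have hsinv : s⁻¹ ≤ n := by
    rw [hs, ← Real.rpow_neg hk0.le]
    calc (k : ℝ) ^ (-(-(1 / 4)) : ℝ) ≤ (k : ℝ) ^ (1 : ℝ) :=
          Real.rpow_le_rpow_of_exponent_le hk1 (by norm_num)
      _ = k := Real.rpow_one _
      _ ≤ n := by exact_mod_cast (by omega : k ≤ n)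
  have hquot : (n : ℝ) / (2 * k : ℕ) ≤ n := by
    apply div_le_self hn0.le
    push_cast; linarith
  have hpk : (n : ℝ) ≤ (n : ℝ) ^ k := le_self_pow₀ (by linarith) (by omega)
  have hpk1 : (1 : ℝ) ≤ (n : ℝ) ^ k := by linarith
  -- One quantity dominating every net term with its polynomial prefactor: since `k ≥ 1`, `k + 2 +
  -- (4D + 13)(2k + 1) ≤ (12D + 42)k`.
  set W : ℝ := (n : ℝ) ^ ((12 * D + 42) * k) * q ^ (n - 2) with hW
  have hUW : (n : ℝ) * (n * ((n : ℝ) ^ k * U)) ≤ W := by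
    rw [hU, hW]
    calc (n : ℝ) * (n * ((n : ℝ) ^ k * ((n : ℝ) ^ ((4 * D + 13) * (2 * k + 1)) * q ^ (n - 2))))
        = (n : ℝ) ^ (k + 2 + (4 * D + 13) * (2 * k + 1)) * q ^ (n - 2) := by
          rw [pow_add, pow_add]; ring
      _ ≤ _ := by
          gcongr
          · linarith
          · nlinarith
  have hff : f = 3 / (1 - q) ^ 2 / Real.sqrt k := by rw [hf, div_div]
  rw [← hff]
  have g1 : U ≤ W := by
    refine le_trans ?_ hUW
    calc U = 1 * (1 * (1 * U)) := by ring
      _ ≤ _ := by gcongr <;> linarith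
  have g2 : (n : ℝ) / (2 * k : ℕ) * (s⁻¹ * ((n : ℝ) ^ k * U)) ≤ W := by
    refine le_trans ?_ hUW
    gcongr
  have g3 : (n : ℝ) / (2 * k : ℕ) * (n * U) ≤ W := by
    refine le_trans ?_ hUW
    gcongr
    exact le_mul_of_one_le_left hU0 hpk1
  calc U + (n : ℝ) / (2 * k : ℕ) * (s + s⁻¹ * (2 * f + (n : ℝ) ^ k * U) + n * U)
      = U + (n : ℝ) / (2 * k : ℕ) * (s⁻¹ * ((n : ℝ) ^ k * U)) + (n : ℝ) / (2 * k : ℕ) * (n * U) +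
        (n : ℝ) / (2 * k : ℕ) * (s + s⁻¹ * (2 * f)) := by ring
    _ ≤ _ := by linarith

/-! ### Assembly. -/

theorem theorem5p5
    {Ω₀ : Type*} [MeasurableSpace Ω₀] (ν : Measure Ω₀) [IsProbabilityMeasure ν]
    (ξ₁ ξ₂ ζ : Ω₀ → ℂ) (hξ₁ : Measurable ξ₁) (hξ₂ : Measurable ξ₂) (hζ : Measurable ζ)
    (α : ℝ) (a : ℕ → ℝ) (θ : Measure UnitSphereC2)
    (hC2 : ConditionC2 ν ξ₁ ξ₂ ζ α a θ)
    {Ω : ℕ → Type*} [∀ n, MeasurableSpace (Ω n)] (P : ∀ n, Measure (Ω n))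
    [∀ n, IsProbabilityMeasure (P n)]
    (X : ∀ n, Ω n → Matrix (Fin n) (Fin n) ℂ)
    (hX : ∀ n, IsEllipticRandomMatrix ν ξ₁ ξ₂ ζ (P n) (X n))
    (z : ℂ) :
    ∃ C r : ℝ, 0 < C ∧ 0 < r ∧
      Tendsto (fun n : ℕ => (P n).real
          {ω | leastSingularValue ((a n)⁻¹ • X n ω - z • (1 : Matrix (Fin n) (Fin n) ℂ))
                ≤ C * (n : ℝ) ^ (-r)})
        atTop (𝓝 0) := by
  obtain ⟨ε, q', hε0, hε1, hq'0, hq'1, hspread⟩ := exists_spread ν ξ₁ ξ₂ hξ₁ hξ₂ hC2.not_ae_const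
  obtain ⟨B, C, hC, htail⟩ := hC2.exists_tail_bound
  -- Raised to at least `1/2` so that `q` is positive and its logarithm usable.
  set q := max q' (1 / 2) with hq
  have hq0 : 0 < q := lt_max_of_lt_right (by norm_num)
  have hq1 : q < 1 := max_lt hq'1 (by norm_num)
  have hspread' : ∀ c d u : ℂ, (1 ≤ ‖c‖ ∨ 1 ≤ ‖d‖) →
      ν.real {ω | ‖c * ξ₁ ω + d * ξ₂ ω - u‖ ≤ ε} ≤ q := fun c d u hcd =>
    (hspread c d u hcd).trans (le_max_left _ _)
  -- Entries of the shifted matrix are at most `n ^ B * (‖z‖ + 2) ≤ n ^ (B + 1)`.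
  set D := B + 1 with hD
  -- The part `3 * (D + 3)` matches `η³`; the other `D + 3` cancels `n ^ (D + 2)` and leaves `2 / n
  -- ≤ ε² / 32`.
  set r₀ := D + 3 + 3 * (D + 3) with hr₀
  -- `B` pays for `a n`, one power for passing from the Euclidean to the sup norm, and one more
  -- brings the residual below `σ / 2`.
  set R := B + 2 + r₀ with hR
  refine ⟨1, R, one_pos, by positivity, ?_⟩
  have hlim : Tendsto (fun n : ℕ => C / (n : ℝ) ^ 2 +
      (3 * ((n : ℝ) ^ ((12 * D + 42) * sparsity n) * q ^ (n - 2)) +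
      (n : ℝ) / (2 * sparsity n : ℕ) *
      ((sparsity n : ℝ) ^ (-(1 / 4) : ℝ) + ((sparsity n : ℝ) ^ (-(1 / 4) : ℝ))⁻¹ *
        (2 * (3 / (1 - q) ^ 2 / Real.sqrt (sparsity n)))))) atTop (𝓝 0) := by
    have h1 : Tendsto (fun n : ℕ => C / (n : ℝ) ^ 2) atTop (𝓝 0) :=
      tendsto_const_nhds.div_atTop
        ((tendsto_pow_atTop (by norm_num)).comp tendsto_natCast_atTop_atTop)
    have h2 := (tendsto_pow_sparsity_mul_pow hq0 hq1 (12 * D + 42)).const_mul 3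
    have h3 := tendsto_div_sparsity_mul (3 / (1 - q) ^ 2) (by positivity)
    simpa using h1.add (h2.add h3)
  refine squeeze_zero' (Eventually.of_forall fun n => measureReal_nonneg) ?_ hlim
  filter_upwards [htail, hC2.eventually_pos, eventually_two_mul_sparsity_lt, eventually_le_sparsity,
    eventually_ge_atTop 5, tendsto_natCast_atTop_atTop.eventually_ge_atTop (‖z‖ + 2),
    tendsto_natCast_atTop_atTop.eventually_ge_atTop (64 / ε ^ 2)] with n ht han hsp hsp' hn5 hnz hnε
  obtain ⟨haB, ht⟩ := ht
  have hn : (5 : ℝ) ≤ n := by exact_mod_cast hn5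
  have hn0 : (0 : ℝ) < n := by linarith
  have hk : 0 < sparsity n := by
    have : (0 : ℝ) < sparsity n := lt_of_lt_of_le (by positivity) hsp'
    exact_mod_cast this
  have hε2 : 64 ≤ ε ^ 2 * n := by
    rw [div_le_iff₀ (by positivity)] at hnε; linarith
  have hnε8 : 8 / ε ≤ n := by
    rw [div_le_iff₀ hε0]; nlinarith
  set σ : ℝ := ((n : ℝ) ^ r₀)⁻¹ with hσ
  have hσ0 : 0 < σ := by positivity
  have hpair := ((hX n).isPairIndep hspread').add_diagonal fun _ => -((a n : ℂ) * z)
  -- The shift makes all minors almost surely invertible; being below `σ / 2`, it uses up only the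
  -- other half of the allowed residual.
  obtain ⟨t, ht0, htσ, htdet⟩ := hpair.exists_shift (half_pos hσ0)
  have hpair' := hpair.add_diagonal fun _ => (t : ℂ)
  have hσn : σ * n ≤ 1 := by
    rw [hσ, inv_mul_le_iff₀ (by positivity), mul_one]
    exact le_self_pow₀ (by linarith) (by omega)
  have hσε : σ ≤ ε / 4 := by
    rw [div_le_iff₀ hε0] at hnε8
    nlinarith
  have hσ' : 2 * (n : ℝ) ^ 2 * (n : ℝ) ^ D * σ ≤
      ε ^ 2 * (((n : ℝ) ^ (D + 3))⁻¹) ^ 2 / 32 * ((n : ℝ) ^ (D + 3))⁻¹ := by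
    have h1 : 2 * (n : ℝ) ^ 2 * (n : ℝ) ^ D * σ = 2 / n * (((n : ℝ) ^ (D + 3))⁻¹) ^ 3 := by
      rw [hσ, hr₀]; field_simp; ring
    have h2 : ε ^ 2 * (((n : ℝ) ^ (D + 3))⁻¹) ^ 2 / 32 * ((n : ℝ) ^ (D + 3))⁻¹ =
        ε ^ 2 / 32 * (((n : ℝ) ^ (D + 3))⁻¹) ^ 3 := by ring
    rw [h1, h2]
    gcongr ?_ * _
    rw [div_le_div_iff₀ hn0 (by norm_num)]
    linarith
  have hmain := hpair'.measureReal_approx_null_le (D := D) hq0.le hq1 hε0 hε1 hn5 hnε8 hk hsp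
    hσ0.le hσε hσ' htdet
  have hbig := (hX n).measureReal_exists_le ht
  have hbig' : (P n).real {ω | ∃ i j, (n : ℝ) ^ B ≤ ‖X n ω i j‖} ≤ C / (n : ℝ) ^ 2 := by
    refine hbig.trans (le_of_eq ?_)
    field_simp
  refine le_trans (measureReal_mono ?_ (measure_ne_top _ _))
    ((measureReal_union_le _ _).trans (add_le_add hbig' hmain))
  intro ω hω
  by_cases hent : ∃ i j, (n : ℝ) ^ B ≤ ‖X n ω i j‖
  · exact Or.inl hent
  push Not at hent
  refine Or.inr ⟨fun i j => ?_, ?_⟩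
  · have h1 : ‖if i = j then -((a n : ℂ) * z) else 0‖ ≤ (n : ℝ) ^ B * ‖z‖ := by
      split_ifs
      · rw [norm_neg, norm_mul, Complex.norm_real, Real.norm_eq_abs, abs_of_pos han]
        gcongr
      · rw [norm_zero]; positivity
    have hB1 : (1 : ℝ) ≤ (n : ℝ) ^ B := one_le_pow₀ (by linarith)
    have h2 : ‖if i = j then (t : ℂ) else 0‖ ≤ (n : ℝ) ^ B := by
      split_ifs
      · rw [Complex.norm_real, Real.norm_eq_abs, abs_of_pos ht0]
        nlinarith
      · rw [norm_zero]; positivity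
    calc ‖X n ω i j + (if i = j then -((a n : ℂ) * z) else 0) + (if i = j then (t : ℂ) else 0)‖
        ≤ (n : ℝ) ^ B + (n : ℝ) ^ B * ‖z‖ + (n : ℝ) ^ B :=
          norm_add₃_le.trans (add_le_add (add_le_add (hent i j).le h1) h2)
      _ = (n : ℝ) ^ B * (‖z‖ + 2) := by ring
      _ ≤ (n : ℝ) ^ B * n := by gcongr
      _ = (n : ℝ) ^ D := by rw [hD, pow_succ]
  · have hω' : leastSingularValue ((a n)⁻¹ • X n ω - z • (1 : Matrix (Fin n) (Fin n) ℂ)) ≤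
        ((n : ℝ) ^ R)⁻¹ := by
      have h1 : leastSingularValue ((a n)⁻¹ • X n ω - z • (1 : Matrix (Fin n) (Fin n) ℂ)) ≤
        1 * (n : ℝ) ^ (-(R : ℝ)) := hω
      rwa [one_mul, Real.rpow_neg hn0.le, Real.rpow_natCast] at h1
    obtain ⟨y, hy1, hy2, hy⟩ :=
      exists_approx_null_of_leastSingularValue_le (by omega) (X n ω) z han hω'
    refine ⟨y, hy1, hy2, fun i => ?_⟩
    have h1 : ∑ j, (X n ω i j + (if i = j then -((a n : ℂ) * z) else 0) +
        (if i = j then (t : ℂ) else 0)) * y j =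
        ∑ j, (X n ω i j + if i = j then -((a n : ℂ) * z) else 0) * y j + t * y i := by
      simp only [add_mul _ (ite _ _ _) (y _), Finset.sum_add_distrib, ite_mul, zero_mul]
      simp
    rw [h1]
    have h2 : ‖(t : ℂ) * y i‖ ≤ σ / 2 := by
      rw [norm_mul, Complex.norm_real, Real.norm_eq_abs, abs_of_pos ht0]
      calc t * ‖y i‖ ≤ t * 1 := by gcongr; exact hy1 i
        _ ≤ σ / 2 := by linarith
    have h3 : a n * (((n : ℝ) ^ R)⁻¹ * n) ≤ σ / 2 := by
      calc a n * (((n : ℝ) ^ R)⁻¹ * n) ≤ (n : ℝ) ^ B * (((n : ℝ) ^ R)⁻¹ * n) := by gcongr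
        _ = σ * (n : ℝ)⁻¹ := by rw [hσ, hR]; field_simp; ring
        _ ≤ σ * (1 / 2) := by
            gcongr
            rw [inv_le_comm₀ hn0 (by norm_num)]
            linarith
        _ = σ / 2 := by ring
    calc _ ≤ σ / 2 + σ / 2 := (norm_add_le _ _).trans (add_le_add ((hy i).trans h3) h2)
      _ = σ := by ring
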